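/- Let $\mathcal H$ be a finite-dimensional Hilbert space and let $\mathcal L(\mathcal H)_+$ be the set of non-zero positive semidefinite operators on $\mathcal H$. For positive definite $\varrho,\sigma$ and $\alpha\in(0,\infty)$ put $$Q_\alpha(\varrho\|\sigma)=\operatorname{Tr}\varrho^\alpha\sigma^{1-\alpha},\quad Q^*_\alpha(\varrho\|\sigma)=\operatorname{Tr}\bigl(\varrho^{1/2}\sigma^{\frac{1-\alpha}{\alpha}}\varrho^{1/2}\bigr)^\alpha,\quad Q^\flat_\alpha(\varrho\|\sigma)=\operatorname{Tr}e^{\alpha\log\varrho+(1-\alpha)\log\sigma}$$ (the Petz, the sandwiched and the log-Euclidean, or $\flat$, version), and let $(t)$ stand for the empty superscript, $*$ or $\flat$. For $\varrho,\sigma\in\mathcal L(\mathcal H)_+$ define, with $\log$ the natural logarithm, $\log 0=-\infty$ and $\log(+\infty)=+\infty$: - $Q^{(t)}_\alpha(\varrho\|\sigma)=\lim_{\varepsilon\searrow0}Q^{(t)}_\alpha(\varrho+\varepsilon I\|\sigma+\varepsilon I)\in[0,+\infty]$ for $\alpha>0$, and $Q^{(t)}_0=\lim_{\alpha\searrow0}Q^{(t)}_\alpha$;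 - $\psi^{(t)}_\alpha(\varrho\|\sigma)=\log Q^{(t)}_\alpha(\varrho\|\sigma)$ for $\alpha\ge0$; - $D^{(t)}_\alpha(\varrho\|\sigma)=\frac{1}{\alpha-1}\psi^{(t)}_\alpha(\varrho\|\sigma)-\frac1{\alpha-1}\log\operatorname{Tr}\varrho$ for $\alpha\in(0,\infty)\setminus\{1\}$, and $D^{(t)}_0=\lim_{\alpha\searrow0}D^{(t)}_\alpha$, $D^{(t)}_1=\lim_{\alpha\to1}D^{(t)}_\alpha$, $D^{(t)}_\infty=\lim_{\alpha\to+\infty}D^{(t)}_\alpha$. Let $s(\alpha)=1$ for $\alpha\ge1$ and $s(\alpha)=-1$ for $\alpha<1$. **Proposition.** Let $\varrho\in\mathcal L(\mathcal H)_+$. For $(t)=\flat$ and $\alpha\in[0,+\infty)$, for $(t)=*$ and $\alpha\in[1/2,+\infty)$, and for the empty superscript and $\alpha\in[0,2]$, the limits that define $Q^{(t)}_\alpha(\varrho\|\sigma)$ and $D^{(t)}_\alpha(\varrho\|\sigma)$ exist in $[-\infty,+\infty]$ for every $\sigma\in\mathcal L(\mathcal H)_+$, and the functions $$\sigma\mapsto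 s(\alpha)Q^{(t)}_\alpha(\varrho\|\sigma),\qquad \sigma\mapsto s(\alpha)\psi^{(t)}_\alpha(\varrho\|\sigma),\qquad \sigma\mapsto D^{(t)}_\alpha(\varrho\|\sigma)$$ are convex on $\mathcal L(\mathcal H)_+$. Moreover, the limits $D^\flat_\infty(\varrho\|\sigma)$ and $D^*_\infty(\varrho\|\sigma)$ exist for every $\sigma\in\mathcal L(\mathcal H)_+$, and $\sigma\mapsto D^\flat_\infty(\varrho\|\sigma)$ and $\sigma\mapsto D^*_\infty(\varrho\|\sigma)$ are convex on $\mathcal L(\mathcal H)_+$. -/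

import Mathlib

open Filter Topology

open scoped ENNReal

noncomputable section

namespace QRenyi

/-- The three families of quantum Rényi quantities: Petz (no superscript), sandwiched
(superscript `*`) and log-Euclidean (superscript `♭`). -/
inductive Family where
  | petz
  | sandwiched
  | flat

variable {H : Type*} [NormedAddCommGroup H] [InnerProductSpace ℂ H] [CompleteSpace H]

/-- The set of non-zero positive semidefinite operators on `H`
(`≤` is the positive semidefinite order). -/
def posOp (H : Type*) [NormedAddCommGroup H] [InnerProductSpace ℂ H] [CompleteSpace H] :
    Set (H →L[ℂ] H) :=
  {A | 0 ≤ A ∧ A ≠ 0}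

/-- The real part of the trace (all traces taken below are real and non-negative). -/
def tr (A : H →L[ℂ] H) : ℝ := (LinearMap.trace ℂ H (A : H →ₗ[ℂ] H)).re

/-- The closed formulas for `Q_α(ρ‖σ)`, `Q_α^*(ρ‖σ)`, `Q_α^♭(ρ‖σ)`, used for positive definite
`ρ`, `σ` and `α > 0` only. Powers and logarithm are those of the functional calculus. -/
def formulaQ (t : Family) (α : ℝ) (ρ σ : H →L[ℂ] H) : ℝ :=
  match t with
  | .petz => tr (ρ ^ α * σ ^ (1 - α))
  | .sandwiched => tr ((ρ ^ (1 / 2 : ℝ) * σ ^ ((1 - α) / α) * ρ ^ (1 / 2 : ℝ)) ^ α)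
  | .flat => tr (NormedSpace.exp (α • CFC.log ρ + (1 - α) • CFC.log σ))

/-- `Q_α(ρ + εI ‖ σ + εI)`, as an extended non-negative real. -/
def regQ (t : Family) (α : ℝ) (ρ σ : H →L[ℂ] H) (ε : ℝ) : ℝ≥0∞ :=
  ENNReal.ofReal (formulaQ t α (ρ + ε • (1 : H →L[ℂ] H)) (σ + ε • (1 : H →L[ℂ] H)))

/-- `Q_α(ρ‖σ) ∈ [0, ∞]` for positive semidefinite `ρ`, `σ` and `α > 0`:
the limit of `Q_α(ρ + εI ‖ σ + εI)` as `ε ↘ 0`. -/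
def posQ (t : Family) (α : ℝ) (ρ σ : H →L[ℂ] H) : ℝ≥0∞ :=
  limUnder (𝓝[>] (0 : ℝ)) (regQ t α ρ σ)

/-- `Q_α(ρ‖σ) ∈ [0, ∞]` for `α ≥ 0`, where `Q_0` is the limit of `Q_α` as `α ↘ 0`. -/
def Q (t : Family) (α : ℝ) (ρ σ : H →L[ℂ] H) : ℝ≥0∞ :=
  if α = 0 then limUnder (𝓝[>] (0 : ℝ)) (fun a => posQ t a ρ σ) else posQ t α ρ σ

/-- The limit that defines `Q_α(ρ‖σ)` exists. -/
def QLimitExists (t : Family) (α : ℝ) (ρ σ : H →L[ℂ] H) : Prop :=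
  if α = 0 then ∃ q, Tendsto (fun a => posQ t a ρ σ) (𝓝[>] (0 : ℝ)) (𝓝 q)
  else ∃ q, Tendsto (regQ t α ρ σ) (𝓝[>] (0 : ℝ)) (𝓝 q)

/-- `ψ_α(ρ‖σ) = log Q_α(ρ‖σ) ∈ [-∞, ∞]`, with `log 0 = -∞` and `log ∞ = ∞`. -/
def psi (t : Family) (α : ℝ) (ρ σ : H →L[ℂ] H) : EReal := ENNReal.log (Q t α ρ σ)

/-- The Rényi divergence for `α ∈ (0, ∞) \ {1}`. -/
def genericD (t : Family) (α : ℝ) (ρ σ : H →L[ℂ] H) : EReal :=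
  ((1 / (α - 1) : ℝ) : EReal) * psi t α ρ σ - ((1 / (α - 1) * Real.log (tr ρ) : ℝ) : EReal)

/-- The Rényi divergence for `α ∈ [0, ∞)`, extended to `α = 0` and `α = 1` by taking limits. -/
def D (t : Family) (α : ℝ) (ρ σ : H →L[ℂ] H) : EReal :=
  if α = 0 then limUnder (𝓝[>] (0 : ℝ)) (fun a => genericD t a ρ σ)
  else if α = 1 then limUnder (𝓝[≠] (1 : ℝ)) (fun a => genericD t a ρ σ)
  else genericD t α ρ σ

/-- The limit that defines `D_α(ρ‖σ)` exists (no condition unless `α` is `0` or `1`). -/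
def DLimitExists (t : Family) (α : ℝ) (ρ σ : H →L[ℂ] H) : Prop :=
  (α = 0 → ∃ d, Tendsto (fun a => genericD t a ρ σ) (𝓝[>] (0 : ℝ)) (𝓝 d)) ∧
  (α = 1 → ∃ d, Tendsto (fun a => genericD t a ρ σ) (𝓝[≠] (1 : ℝ)) (𝓝 d))

/-- `D_∞(ρ‖σ)`, the limit of `D_α(ρ‖σ)` as `α → ∞`. -/
def DInf (t : Family) (ρ σ : H →L[ℂ] H) : EReal :=
  limUnder atTop (fun α : ℝ => D t α ρ σ)

/-- The limit that defines `D_∞(ρ‖σ)` exists. -/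
def DInfLimitExists (t : Family) (ρ σ : H →L[ℂ] H) : Prop :=
  ∃ d, Tendsto (fun α : ℝ => D t α ρ σ) atTop (𝓝 d)

/-- The sign `s(α)`. -/
def s (α : ℝ) : ℝ := if 1 ≤ α then 1 else -1

/-- Convexity on the set of non-zero positive semidefinite operators of an extended-real-valued
function. In `EReal`, `⊤ + ⊥ = ⊥`, which is the strongest reading of the inequality. -/
def ConvexOnPosOp (f : (H →L[ℂ] H) → EReal) : Prop :=
  ∀ σ₁ ∈ posOp H, ∀ σ₂ ∈ posOp H, ∀ a b : ℝ, 0 < a → 0 < b → a + b = 1 →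
    f (a • σ₁ + b • σ₂) ≤ (a : EReal) * f σ₁ + (b : EReal) * f σ₂

/-- The values of `α` for which convexity is claimed: `[0, 2]` for the Petz family, `[1/2, ∞)`
for the sandwiched family, and `[0, ∞)` for the log-Euclidean family. -/
def convexityRange : Family → Set ℝ
  | .petz => Set.Icc 0 2
  | .sandwiched => Set.Ici (1 / 2)
  | .flat => Set.Ici 0

end QRenyi

end

noncomputable section

set_option linter.unusedSectionVars false

namespace QRenyi

/-! ### Quadratic forms, traces and the functional calculus in finite dimension -/

section Basics

variable {H : Type*} [NormedAddCommGroup H] [InnerProductSpace ℂ H] [CompleteSpace H]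

/-! For positive definite operators, convexity comes from operator inequalities. Powers with
exponent in [0, 1] and the logarithm are operator concave, powers with exponent in [-1, 0] are
operator convex, and the trace of an increasing convex or concave function transports such
inequalities. Hence Q is convex in σ for α > 1 (`formulaQ_comb_le`) and concave for α < 1
(`formulaQ_comb_ge`); the ranges of α for the Petz and sandwiched families keep the exponent of σ in
[-1, 1]. The log-Euclidean family with α < 1 needs Lieb's concavity theorem (`lieb_concave`). That
theorem follows from the Gibbs variational formula for Tr exp, whose objective is jointly concave
because relative entropy is jointly convex (`relEnt_comb_le`). Relative entropy in turn is an
integral of quadratic-over-linear expressions, each a supremum of functionals linear in the pair of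
operators.

For α > 1, convexity of Q does not by itself bound log Q from the right side. But Q is homogeneous
of degree 1 - α in σ, so Q ^ (1 / (1 - α)) has degree one. Rescaling both arguments to Q = 1 turns
the convexity or concavity of Q into superadditivity of this power (`formulaQ_rpow_superadditive`).
Taking logarithms, (1 - α)⁻¹ log Q is concave, which serves ψ and D together.

For singular operators the inequalities pass to the limit ε ↘ 0, and then to the limits of α at 0, 1
and ∞. Two facts are needed. The limits must exist. For 0 < α < 1, or when supp ρ ⊆ supp σ, the
limit in ε is the finite `limQ`; without the inclusion it is Tr ρ at α = 1 and ∞ for α > 1. With the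
inclusion, D near α = 1 is a difference quotient of log `limQ`, which is differentiable there.
Without it, `limQ` at 1 is strictly below Tr ρ (`limQ_one_lt`) and D tends to ∞ from both sides. As
α → ∞, a largest eigenvalue governs the growth. Moreover, no limiting value on the right of an
inequality may be -∞, since addition of extended reals is discontinuous at ∞ + (-∞)
(`le_of_tendsto_comb`); for α > 1 this rests on `limQ_pos`. -/

/-- The real quadratic form `v ↦ re ⟪v, A v⟫` of an operator. -/
def qf (A : H →L[ℂ] H) (v : H) : ℝ := (inner ℂ v (A v)).re

lemma qf_add (A B : H →L[ℂ] H) (v : H) : qf (A + B) v = qf A v + qf B v := by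
  simp [qf]

lemma qf_sub (A B : H →L[ℂ] H) (v : H) : qf (A - B) v = qf A v - qf B v := by
  simp [qf]

lemma qf_smul (r : ℝ) (A : H →L[ℂ] H) (v : H) : qf (r • A) v = r * qf A v := by
  simp [qf, inner_smul_right_eq_smul]

lemma qf_one (v : H) : qf (1 : H →L[ℂ] H) v = ‖v‖ ^ 2 := by
  simp [qf, inner_self_eq_norm_sq_to_K, ← Complex.ofReal_pow]

lemma qf_mono {A B : H →L[ℂ] H} (h : A ≤ B) (v : H) : qf A v ≤ qf B v := by
  have := (ContinuousLinearMap.le_def A B).1 h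
  have h2 := this.re_inner_nonneg_right v
  have h3 : 0 ≤ qf (B - A) v := h2
  rw [qf_sub] at h3
  linarith

lemma qf_nonneg {A : H →L[ℂ] H} (h : 0 ≤ A) (v : H) : 0 ≤ qf A v := by
  simpa [qf] using qf_mono h v

lemma le_of_qf_le {A B : H →L[ℂ] H} (hA : IsSelfAdjoint A) (hB : IsSelfAdjoint B)
    (h : ∀ v, qf A v ≤ qf B v) : A ≤ B := by
  rw [ContinuousLinearMap.le_def, ContinuousLinearMap.isPositive_def']
  refine ⟨hB.sub hA, fun v => ?_⟩
  have h1 := h v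
  have h2 : (B - A).reApplyInnerSelf v = qf (B - A) v := by
    rw [ContinuousLinearMap.reApplyInnerSelf_apply, qf]
    exact inner_re_symm (𝕜 := ℂ) _ _
  rw [h2, qf_sub]
  linarith

lemma qf_abs_le (A : H →L[ℂ] H) (v : H) : |qf A v| ≤ ‖A‖ * ‖v‖ ^ 2 := by
  calc |qf A v| ≤ ‖inner ℂ v (A v)‖ := Complex.abs_re_le_norm _
    _ ≤ ‖v‖ * ‖A v‖ := norm_inner_le_norm _ _
    _ ≤ ‖v‖ * (‖A‖ * ‖v‖) := by gcongr; exact A.le_opNorm v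
    _ = _ := by ring

lemma isSelfAdjoint_smul_real (r : ℝ) {A : H →L[ℂ] H} (hA : IsSelfAdjoint A) :
    IsSelfAdjoint (r • A) := (IsSelfAdjoint.all r).smul hA

lemma le_norm_smul_one {A : H →L[ℂ] H} (hA : IsSelfAdjoint A) :
    A ≤ ‖A‖ • (1 : H →L[ℂ] H) := by
  refine le_of_qf_le hA (isSelfAdjoint_smul_real _ (IsSelfAdjoint.one _)) fun v => ?_
  rw [qf_smul, qf_one]
  exact (le_abs_self _).trans (qf_abs_le A v)

lemma qf_conj {A B : H →L[ℂ] H} (hA : IsSelfAdjoint A) (v : H) :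
    qf (A * B * A) v = qf B (A v) := by
  have h : inner ℂ v (A (B (A v))) = inner ℂ (A v) (B (A v)) := by
    have := ContinuousLinearMap.adjoint_inner_left A (B (A v)) v
    rw [ContinuousLinearMap.isSelfAdjoint_iff'.1 hA] at this
    exact this.symm
  simp [qf, mul_apply_eq_comp, h]

lemma isSelfAdjoint_conj {A B : H →L[ℂ] H} (hA : IsSelfAdjoint A) (hB : IsSelfAdjoint B) :
    IsSelfAdjoint (A * B * A) := by
  have := hB.conjugate A
  rwa [hA.star_eq] at this

lemma conj_mono {A B C : H →L[ℂ] H} (hC : IsSelfAdjoint C) (h : A ≤ B) :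
    C * A * C ≤ C * B * C := by
  have := star_left_conjugate_le_conjugate h C
  rwa [hC.star_eq] at this

lemma continuous_qf (v : H) : Continuous fun A : H →L[ℂ] H => qf A v := by
  unfold qf
  fun_prop

variable [FiniteDimensional ℂ H]

lemma tr_eq_sum {ι : Type*} [Fintype ι] (b : OrthonormalBasis ι ℂ H) (A : H →L[ℂ] H) :
    tr A = ∑ i, qf A (b i) := by
  rw [tr, LinearMap.trace_eq_sum_inner _ b]
  simp [qf]

lemma tr_add (A B : H →L[ℂ] H) : tr (A + B) = tr A + tr B := by simp [tr]
lemma tr_sub (A B : H →L[ℂ] H) : tr (A - B) = tr A - tr B := by simp [tr]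

lemma tr_smul (r : ℝ) (A : H →L[ℂ] H) : tr (r • A) = r * tr A := by
  rw [tr_eq_sum (stdOrthonormalBasis ℂ H), tr_eq_sum (stdOrthonormalBasis ℂ H), Finset.mul_sum]
  simp [qf_smul]

lemma tr_mono {A B : H →L[ℂ] H} (h : A ≤ B) : tr A ≤ tr B := by
  rw [tr_eq_sum (stdOrthonormalBasis ℂ H), tr_eq_sum (stdOrthonormalBasis ℂ H)]
  exact Finset.sum_le_sum fun i _ => qf_mono h _

lemma tr_nonneg {A : H →L[ℂ] H} (h : 0 ≤ A) : 0 ≤ tr A := by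
  simpa [tr] using tr_mono h

lemma tr_mul_comm (A B : H →L[ℂ] H) : tr (A * B) = tr (B * A) := by
  unfold tr
  exact congrArg Complex.re (LinearMap.trace_mul_comm ℂ (A : H →ₗ[ℂ] H) (B : H →ₗ[ℂ] H))

lemma continuous_tr : Continuous fun A : H →L[ℂ] H => tr A := by
  have : (fun A : H →L[ℂ] H => tr A) =
      fun A => ∑ i, qf A (stdOrthonormalBasis ℂ H i) := by
    ext A; exact tr_eq_sum _ A
  rw [this]
  exact continuous_finsetSum _ fun i _ => continuous_qf _

/-- Extend `v` to an orthonormal basis; the trace is then a sum of nonnegative terms, one of which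
is the left-hand side. -/
lemma qf_le_tr {A : H →L[ℂ] H} (h : 0 ≤ A) {v : H} (hv : ‖v‖ = 1) : qf A v ≤ tr A := by
  have ho : Orthonormal ℂ ((↑) : ({v} : Set H) → H) := by
    rw [orthonormal_iff_ite]
    rintro ⟨x, hx⟩ ⟨y, hy⟩
    simp only [Set.mem_singleton_iff] at hx hy
    subst hx; subst hy
    simp [inner_self_eq_norm_sq_to_K, hv]
  obtain ⟨u, b, hvu, hb⟩ := ho.exists_orthonormalBasis_extension
  rw [tr_eq_sum b]
  have hmem : v ∈ u := hvu rfl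
  have h2 : qf A v = qf A (b ⟨v, hmem⟩) := by rw [hb]
  rw [h2]
  exact Finset.single_le_sum (f := fun i => qf A (b i)) (fun i _ => qf_nonneg h _)
    (Finset.mem_univ _)

lemma finite_spectrum_real (A : H →L[ℂ] H) : (spectrum ℝ A).Finite := by
  have h1 : (spectrum ℂ A).Finite := by
    have h2 := Module.End.finite_spectrum (K := ℂ) (A : H →ₗ[ℂ] H)
    have h3 := AlgEquiv.spectrum_eq (Module.End.toContinuousLinearMap (𝕜 := ℂ) H) (A : H →ₗ[ℂ] H)
    rw [← h3] at h2
    exact h2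
  have : spectrum ℝ A = (algebraMap ℝ ℂ) ⁻¹' spectrum ℂ A :=
    (spectrum.preimage_algebraMap ℂ).symm
  rw [this]
  exact h1.preimage (FaithfulSMul.algebraMap_injective ℝ ℂ).injOn

lemma continuousOn_spectrum (f : ℝ → ℝ) (A : H →L[ℂ] H) : ContinuousOn f (spectrum ℝ A) :=
  (finite_spectrum_real A).continuousOn f

lemma cfc_mul' (f g : ℝ → ℝ) (A : H →L[ℂ] H) :
    cfc f A * cfc g A = cfc (fun x => f x * g x) A :=
  (cfc_mul f g A (continuousOn_spectrum _ _) (continuousOn_spectrum _ _)).symm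

lemma cfc_add' (f g : ℝ → ℝ) (A : H →L[ℂ] H) :
    cfc f A + cfc g A = cfc (fun x => f x + g x) A :=
  (cfc_add A f g (continuousOn_spectrum _ _) (continuousOn_spectrum _ _)).symm

lemma cfc_smul' (r : ℝ) (f : ℝ → ℝ) (A : H →L[ℂ] H) :
    r • cfc f A = cfc (fun x => r * f x) A :=
  (cfc_smul r f A (continuousOn_spectrum _ _)).symm

lemma one_sub_cfc (f : ℝ → ℝ) {A : H →L[ℂ] H} (hA : IsSelfAdjoint A) :
    1 - cfc f A = cfc (fun x => 1 - f x) A := by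
  rw [cfc_sub (fun _ => 1) f A (continuousOn_spectrum _ _) (continuousOn_spectrum _ _),
    cfc_const_one ℝ A]

lemma cfc_cfc (f g : ℝ → ℝ) {A : H →L[ℂ] H} (hA : IsSelfAdjoint A) :
    cfc g (cfc f A) = cfc (fun x => g (f x)) A :=
  (cfc_comp' g f A (((finite_spectrum_real A).image f).continuousOn g)
    (continuousOn_spectrum _ _)).symm

lemma cfc_add_smul_one (f : ℝ → ℝ) {A : H →L[ℂ] H} (hA : IsSelfAdjoint A) (ε : ℝ) :
    cfc f (A + ε • (1 : H →L[ℂ] H)) = cfc (fun x => f (x + ε)) A := by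
  have : A + ε • (1 : H →L[ℂ] H) = cfc (fun x => x + ε) A := by
    rw [← cfc_add' (fun x => x) (fun _ => ε) A, cfc_id' ℝ A, cfc_const ε A]
    simp [Algebra.algebraMap_eq_smul_one]
  rw [this, cfc_cfc _ _ hA]

/-- The spectrum is finite, so pointwise convergence on it is uniform. -/
lemma tendsto_cfc {X : Type*} {l : Filter X} {F : X → ℝ → ℝ} {f : ℝ → ℝ} {A : H →L[ℂ] H}
    (h : ∀ x ∈ spectrum ℝ A, Tendsto (fun t => F t x) l (𝓝 (f x))) :
    Tendsto (fun t => cfc (F t) A) l (𝓝 (cfc f A)) := by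
  refine tendsto_cfc_fun ?_ (Eventually.of_forall fun t => continuousOn_spectrum _ _)
  rw [Metric.tendstoUniformlyOn_iff]
  intro ε hε
  have : ∀ᶠ t in l, ∀ x ∈ spectrum ℝ A, dist (f x) (F t x) < ε := by
    rw [Filter.eventually_all_finite (finite_spectrum_real A)]
    intro x hx
    have := (Metric.tendsto_nhds.1 (h x hx)) ε hε
    filter_upwards [this] with t ht
    rwa [dist_comm]
  exact this

/-- On the finite spectrum, f(y) = g(y)(y - x) + f(x) for a divided difference g, and A - x
annihilates `v`. No continuity of `f` is needed, nor that `x` be known to lie in the spectrum. -/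
lemma cfc_apply_eigenvector (f : ℝ → ℝ) {A : H →L[ℂ] H} (hA : IsSelfAdjoint A) {v : H} {x : ℝ}
    (h : A v = (x : ℂ) • v) : cfc f A v = (f x : ℂ) • v := by
  let g : ℝ → ℝ := fun y => (f y - f x) / (y - x)
  have h1 : cfc f A = cfc g A * cfc (fun y => y - x) A + cfc (fun _ => f x) A := by
    rw [cfc_mul', cfc_add']
    refine cfc_congr fun y _ => ?_
    by_cases hy : y = x
    · simp [hy]
    · have : y - x ≠ 0 := sub_ne_zero.2 hy
      simp only [g]; field_simp; ring
  have h2 : cfc (fun y => y - x) A = A - algebraMap ℝ _ x := by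
    rw [cfc_sub (fun y => y) (fun _ => x) A, cfc_id' ℝ A, cfc_const x A]
  rw [h1, h2, cfc_const (f x) A]
  simp [mul_apply_eq_comp, h, Algebra.algebraMap_eq_smul_one]

/-- An orthonormal eigenbasis diagonalizing the whole functional calculus. -/
lemma exists_spectral_basis {A : H →L[ℂ] H} (hA : IsSelfAdjoint A) :
    ∃ (b : OrthonormalBasis (Fin (Module.finrank ℂ H)) ℂ H) (x : Fin (Module.finrank ℂ H) → ℝ),
      (∀ i, x i ∈ spectrum ℝ A) ∧ (∀ y ∈ spectrum ℝ A, ∃ i, x i = y) ∧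
      (∀ (f : ℝ → ℝ) i, cfc f A (b i) = (f (x i) : ℂ) • b i) := by
  have hs : (A : H →ₗ[ℂ] H).IsSymmetric := ContinuousLinearMap.isSelfAdjoint_iff_isSymmetric.1 hA
  let b := hs.eigenvectorBasis rfl
  let x := hs.eigenvalues rfl
  have hb : ∀ i, A (b i) = (x i : ℂ) • b i := fun i => hs.apply_eigenvectorBasis rfl i
  have hcfc : ∀ (f : ℝ → ℝ) i, cfc f A (b i) = (f (x i) : ℂ) • b i :=
    fun f i => cfc_apply_eigenvector f hA (hb i)
  have hne : ∀ i, b i ≠ 0 := fun i => b.orthonormal.ne_zero i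
  refine ⟨b, x, fun i => ?_, fun y hy => ?_, hcfc⟩
  · intro hu
    rw [spectrum.mem_resolventSet_iff] at hu
    obtain ⟨u, hu⟩ := hu
    have h0 : (u : H →L[ℂ] H) (b i) = 0 := by
      rw [hu]; simp [hb, Algebra.algebraMap_eq_smul_one]
    have h1 : ((u⁻¹ : (H →L[ℂ] H)ˣ) : H →L[ℂ] H) ((u : H →L[ℂ] H) (b i)) = b i := by
      rw [← mul_apply_eq_comp, Units.inv_mul]; simp
    rw [h0, map_zero] at h1
    exact hne i h1.symm
  -- If `y` were not among the eigenvalues, the indicator function of `y` applied to `A` would kill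
  -- the whole basis, although spectral mapping puts 1 in its spectrum.
  · by_contra! hcon
    have h0 : cfc (fun z => if z = y then (1 : ℝ) else 0) A = 0 := by
      refine ContinuousLinearMap.coe_injective (b.toBasis.ext fun i => ?_)
      simp [hcfc, hcon i]
    have h1 := cfc_map_spectrum (R := ℝ) (fun z => if z = y then (1 : ℝ) else 0) A hA
      (continuousOn_spectrum _ _)
    have h2 : (1 : ℝ) ∈ spectrum ℝ (cfc (fun z => if z = y then (1 : ℝ) else 0) A) := by
      rw [h1]; exact ⟨y, hy, by simp⟩
    rw [h0] at h2
    have : Nontrivial (H →L[ℂ] H) := by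
      by_contra hnt
      rw [not_nontrivial_iff_subsingleton] at hnt
      simp [spectrum.of_subsingleton] at h2
    simp [spectrum.zero_eq] at h2

end Basics

/-! ### Spectral bases and trace inequalities of Jensen type -/

section Spectral

variable {H : Type*} [NormedAddCommGroup H] [InnerProductSpace ℂ H] [CompleteSpace H]
  [FiniteDimensional ℂ H]

/-- `b` is an orthonormal eigenbasis of `A` with eigenvalues `x`. -/
structure IsSpectralBasis (A : H →L[ℂ] H)
    (b : OrthonormalBasis (Fin (Module.finrank ℂ H)) ℂ H)
    (x : Fin (Module.finrank ℂ H) → ℝ) : Prop where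
  isSelfAdjoint : IsSelfAdjoint A
  mem : ∀ i, x i ∈ spectrum ℝ A
  surj : ∀ y ∈ spectrum ℝ A, ∃ i, x i = y
  apply_cfc : ∀ (f : ℝ → ℝ) i, cfc f A (b i) = (f (x i) : ℂ) • b i

lemma IsSpectralBasis.exists {A : H →L[ℂ] H} (hA : IsSelfAdjoint A) :
    ∃ b x, IsSpectralBasis A b x := by
  obtain ⟨b, x, h1, h2, h3⟩ := exists_spectral_basis hA
  exact ⟨b, x, hA, h1, h2, h3⟩

lemma isSelfAdjoint_cfc (f : ℝ → ℝ) (A : H →L[ℂ] H) : IsSelfAdjoint (cfc f A) :=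
  cfc_predicate f A

variable {A B X : H →L[ℂ] H} {b c : OrthonormalBasis (Fin (Module.finrank ℂ H)) ℂ H}
  {x y : Fin (Module.finrank ℂ H) → ℝ}

lemma IsSpectralBasis.apply (h : IsSpectralBasis A b x) (i) : A (b i) = (x i : ℂ) • b i := by
  have := h.apply_cfc (fun x => x) i
  rwa [cfc_id' ℝ A h.isSelfAdjoint] at this

lemma IsSpectralBasis.qf_cfc (h : IsSpectralBasis A b x) (f : ℝ → ℝ) (v : H) :
    qf (cfc f A) v = ∑ i, f (x i) * ‖inner ℂ (b i) v‖ ^ 2 := by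
  rw [qf, ← b.sum_inner_mul_inner v (cfc f A v), Complex.re_sum]
  refine Finset.sum_congr rfl fun i _ => ?_
  have h1 : inner ℂ (b i) (cfc f A v) = (f (x i) : ℂ) * inner ℂ (b i) v := by
    have h2 := ContinuousLinearMap.adjoint_inner_left (cfc f A) v (b i)
    rw [ContinuousLinearMap.isSelfAdjoint_iff'.1 (isSelfAdjoint_cfc f A), h.apply_cfc] at h2
    rw [← h2, inner_smul_left]
    simp
  rw [h1, ← inner_conj_symm v (b i)]
  have h3 : (starRingEnd ℂ) (inner ℂ (b i) v) * ((f (x i) : ℂ) * inner ℂ (b i) v) =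
      ((f (x i) * ‖inner ℂ (b i) v‖ ^ 2 : ℝ) : ℂ) := by
    push_cast
    rw [← Complex.conj_mul' (inner ℂ (b i) v)]
    ring
  rw [h3, Complex.ofReal_re]

lemma IsSpectralBasis.qf_cfc_self (h : IsSpectralBasis A b x) (f : ℝ → ℝ) (i) :
    qf (cfc f A) (b i) = f (x i) := by
  rw [qf, h.apply_cfc, inner_smul_right]
  simp

lemma IsSpectralBasis.qf_self (h : IsSpectralBasis A b x) (i) : qf A (b i) = x i := by
  have := h.qf_cfc_self (fun x => x) i
  rwa [cfc_id' ℝ A h.isSelfAdjoint] at this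

lemma IsSpectralBasis.tr_cfc (h : IsSpectralBasis A b x) (f : ℝ → ℝ) :
    tr (cfc f A) = ∑ i, f (x i) := by
  rw [tr_eq_sum b]
  exact Finset.sum_congr rfl fun i _ => h.qf_cfc_self f i

lemma IsSpectralBasis.tr_self (h : IsSpectralBasis A b x) : tr A = ∑ i, x i := by
  rw [tr_eq_sum b]
  exact Finset.sum_congr rfl fun i _ => h.qf_self i

/-- Traces of products of functions of two noncommuting operators become scalar double sums with
nonnegative weights. The limits of the Petz quantity and the integral formula for relative entropy
are read off from this. -/
lemma IsSpectralBasis.tr_cfc_mul_cfc (hA : IsSpectralBasis A b x) (hB : IsSpectralBasis B c y)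
    (f g : ℝ → ℝ) : tr (cfc f A * cfc g B) =
      ∑ i, ∑ j, f (x i) * g (y j) * ‖inner ℂ (c j) (b i)‖ ^ 2 := by
  rw [tr_mul_comm, tr_eq_sum b]
  refine Finset.sum_congr rfl fun i _ => ?_
  have h1 : qf (cfc g B * cfc f A) (b i) = f (x i) * qf (cfc g B) (b i) := by
    simp [qf, mul_apply_eq_comp, hA.apply_cfc]
  rw [h1, hB.qf_cfc, Finset.mul_sum]
  exact Finset.sum_congr rfl fun j _ => by ring

lemma sum_sq_norm_inner_eq_one (b : OrthonormalBasis (Fin (Module.finrank ℂ H)) ℂ H) {v : H}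
    (hv : ‖v‖ = 1) : ∑ i, ‖inner ℂ (b i) v‖ ^ 2 = 1 := by
  rw [b.sum_sq_norm_inner_right v, hv, one_pow]

/-- Jensen's inequality for a vector state. -/
lemma le_qf_cfc {f : ℝ → ℝ} {s : Set ℝ} (hf : ConvexOn ℝ s f) (hA : IsSelfAdjoint A)
    (hs : spectrum ℝ A ⊆ s) {v : H} (hv : ‖v‖ = 1) : f (qf A v) ≤ qf (cfc f A) v := by
  obtain ⟨b, x, h⟩ := IsSpectralBasis.exists hA
  have h1 : qf A v = ∑ i, ‖inner ℂ (b i) v‖ ^ 2 • x i := by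
    have := h.qf_cfc (fun x => x) v
    rw [cfc_id' ℝ A hA] at this
    rw [this]
    exact Finset.sum_congr rfl fun i _ => by rw [smul_eq_mul, mul_comm]
  rw [h1, h.qf_cfc]
  refine (hf.map_sum_le (fun i _ => by positivity) (sum_sq_norm_inner_eq_one b hv)
    (fun i _ => hs (h.mem i))).trans_eq ?_
  exact Finset.sum_congr rfl fun i _ => by rw [smul_eq_mul, mul_comm]

/-- In an eigenbasis of `X` the left-hand trace is a sum of `f (qf X (b i))`. The hypothesis bounds
each term by values of `f` at quadratic forms of `X₁` and `X₂`, and Jensen's inequality for vector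
states moves `f` inside the form. Thus trace inequalities need only scalar convexity of `f`. -/
lemma tr_cfc_le_of_qf_le {X₁ X₂ : H →L[ℂ] H} {f : ℝ → ℝ} {s : Set ℝ} (hf : ConvexOn ℝ s f)
    (hX : IsSelfAdjoint X) (hX₁ : IsSelfAdjoint X₁) (hX₂ : IsSelfAdjoint X₂)
    (hs₁ : spectrum ℝ X₁ ⊆ s) (hs₂ : spectrum ℝ X₂ ⊆ s) {a d : ℝ} (ha : 0 ≤ a) (hd : 0 ≤ d)
    (h : ∀ v : H, ‖v‖ = 1 → f (qf X v) ≤ a * f (qf X₁ v) + d * f (qf X₂ v)) :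
    tr (cfc f X) ≤ a * tr (cfc f X₁) + d * tr (cfc f X₂) := by
  obtain ⟨b, x, hb⟩ := IsSpectralBasis.exists hX
  rw [hb.tr_cfc, tr_eq_sum b, tr_eq_sum b, Finset.mul_sum, Finset.mul_sum,
    ← Finset.sum_add_distrib]
  refine Finset.sum_le_sum fun i _ => ?_
  have hn : ‖b i‖ = 1 := b.orthonormal.1 i
  have h1 := h (b i) hn
  rw [hb.qf_self] at h1
  have h2 := le_qf_cfc hf hX₁ hs₁ hn
  have h3 := le_qf_cfc hf hX₂ hs₂ hn
  nlinarith

lemma tr_cfc_mono {f : ℝ → ℝ} {s : Set ℝ} (hf : ConvexOn ℝ s f) (hm : MonotoneOn f s)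
    (hA : IsSelfAdjoint A) (hB : IsSelfAdjoint B) (hsA : spectrum ℝ A ⊆ s)
    (hsB : spectrum ℝ B ⊆ s) (h : A ≤ B) : tr (cfc f A) ≤ tr (cfc f B) := by
  have hmem : ∀ {C : H →L[ℂ] H}, IsSelfAdjoint C → spectrum ℝ C ⊆ s → ∀ v : H, ‖v‖ = 1 →
      qf C v ∈ s := by
    intro C hC hs v hv
    obtain ⟨b, x, hb⟩ := IsSpectralBasis.exists hC
    have h1 : qf C v = ∑ i, ‖inner ℂ (b i) v‖ ^ 2 • x i := by
      have := hb.qf_cfc (fun x => x) v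
      rw [cfc_id' ℝ C hC] at this
      rw [this]
      exact Finset.sum_congr rfl fun i _ => by rw [smul_eq_mul, mul_comm]
    rw [h1]
    exact hf.1.sum_mem (fun i _ => by positivity) (sum_sq_norm_inner_eq_one b hv)
      (fun i _ => hs (hb.mem i))
  have := tr_cfc_le_of_qf_le (a := 1) (d := 0) hf hA hB hB hsB hsB zero_le_one le_rfl
    (fun v hv => by simpa using hm (hmem hA hsA v hv) (hmem hB hsB v hv) (qf_mono h v))
  simpa using this

lemma spectrum_nonneg (hA : 0 ≤ A) : spectrum ℝ A ⊆ Set.Ici 0 := fun _ hx =>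
  spectrum_nonneg_of_nonneg hA hx

lemma spectrum_pos (hA : IsStrictlyPositive A) : spectrum ℝ A ⊆ Set.Ioi 0 := fun _ hx =>
  hA.spectrum_pos hx

lemma isStrictlyPositive_add_smul_one (hA : 0 ≤ A) {ε : ℝ} (hε : 0 < ε) :
    IsStrictlyPositive (A + ε • (1 : H →L[ℂ] H)) := by
  have h1 : IsStrictlyPositive (1 : H →L[ℂ] H) :=
    IsStrictlyPositive.iff_of_unital.2 ⟨zero_le_one, isUnit_one⟩
  exact (h1.smul hε).nonneg_add hA

lemma isStrictlyPositive_comb (hA : IsStrictlyPositive A) (hB : IsStrictlyPositive B) {a d : ℝ}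
    (ha : 0 < a) (hd : 0 < d) : IsStrictlyPositive (a • A + d • B) :=
  (hA.smul ha).add_nonneg (smul_nonneg hd.le hB.nonneg)

lemma isStrictlyPositive_cfc (hA : IsSelfAdjoint A) {f : ℝ → ℝ}
    (hf : ∀ x ∈ spectrum ℝ A, 0 < f x) : IsStrictlyPositive (cfc f A) :=
  (cfc_isStrictlyPositive_iff f A (continuousOn_spectrum _ _) hA).2 hf

lemma cfc_nonneg' {f : ℝ → ℝ} (hf : ∀ x ∈ spectrum ℝ A, 0 ≤ f x) : 0 ≤ cfc f A :=
  cfc_nonneg hf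

lemma tr_pos (hA : 0 ≤ A) (h0 : A ≠ 0) : 0 < tr A := by
  refine (tr_nonneg hA).lt_of_ne fun h => h0 ?_
  obtain ⟨b, x, hb⟩ := IsSpectralBasis.exists (IsSelfAdjoint.of_nonneg hA)
  rw [hb.tr_self, eq_comm, Finset.sum_eq_zero_iff_of_nonneg
    (fun i _ => spectrum_nonneg hA (hb.mem i))] at h
  refine ContinuousLinearMap.coe_injective (b.toBasis.ext fun i => ?_)
  simp [hb.apply, h i]

lemma rpow_eq_cfc (hA : 0 ≤ A) (p : ℝ) : A ^ p = cfc (fun x : ℝ => x ^ p) A :=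
  CFC.rpow_eq_cfc_real hA

lemma exp_eq_cfc (hA : IsSelfAdjoint A) : NormedSpace.exp A = cfc Real.exp A :=
  (CFC.real_exp_eq_normedSpace_exp hA).symm

lemma log_eq_cfc (A : H →L[ℂ] H) : CFC.log A = cfc Real.log A := rfl

end Spectral

/-! ### Joint convexity of relative entropy and Lieb's concavity theorem -/

section Lieb

variable {H : Type*} [NormedAddCommGroup H] [InnerProductSpace ℂ H] [CompleteSpace H]
  [FiniteDimensional ℂ H]

/-- The (generalized) quantum relative entropy
`Tr (τ log τ - τ log σ - τ + σ)` of positive definite operators. -/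
def relEnt (τ σ : H →L[ℂ] H) : ℝ :=
  tr (τ * CFC.log τ) - tr (τ * CFC.log σ) - (tr τ - tr σ)

/-- With m = (1 - t) y + t x, the antiderivative is x log m - (x - y) t, because x - m = (1 - t)(x -
y). -/
lemma mul_log_sub_eq_integral {x y : ℝ} (hx : 0 < x) (hy : 0 < y) :
    x * Real.log x - x * Real.log y - (x - y) =
      ∫ t in (0 : ℝ)..1, (1 - t) * ((x - y) ^ 2 / ((1 - t) * y + t * x)) := by
  have hm : ∀ t ∈ Set.uIcc (0 : ℝ) 1, 0 < (1 - t) * y + t * x := by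
    intro t ht
    rw [Set.uIcc_of_le zero_le_one] at ht
    rcases eq_or_lt_of_le ht.1 with h | h
    · simp [← h, hy]
    · have := mul_nonneg (sub_nonneg.2 ht.2) hy.le
      have := mul_pos h hx
      linarith
  have hd : ∀ t ∈ Set.uIcc (0 : ℝ) 1,
      HasDerivAt (fun t => x * Real.log ((1 - t) * y + t * x) - (x - y) * t)
        ((1 - t) * ((x - y) ^ 2 / ((1 - t) * y + t * x))) t := by
    intro t ht
    have h0 := hm t ht
    have h1 : HasDerivAt (fun t : ℝ => (1 - t) * y + t * x) (x - y) t := by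
      have h3 : (fun t : ℝ => (1 - t) * y + t * x) = fun t => y + (x - y) * t := by
        ext t; ring
      rw [h3]
      exact (((hasDerivAt_id' t).const_mul (x - y)).const_add y).congr_deriv (mul_one _)
    refine (((h1.log h0.ne').const_mul x).sub
      ((hasDerivAt_id' t).const_mul (x - y))).congr_deriv ?_
    have h4 : x - ((1 - t) * y + t * x) = (1 - t) * (x - y) := by ring
    clear h1 hm
    generalize (1 - t) * y + t * x = m at *
    have h5 : m ≠ 0 := h0.ne'
    field_simp
    linear_combination (x - y) * h4
  have hc : ContinuousOn (fun t : ℝ => (1 - t) * ((x - y) ^ 2 / ((1 - t) * y + t * x)))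
      (Set.uIcc 0 1) := by
    refine ContinuousOn.mul (by fun_prop) (ContinuousOn.div (by fun_prop) (by fun_prop) ?_)
    exact fun t ht => (hm t ht).ne'
  rw [intervalIntegral.integral_eq_sub_of_hasDerivAt hd hc.intervalIntegrable]
  simp
  ring

/-- The quadratic-over-linear functional whose mixture over `t` is the relative entropy. -/
def quadOverLin (t : ℝ) (b c : OrthonormalBasis (Fin (Module.finrank ℂ H)) ℂ H)
    (x y : Fin (Module.finrank ℂ H) → ℝ) : ℝ :=
  ∑ i, ∑ j, ‖inner ℂ (c j) (b i)‖ ^ 2 * ((x i - y j) ^ 2 / ((1 - t) * y j + t * x i))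

variable {τ σ : H →L[ℂ] H} {b c : OrthonormalBasis (Fin (Module.finrank ℂ H)) ℂ H}
  {x y : Fin (Module.finrank ℂ H) → ℝ}

lemma comb_pos {t x y : ℝ} (ht : t ∈ Set.Icc (0 : ℝ) 1) (hx : 0 < x) (hy : 0 < y) :
    0 < (1 - t) * y + t * x := by
  rcases eq_or_lt_of_le ht.1 with h | h
  · simp [← h, hy]
  · have := mul_nonneg (sub_nonneg.2 ht.2) hy.le
    have := mul_pos h hx
    linarith

lemma continuousOn_quadOverLin (hx : ∀ i, 0 < x i) (hy : ∀ i, 0 < y i) :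
    ContinuousOn (fun t => (1 - t) * quadOverLin t b c x y) (Set.uIcc 0 1) := by
  unfold quadOverLin
  refine ContinuousOn.mul (by fun_prop) ?_
  refine continuousOn_finsetSum _ fun i _ => continuousOn_finsetSum _ fun j _ => ?_
  refine ContinuousOn.mul (by fun_prop) (ContinuousOn.div (by fun_prop) (by fun_prop) ?_)
  intro t ht
  rw [Set.uIcc_of_le zero_le_one] at ht
  exact (comb_pos ht (hx i) (hy j)).ne'

lemma relEnt_eq_integral (hb : IsSpectralBasis τ b x) (hc : IsSpectralBasis σ c y)
    (hx : ∀ i, 0 < x i) (hy : ∀ i, 0 < y i) :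
    relEnt τ σ = ∫ t in (0 : ℝ)..1, (1 - t) * quadOverLin t b c x y := by
  have h1 : tr (τ * CFC.log τ) =
      ∑ i, ∑ j, (x i * Real.log (x i)) * ‖inner ℂ (c j) (b i)‖ ^ 2 := by
    have := hb.tr_cfc_mul_cfc hc (fun x => x * Real.log x) (fun _ => 1)
    rw [cfc_const_one ℝ σ hc.isSelfAdjoint, mul_one, ← cfc_mul' (fun x => x) Real.log,
      cfc_id' ℝ τ hb.isSelfAdjoint] at this
    simpa [log_eq_cfc] using this
  have h2 : tr (τ * CFC.log σ) =
      ∑ i, ∑ j, (x i * Real.log (y j)) * ‖inner ℂ (c j) (b i)‖ ^ 2 := by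
    have := hb.tr_cfc_mul_cfc hc (fun x => x) Real.log
    rwa [cfc_id' ℝ τ hb.isSelfAdjoint] at this
  have h3 : tr τ = ∑ i, ∑ j, x i * ‖inner ℂ (c j) (b i)‖ ^ 2 := by
    have := hb.tr_cfc_mul_cfc hc (fun x => x) (fun _ => 1)
    rw [cfc_const_one ℝ σ hc.isSelfAdjoint, mul_one, cfc_id' ℝ τ hb.isSelfAdjoint] at this
    simpa using this
  have h4 : tr σ = ∑ i, ∑ j, y j * ‖inner ℂ (c j) (b i)‖ ^ 2 := by
    have := hb.tr_cfc_mul_cfc hc (fun _ => 1) (fun x => x)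
    rw [cfc_const_one ℝ τ hb.isSelfAdjoint, one_mul, cfc_id' ℝ σ hc.isSelfAdjoint] at this
    simpa using this
  have h5 : ∀ i j, IntervalIntegrable (fun t : ℝ => ‖inner ℂ (c j) (b i)‖ ^ 2 *
      ((1 - t) * ((x i - y j) ^ 2 / ((1 - t) * y j + t * x i)))) MeasureTheory.volume 0 1 := by
    intro i j
    refine ContinuousOn.intervalIntegrable ?_
    refine ContinuousOn.mul (by fun_prop) (ContinuousOn.mul (by fun_prop)
      (ContinuousOn.div (by fun_prop) (by fun_prop) ?_))
    intro t ht
    rw [Set.uIcc_of_le zero_le_one] at ht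
    exact (comb_pos ht (hx i) (hy j)).ne'
  have h6 : (fun t : ℝ => (1 - t) * quadOverLin t b c x y) = fun t => ∑ i, ∑ j,
      ‖inner ℂ (c j) (b i)‖ ^ 2 * ((1 - t) * ((x i - y j) ^ 2 / ((1 - t) * y j + t * x i))) := by
    ext t
    simp only [quadOverLin, Finset.mul_sum]
    exact Finset.sum_congr rfl fun i _ => Finset.sum_congr rfl fun j _ => by ring
  rw [h6, intervalIntegral.integral_finsetSum]
  · rw [relEnt, h1, h2, h3, h4, ← Finset.sum_sub_distrib, ← Finset.sum_sub_distrib,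
      ← Finset.sum_sub_distrib]
    refine Finset.sum_congr rfl fun i _ => ?_
    rw [intervalIntegral.integral_finsetSum fun j _ => h5 i j, ← Finset.sum_sub_distrib,
      ← Finset.sum_sub_distrib, ← Finset.sum_sub_distrib]
    refine Finset.sum_congr rfl fun j _ => ?_
    rw [intervalIntegral.integral_const_mul, ← mul_log_sub_eq_integral (hx i) (hy j)]
    ring
  · intro i _
    have h7 := IntervalIntegrable.sum Finset.univ fun j _ => h5 i j
    rwa [Finset.sum_fn] at h7

/-- For each `Y`, a functional of `(τ, σ)`, linear in the pair, bounding `quadOverLin` from below. -/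
def linMinorant (t : ℝ) (Y τ σ : H →L[ℂ] H) : ℝ :=
  2 * tr (star Y * (τ - σ)) - (1 - t) * tr (star Y * Y * σ) - t * tr (star Y * τ * Y)

lemma linMinorant_comb (t : ℝ) (Y τ₁ τ₂ σ₁ σ₂ : H →L[ℂ] H) (a d : ℝ) :
    linMinorant t Y (a • τ₁ + d • τ₂) (a • σ₁ + d • σ₂) =
      a * linMinorant t Y τ₁ σ₁ + d * linMinorant t Y τ₂ σ₂ := by
  simp only [linMinorant, mul_add, mul_sub, add_mul, tr_add, tr_sub, mul_smul_comm, smul_mul_assoc,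
    tr_smul]
  ring

lemma linMinorant_eq (hb : IsSpectralBasis τ b x) (hc : IsSpectralBasis σ c y) (t : ℝ)
    (Y : H →L[ℂ] H) : linMinorant t Y τ σ = ∑ i, ∑ j,
      (2 * ((x i - y j) * (inner ℂ (Y (c j)) (b i) * inner ℂ (b i) (c j)).re) -
        ((1 - t) * y j + t * x i) * ‖inner ℂ (b i) (Y (c j))‖ ^ 2) := by
  have hstar : ∀ u v : H, inner ℂ u (star Y v) = inner ℂ (Y u) v := fun u v =>
    ContinuousLinearMap.adjoint_inner_right Y u v
  have h1 : tr (star Y * (τ - σ)) =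
      ∑ j, ∑ i, (x i - y j) * (inner ℂ (Y (c j)) (b i) * inner ℂ (b i) (c j)).re := by
    rw [tr_eq_sum c]
    refine Finset.sum_congr rfl fun j _ => ?_
    rw [qf, mul_apply_eq_comp, hstar, ← b.sum_inner_mul_inner, Complex.re_sum]
    refine Finset.sum_congr rfl fun i _ => ?_
    have h2 : inner ℂ (b i) ((τ - σ) (c j)) = ((x i - y j : ℝ) : ℂ) * inner ℂ (b i) (c j) := by
      have h3 : inner ℂ (b i) (τ (c j)) = (x i : ℂ) * inner ℂ (b i) (c j) := by
        have := ContinuousLinearMap.adjoint_inner_left τ (c j) (b i)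
        rw [ContinuousLinearMap.isSelfAdjoint_iff'.1 hb.isSelfAdjoint, hb.apply] at this
        rw [← this, inner_smul_left]
        simp
      rw [sub_apply, inner_sub_right, h3, hc.apply, inner_smul_right]
      push_cast; ring
    rw [h2, mul_left_comm, Complex.re_ofReal_mul]
  have h2 : tr (star Y * Y * σ) = ∑ j, ∑ i, y j * ‖inner ℂ (b i) (Y (c j))‖ ^ 2 := by
    rw [tr_eq_sum c]
    refine Finset.sum_congr rfl fun j _ => ?_
    rw [qf, mul_apply_eq_comp, mul_apply_eq_comp, hstar,
      hc.apply, map_smul, inner_smul_right, Complex.re_ofReal_mul, ← Finset.mul_sum,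
      b.sum_sq_norm_inner_right]
    simp [inner_self_eq_norm_sq_to_K, ← Complex.ofReal_pow]
  have h3 : tr (star Y * τ * Y) = ∑ j, ∑ i, x i * ‖inner ℂ (b i) (Y (c j))‖ ^ 2 := by
    rw [tr_eq_sum c]
    refine Finset.sum_congr rfl fun j _ => ?_
    have := hb.qf_cfc (fun x => x) (Y (c j))
    rw [cfc_id' ℝ τ hb.isSelfAdjoint] at this
    rw [← this, qf, mul_apply_eq_comp, mul_apply_eq_comp, hstar, qf]
  rw [linMinorant, h1, h2, h3, Finset.sum_comm, Finset.sum_comm (f := fun j i => y j * _),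
    Finset.sum_comm (f := fun j i => x i * _), Finset.mul_sum, Finset.mul_sum, Finset.mul_sum,
    ← Finset.sum_sub_distrib, ← Finset.sum_sub_distrib]
  refine Finset.sum_congr rfl fun i _ => ?_
  rw [Finset.mul_sum, Finset.mul_sum, Finset.mul_sum,
    ← Finset.sum_sub_distrib, ← Finset.sum_sub_distrib]
  exact Finset.sum_congr rfl fun j _ => by ring

/-- The comparison is made for each pair of eigenvectors by completing the square: 2dqp - mp² ≤
(qd)² / m, with d = |x i - y j| and m > 0. -/
lemma linMinorant_le (hb : IsSpectralBasis τ b x) (hc : IsSpectralBasis σ c y)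
    (hx : ∀ i, 0 < x i) (hy : ∀ i, 0 < y i) {t : ℝ} (ht : t ∈ Set.Icc (0 : ℝ) 1)
    (Y : H →L[ℂ] H) : linMinorant t Y τ σ ≤ quadOverLin t b c x y := by
  rw [linMinorant_eq hb hc]
  refine Finset.sum_le_sum fun i _ => Finset.sum_le_sum fun j _ => ?_
  have hm := comb_pos ht (hx i) (hy j)
  set m := (1 - t) * y j + t * x i
  set p := ‖inner ℂ (b i) (Y (c j))‖ with hp
  set q := ‖inner ℂ (c j) (b i)‖ with hq
  have h1 : |(inner ℂ (Y (c j)) (b i) * inner ℂ (b i) (c j)).re| ≤ p * q := by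
    refine (Complex.abs_re_le_norm _).trans_eq ?_
    rw [norm_mul, hp, hq, norm_inner_symm, norm_inner_symm (b i) (c j)]
  have h2 : (x i - y j) * (inner ℂ (Y (c j)) (b i) * inner ℂ (b i) (c j)).re ≤
      |x i - y j| * (p * q) :=
    (le_abs_self _).trans (by rw [abs_mul]; gcongr)
  have h3 : q ^ 2 * ((x i - y j) ^ 2 / m) = (q * |x i - y j|) ^ 2 / m := by
    rw [mul_pow, sq_abs]; ring
  have h4 : 0 ≤ (q * |x i - y j| - m * p) ^ 2 / m := by positivity
  have h5 : (q * |x i - y j| - m * p) ^ 2 / m =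
      (q * |x i - y j|) ^ 2 / m - 2 * (|x i - y j| * (p * q)) + m * p ^ 2 := by
    field_simp
    ring
  linarith

/-- The maximizer solves (1 - t) Y σ + t τ Y = τ - σ, an equation that is diagonal in the two
eigenbases; `e i j` are the resulting matrix entries. -/
lemma exists_linMinorant_eq (hb : IsSpectralBasis τ b x) (hc : IsSpectralBasis σ c y)
    (hx : ∀ i, 0 < x i) (hy : ∀ i, 0 < y i) {t : ℝ} (ht : t ∈ Set.Icc (0 : ℝ) 1) :
    ∃ Y, linMinorant t Y τ σ = quadOverLin t b c x y := by
  let e : Fin (Module.finrank ℂ H) → Fin (Module.finrank ℂ H) → ℂ := fun i j =>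
    (((x i - y j) / ((1 - t) * y j + t * x i) : ℝ) : ℂ) * inner ℂ (b i) (c j)
  let Y : H →L[ℂ] H :=
    LinearMap.toContinuousLinearMap (c.toBasis.constr ℂ fun j => ∑ i, e i j • b i)
  have hY : ∀ i j, inner ℂ (b i) (Y (c j)) = e i j := by
    intro i j
    have h1 : Y (c j) = ∑ i, e i j • b i := by
      have := c.toBasis.constr_basis ℂ (fun j => ∑ i, e i j • b i) j
      rw [c.coe_toBasis] at this
      exact this
    rw [h1, b.orthonormal.inner_right_fintype]
  refine ⟨Y, ?_⟩
  rw [linMinorant_eq hb hc]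
  refine Finset.sum_congr rfl fun i _ => Finset.sum_congr rfl fun j _ => ?_
  have hm := comb_pos ht (hx i) (hy j)
  rw [← inner_conj_symm (Y (c j)) (b i), hY]
  simp only [e]
  set m := (1 - t) * y j + t * x i
  have h1 : (starRingEnd ℂ) ((((x i - y j) / m : ℝ) : ℂ) * inner ℂ (b i) (c j)) *
      inner ℂ (b i) (c j) = (((x i - y j) / m * ‖inner ℂ (c j) (b i)‖ ^ 2 : ℝ) : ℂ) := by
    rw [map_mul, Complex.conj_ofReal, mul_assoc, Complex.conj_mul', norm_inner_symm]
    push_cast; ring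
  rw [h1, Complex.ofReal_re, norm_mul, Complex.norm_real, norm_inner_symm (b i) (c j), mul_pow,
    Real.norm_eq_abs, sq_abs]
  field_simp
  ring

lemma IsSpectralBasis.pos (hb : IsSpectralBasis τ b x) (h : IsStrictlyPositive τ) (i) : 0 < x i :=
  spectrum_pos h (hb.mem i)

/-- Joint convexity of the relative entropy. -/
lemma relEnt_comb_le {τ₁ τ₂ σ₁ σ₂ : H →L[ℂ] H} (hτ₁ : IsStrictlyPositive τ₁)
    (hτ₂ : IsStrictlyPositive τ₂) (hσ₁ : IsStrictlyPositive σ₁) (hσ₂ : IsStrictlyPositive σ₂)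
    {a d : ℝ} (ha : 0 < a) (hd : 0 < d) :
    relEnt (a • τ₁ + d • τ₂) (a • σ₁ + d • σ₂) ≤ a * relEnt τ₁ σ₁ + d * relEnt τ₂ σ₂ := by
  have hτ := isStrictlyPositive_comb hτ₁ hτ₂ ha hd
  have hσ := isStrictlyPositive_comb hσ₁ hσ₂ ha hd
  obtain ⟨b, x, hb⟩ := IsSpectralBasis.exists hτ.isSelfAdjoint
  obtain ⟨c, y, hc⟩ := IsSpectralBasis.exists hσ.isSelfAdjoint
  obtain ⟨b₁, x₁, hb₁⟩ := IsSpectralBasis.exists hτ₁.isSelfAdjoint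
  obtain ⟨c₁, y₁, hc₁⟩ := IsSpectralBasis.exists hσ₁.isSelfAdjoint
  obtain ⟨b₂, x₂, hb₂⟩ := IsSpectralBasis.exists hτ₂.isSelfAdjoint
  obtain ⟨c₂, y₂, hc₂⟩ := IsSpectralBasis.exists hσ₂.isSelfAdjoint
  rw [relEnt_eq_integral hb hc (hb.pos hτ) (hc.pos hσ),
    relEnt_eq_integral hb₁ hc₁ (hb₁.pos hτ₁) (hc₁.pos hσ₁),
    relEnt_eq_integral hb₂ hc₂ (hb₂.pos hτ₂) (hc₂.pos hσ₂)]
  have i0 := (continuousOn_quadOverLin (b := b) (c := c)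
    (hb.pos hτ) (hc.pos hσ)).intervalIntegrable (μ := MeasureTheory.volume)
  have i1 := (continuousOn_quadOverLin (b := b₁) (c := c₁)
    (hb₁.pos hτ₁) (hc₁.pos hσ₁)).intervalIntegrable (μ := MeasureTheory.volume)
  have i2 := (continuousOn_quadOverLin (b := b₂) (c := c₂)
    (hb₂.pos hτ₂) (hc₂.pos hσ₂)).intervalIntegrable (μ := MeasureTheory.volume)
  rw [← intervalIntegral.integral_const_mul, ← intervalIntegral.integral_const_mul,
    ← intervalIntegral.integral_add (i1.const_mul a) (i2.const_mul d)]
  refine intervalIntegral.integral_mono_on zero_le_one i0 ((i1.const_mul a).add (i2.const_mul d))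
    fun t ht => ?_
  -- The `Y` that is optimal for the mixture serves as a test operator for both components, and
  -- linearity in the pair does the rest.
  obtain ⟨Y, hY⟩ := exists_linMinorant_eq hb hc (hb.pos hτ) (hc.pos hσ) ht
  have h1 := linMinorant_le hb₁ hc₁ (hb₁.pos hτ₁) (hc₁.pos hσ₁) ht Y
  have h2 := linMinorant_le hb₂ hc₂ (hb₂.pos hτ₂) (hc₂.pos hσ₂) ht Y
  rw [← hY, linMinorant_comb]
  have h3 := mul_le_mul_of_nonneg_left h1 ha.le
  have h4 := mul_le_mul_of_nonneg_left h2 hd.le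
  have h5 := mul_le_mul_of_nonneg_left (add_le_add h3 h4) (sub_nonneg.2 ht.2)
  linarith

lemma relEnt_nonneg (hτ : IsStrictlyPositive τ) (hσ : IsStrictlyPositive σ) : 0 ≤ relEnt τ σ := by
  obtain ⟨b, x, hb⟩ := IsSpectralBasis.exists hτ.isSelfAdjoint
  obtain ⟨c, y, hc⟩ := IsSpectralBasis.exists hσ.isSelfAdjoint
  rw [relEnt_eq_integral hb hc (hb.pos hτ) (hc.pos hσ)]
  refine intervalIntegral.integral_nonneg zero_le_one fun t ht => ?_
  refine mul_nonneg (sub_nonneg.2 ht.2) (Finset.sum_nonneg fun i _ => Finset.sum_nonneg fun j _ => ?_)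
  have := comb_pos ht (hb.pos hτ i) (hc.pos hσ j)
  positivity

lemma isStrictlyPositive_exp {X : H →L[ℂ] H} (hX : IsSelfAdjoint X) :
    IsStrictlyPositive (NormedSpace.exp X) := by
  rw [exp_eq_cfc hX]
  exact isStrictlyPositive_cfc hX fun x _ => Real.exp_pos x

/-- The Gibbs variational inequality. -/
lemma gibbs_le {X : H →L[ℂ] H} (hX : IsSelfAdjoint X) (hτ : IsStrictlyPositive τ) :
    tr τ + tr (τ * X) - tr (τ * CFC.log τ) ≤ tr (NormedSpace.exp X) := by
  have := relEnt_nonneg hτ (isStrictlyPositive_exp hX)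
  rw [relEnt, CFC.log_exp X hX] at this
  linarith

lemma isSelfAdjoint_log (A : H →L[ℂ] H) : IsSelfAdjoint (CFC.log A) := isSelfAdjoint_cfc _ _

/-- Klein's inequality for the exponential. -/
lemma klein_exp {X Z : H →L[ℂ] H} (hX : IsSelfAdjoint X) (hZ : IsSelfAdjoint Z) :
    tr (NormedSpace.exp Z) + tr (NormedSpace.exp Z * (X - Z)) ≤ tr (NormedSpace.exp X) := by
  have := gibbs_le hX (isStrictlyPositive_exp hZ)
  rw [CFC.log_exp Z hZ] at this
  rw [mul_sub, tr_sub]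
  linarith

/-- Lieb's concavity theorem for `σ ↦ Tr exp (L + c log σ)`. -/
lemma lieb_concave {L σ₁ σ₂ : H →L[ℂ] H} (hL : IsSelfAdjoint L) (hσ₁ : IsStrictlyPositive σ₁)
    (hσ₂ : IsStrictlyPositive σ₂) {r a d : ℝ} (hr : r ∈ Set.Icc (0 : ℝ) 1) (ha : 0 < a)
    (hd : 0 < d) (had : a + d = 1) :
    a * tr (NormedSpace.exp (L + r • CFC.log σ₁)) + d * tr (NormedSpace.exp (L + r • CFC.log σ₂)) ≤
      tr (NormedSpace.exp (L + r • CFC.log (a • σ₁ + d • σ₂))) := by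
  have hsa : ∀ σ : H →L[ℂ] H, IsSelfAdjoint (L + r • CFC.log σ) := fun σ =>
    hL.add (isSelfAdjoint_smul_real r (isSelfAdjoint_log σ))
  -- This is the Gibbs objective for the exponent L + r log σ, with Tr τ log τ split in proportions
  -- 1 - r and r between relative entropies to 1 and to σ. For `r` in [0, 1] both enter with a
  -- nonpositive coefficient, so `J` is jointly concave. Its maximum over τ is attained at the
  -- exponential, and partial maximization preserves concavity.
  let J : (H →L[ℂ] H) → (H →L[ℂ] H) → ℝ := fun τ σ =>
    tr τ + tr (τ * L) - (1 - r) * (relEnt τ 1 + tr τ - tr (1 : H →L[ℂ] H)) -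
      r * (relEnt τ σ + tr τ - tr σ)
  have hJ : ∀ τ σ : H →L[ℂ] H,
      J τ σ = tr τ + tr (τ * (L + r • CFC.log σ)) - tr (τ * CFC.log τ) := by
    intro τ σ
    simp only [J, relEnt, CFC.log_one, mul_zero, mul_add, mul_smul_comm, tr_add, tr_smul]
    have : tr (0 : H →L[ℂ] H) = 0 := by simp [tr]
    rw [this]
    ring
  have hJexp : ∀ σ : H →L[ℂ] H, J (NormedSpace.exp (L + r • CFC.log σ)) σ =
      tr (NormedSpace.exp (L + r • CFC.log σ)) := by
    intro σ
    rw [hJ, CFC.log_exp _ (hsa σ)]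
    ring
  rw [← hJexp σ₁, ← hJexp σ₂]
  set τ₁ := NormedSpace.exp (L + r • CFC.log σ₁)
  set τ₂ := NormedSpace.exp (L + r • CFC.log σ₂)
  have hτ₁ : IsStrictlyPositive τ₁ := isStrictlyPositive_exp (hsa σ₁)
  have hτ₂ : IsStrictlyPositive τ₂ := isStrictlyPositive_exp (hsa σ₂)
  have h1 := gibbs_le (hsa (a • σ₁ + d • σ₂)) (isStrictlyPositive_comb hτ₁ hτ₂ ha hd)
  rw [← hJ] at h1
  refine le_trans ?_ h1
  have h2 := relEnt_comb_le hτ₁ hτ₂ hσ₁ hσ₂ ha hd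
  have h3 := relEnt_comb_le hτ₁ hτ₂ (isStrictlyPositive_one (A := H →L[ℂ] H))
    isStrictlyPositive_one ha hd
  rw [← add_smul, had, one_smul] at h3
  have h4 := mul_le_mul_of_nonneg_left h2 hr.1
  have h5 := mul_le_mul_of_nonneg_left h3 (sub_nonneg.2 hr.2)
  simp only [J, tr_add, tr_smul, add_mul, smul_mul_assoc]
  have h6 : tr (1 : H →L[ℂ] H) = a * tr (1 : H →L[ℂ] H) + d * tr (1 : H →L[ℂ] H) := by
    rw [← add_mul, had, one_mul]
  have h7 : (1 - r) * tr (1 : H →L[ℂ] H) =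
      (1 - r) * (a * tr (1 : H →L[ℂ] H) + d * tr (1 : H →L[ℂ] H)) := by rw [← h6]
  linarith

end Lieb

/-! ### Convexity for positive definite operators -/

section PosDef

variable {H : Type*} [NormedAddCommGroup H] [InnerProductSpace ℂ H] [CompleteSpace H]
  [FiniteDimensional ℂ H] {A B C ρ σ σ₁ σ₂ : H →L[ℂ] H}

lemma tr_mul_eq_sum {b : OrthonormalBasis (Fin (Module.finrank ℂ H)) ℂ H}
    {x : Fin (Module.finrank ℂ H) → ℝ} (h : IsSpectralBasis A b x) (B : H →L[ℂ] H) :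
    tr (A * B) = ∑ i, x i * qf B (b i) := by
  rw [tr_mul_comm, tr_eq_sum b]
  refine Finset.sum_congr rfl fun i _ => ?_
  simp [qf, mul_apply_eq_comp, h.apply]

lemma tr_mul_mono (hA : 0 ≤ A) (h : B ≤ C) : tr (A * B) ≤ tr (A * C) := by
  obtain ⟨b, x, hb⟩ := IsSpectralBasis.exists (IsSelfAdjoint.of_nonneg hA)
  rw [tr_mul_eq_sum hb, tr_mul_eq_sum hb]
  exact Finset.sum_le_sum fun i _ =>
    mul_le_mul_of_nonneg_left (qf_mono h _) (spectrum_nonneg hA (hb.mem i))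

lemma qf_pos (hA : IsStrictlyPositive A) {v : H} (hv : ‖v‖ = 1) : 0 < qf A v := by
  obtain ⟨b, x, hb⟩ := IsSpectralBasis.exists hA.isSelfAdjoint
  have h1 := hb.qf_cfc (fun x => x) v
  rw [cfc_id' ℝ A hb.isSelfAdjoint] at h1
  rw [h1]
  have h2 : ∀ i, 0 ≤ x i * ‖inner ℂ (b i) v‖ ^ 2 := fun i =>
    mul_nonneg (hb.pos hA i).le (by positivity)
  refine (Finset.sum_nonneg fun i _ => h2 i).lt_of_ne fun h3 => ?_
  rw [eq_comm, Finset.sum_eq_zero_iff_of_nonneg fun i _ => h2 i] at h3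
  have h4 := sum_sq_norm_inner_eq_one b hv
  rw [Finset.sum_eq_zero] at h4
  · exact zero_ne_one h4
  · intro i hi
    exact (mul_eq_zero.1 (h3 i hi)).resolve_left (hb.pos hA i).ne'

lemma tr_mul_pos [Nontrivial H] (hA : IsStrictlyPositive A) (hB : IsStrictlyPositive B) :
    0 < tr (A * B) := by
  obtain ⟨b, x, hb⟩ := IsSpectralBasis.exists hA.isSelfAdjoint
  rw [tr_mul_eq_sum hb]
  have : Nonempty (Fin (Module.finrank ℂ H)) := ⟨⟨0, Module.finrank_pos⟩⟩
  exact Finset.sum_pos (fun i _ => mul_pos (hb.pos hA i) (qf_pos hB (b.orthonormal.1 i)))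
    Finset.univ_nonempty

lemma isStrictlyPositive_rpow (hA : IsStrictlyPositive A) (p : ℝ) : IsStrictlyPositive (A ^ p) := by
  rw [rpow_eq_cfc hA.nonneg]
  exact isStrictlyPositive_cfc hA.isSelfAdjoint fun x hx =>
    Real.rpow_pos_of_pos (spectrum_pos hA hx) p

lemma isStrictlyPositive_conj (hA : IsStrictlyPositive A) (hB : IsStrictlyPositive B) :
    IsStrictlyPositive (B * A * B) :=
  hA.conjugate_of_isUnit_of_isSelfAdjoint A B hB.isUnit hB.isSelfAdjoint

lemma tr_pos_of_isStrictlyPositive [Nontrivial H] (hA : IsStrictlyPositive A) : 0 < tr A := by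
  have := tr_mul_pos hA (isStrictlyPositive_one (A := H →L[ℂ] H))
  rwa [mul_one] at this

lemma isSelfAdjoint_flat (α : ℝ) (ρ σ : H →L[ℂ] H) :
    IsSelfAdjoint (α • CFC.log ρ + (1 - α) • CFC.log σ) :=
  (isSelfAdjoint_smul_real _ (isSelfAdjoint_log _)).add
    (isSelfAdjoint_smul_real _ (isSelfAdjoint_log _))

lemma formulaQ_pos [Nontrivial H] (t : Family) (α : ℝ) (hρ : IsStrictlyPositive ρ)
    (hσ : IsStrictlyPositive σ) : 0 < formulaQ t α ρ σ := by
  cases t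
  · exact tr_mul_pos (isStrictlyPositive_rpow hρ _) (isStrictlyPositive_rpow hσ _)
  · exact tr_pos_of_isStrictlyPositive (isStrictlyPositive_rpow (isStrictlyPositive_conj
      (isStrictlyPositive_rpow hσ _) (isStrictlyPositive_rpow hρ _)) _)
  · exact tr_pos_of_isStrictlyPositive (isStrictlyPositive_exp (isSelfAdjoint_flat _ _ _))

lemma smul_rpow {k : ℝ} (hk : 0 < k) (hA : 0 ≤ A) (p : ℝ) : (k • A) ^ p = k ^ p • A ^ p := by
  have hs := IsSelfAdjoint.of_nonneg hA
  have h1 : k • A = cfc (fun x => k * x) A := by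
    rw [← cfc_smul' k (fun x => x) A, cfc_id' ℝ A]
  rw [rpow_eq_cfc (smul_nonneg hk.le hA), rpow_eq_cfc hA, cfc_smul', h1, cfc_cfc _ _ hs]
  exact cfc_congr fun x hx => Real.mul_rpow hk.le (spectrum_nonneg hA hx)

lemma formulaQ_smul (t : Family) {α : ℝ} (hα : 0 < α) (hρ : IsStrictlyPositive ρ)
    (hσ : IsStrictlyPositive σ) {k : ℝ} (hk : 0 < k) :
    formulaQ t α ρ (k • σ) = k ^ (1 - α) * formulaQ t α ρ σ := by
  cases t
  · simp only [formulaQ]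
    rw [smul_rpow hk hσ.nonneg, mul_smul_comm, tr_smul]
  · simp only [formulaQ]
    have hX := isStrictlyPositive_conj (isStrictlyPositive_rpow hσ ((1 - α) / α))
      (isStrictlyPositive_rpow hρ (1 / 2))
    rw [smul_rpow hk hσ.nonneg, mul_smul_comm, smul_mul_assoc,
      smul_rpow (Real.rpow_pos_of_pos hk _) hX.nonneg, tr_smul, ← Real.rpow_mul hk.le,
      div_mul_cancel₀ _ hα.ne']
  · simp only [formulaQ]
    have h1 : CFC.log (k • σ) = CFC.log σ + Real.log k • (1 : H →L[ℂ] H) := by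
      rw [CFC.log_smul' σ hk hσ, add_comm, Algebra.algebraMap_eq_smul_one]
    have h2 : α • CFC.log ρ + (1 - α) • CFC.log (k • σ) =
        (α • CFC.log ρ + (1 - α) • CFC.log σ) + ((1 - α) * Real.log k) • (1 : H →L[ℂ] H) := by
      rw [h1, smul_add, smul_smul, add_assoc]
    have h3 := isSelfAdjoint_flat α ρ σ
    have h4 := isSelfAdjoint_flat α ρ (k • σ)
    rw [exp_eq_cfc h4, exp_eq_cfc h3, h2, cfc_add_smul_one _ h3, ← tr_smul, cfc_smul']
    congr 1
    refine cfc_congr fun x _ => ?_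
    rw [Real.rpow_def_of_pos hk, Real.exp_add, mul_comm (1 - α), mul_comm]

lemma formulaQ_one (t : Family) (α : ℝ) (hρ : IsStrictlyPositive ρ) :
    formulaQ t α ρ 1 = tr (ρ ^ α) := by
  cases t
  · simp only [formulaQ]
    rw [CFC.one_rpow, mul_one]
  · simp only [formulaQ]
    rw [CFC.one_rpow, mul_one, ← CFC.rpow_add hρ.isUnit]
    norm_num
    rw [CFC.rpow_one ρ hρ.nonneg]
  · simp only [formulaQ]
    have h4 := isSelfAdjoint_flat α ρ 1
    rw [CFC.log_one, smul_zero, add_zero] at *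
    rw [exp_eq_cfc h4, log_eq_cfc, cfc_smul', cfc_cfc _ _ hρ.isSelfAdjoint,
      rpow_eq_cfc hρ.nonneg]
    congr 1
    refine cfc_congr fun x hx => ?_
    rw [Real.rpow_def_of_pos (spectrum_pos hρ hx), mul_comm]

lemma rpow_comb_ge {p : ℝ} (hp : p ∈ Set.Icc (0 : ℝ) 1) (h₁ : 0 ≤ σ₁) (h₂ : 0 ≤ σ₂) {a d : ℝ}
    (ha : 0 < a) (hd : 0 < d) (had : a + d = 1) :
    a • σ₁ ^ p + d • σ₂ ^ p ≤ (a • σ₁ + d • σ₂) ^ p :=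
  (CFC.concaveOn_rpow hp).2 h₁ h₂ ha.le hd.le had

lemma rpow_neg_eq_inverse (hA : IsStrictlyPositive A) (p : ℝ) :
    A ^ (-p) = Ring.inverse (A ^ p) := by
  have h1 := CFC.rpow_mul_rpow_neg p hA
  have h2 := CFC.rpow_neg_mul_rpow p hA
  let u : (H →L[ℂ] H)ˣ := ⟨A ^ p, A ^ (-p), h1, h2⟩
  exact (Ring.inverse_unit u).symm

/-- The negative power is the inverse of the positive one. Inversion reverses the operator concavity
of the positive power, and its own operator convexity then separates the two terms. -/
lemma rpow_neg_comb_le {p : ℝ} (hp : p ∈ Set.Icc (0 : ℝ) 1) (h₁ : IsStrictlyPositive σ₁)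
    (h₂ : IsStrictlyPositive σ₂) {a d : ℝ} (ha : 0 < a) (hd : 0 < d) (had : a + d = 1) :
    (a • σ₁ + d • σ₂) ^ (-p) ≤ a • σ₁ ^ (-p) + d • σ₂ ^ (-p) := by
  rw [rpow_neg_eq_inverse h₁, rpow_neg_eq_inverse h₂,
    rpow_neg_eq_inverse (isStrictlyPositive_comb h₁ h₂ ha hd)]
  have h3 := isStrictlyPositive_rpow h₁ p
  have h4 := isStrictlyPositive_rpow h₂ p
  refine (CStarAlgebra.ringInverse_le_ringInverse
    (rpow_comb_ge hp h₁.nonneg h₂.nonneg ha hd had)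
    (isStrictlyPositive_comb h3 h4 ha hd)).trans ?_
  exact CStarAlgebra.convexOn_ringInverse.2 h3 h4 ha.le hd.le had

lemma tr_rpow_eq_sum (hA : 0 ≤ A) {b : OrthonormalBasis (Fin (Module.finrank ℂ H)) ℂ H}
    {x : Fin (Module.finrank ℂ H) → ℝ} (h : IsSpectralBasis A b x) (p : ℝ) :
    tr (A ^ p) = ∑ i, x i ^ p := by
  rw [rpow_eq_cfc hA, h.tr_cfc]

lemma tr_rpow_comb_le {X X₁ X₂ : H →L[ℂ] H} {q : ℝ} (hq : 1 ≤ q) (hX : 0 ≤ X) (h₁ : 0 ≤ X₁)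
    (h₂ : 0 ≤ X₂) {a d : ℝ} (ha : 0 < a) (hd : 0 < d) (had : a + d = 1)
    (h : X ≤ a • X₁ + d • X₂) : tr (X ^ q) ≤ a * tr (X₁ ^ q) + d * tr (X₂ ^ q) := by
  rw [rpow_eq_cfc hX, rpow_eq_cfc h₁, rpow_eq_cfc h₂]
  refine tr_cfc_le_of_qf_le (convexOn_rpow hq) (.of_nonneg hX) (.of_nonneg h₁) (.of_nonneg h₂)
    (spectrum_nonneg h₁) (spectrum_nonneg h₂) ha.le hd.le fun v _ => ?_
  have h3 := qf_mono h v
  rw [qf_add, qf_smul, qf_smul] at h3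
  exact (Real.rpow_le_rpow (qf_nonneg hX v) h3 (by linarith)).trans
    ((convexOn_rpow hq).2 (qf_nonneg h₁ v) (qf_nonneg h₂ v) ha.le hd.le had)

lemma tr_cfc_neg (f : ℝ → ℝ) (A : H →L[ℂ] H) : tr (cfc (fun x => - f x) A) = - tr (cfc f A) := by
  rw [cfc_neg f A]
  simp [tr]

lemma tr_rpow_comb_ge {X X₁ X₂ : H →L[ℂ] H} {q : ℝ} (hq : q ∈ Set.Icc (0 : ℝ) 1) (hX : 0 ≤ X)
    (h₁ : 0 ≤ X₁) (h₂ : 0 ≤ X₂) {a d : ℝ} (ha : 0 < a) (hd : 0 < d) (had : a + d = 1)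
    (h : a • X₁ + d • X₂ ≤ X) : a * tr (X₁ ^ q) + d * tr (X₂ ^ q) ≤ tr (X ^ q) := by
  rw [rpow_eq_cfc hX, rpow_eq_cfc h₁, rpow_eq_cfc h₂]
  have hc := Real.concaveOn_rpow hq.1 hq.2
  have := tr_cfc_le_of_qf_le hc.neg (.of_nonneg hX) (.of_nonneg h₁) (.of_nonneg h₂)
    (spectrum_nonneg h₁) (spectrum_nonneg h₂) ha.le hd.le fun v _ => by
      have h3 := qf_mono h v
      rw [qf_add, qf_smul, qf_smul] at h3
      have h4 := Real.rpow_le_rpow (add_nonneg (mul_nonneg ha.le (qf_nonneg h₁ v))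
        (mul_nonneg hd.le (qf_nonneg h₂ v))) h3 hq.1
      have h5 := hc.2 (qf_nonneg h₁ v) (qf_nonneg h₂ v) ha.le hd.le had
      simp only [smul_eq_mul, Pi.neg_apply] at h5 ⊢
      linarith
  change tr (cfc (fun x => - x ^ q) X) ≤ a * tr (cfc (fun x => - x ^ q) X₁) +
    d * tr (cfc (fun x => - x ^ q) X₂) at this
  simp only [tr_cfc_neg] at this
  linarith

lemma tr_exp_comb_le {X X₁ X₂ : H →L[ℂ] H} (hX : IsSelfAdjoint X) (h₁ : IsSelfAdjoint X₁)
    (h₂ : IsSelfAdjoint X₂) {a d : ℝ} (ha : 0 < a) (hd : 0 < d) (had : a + d = 1)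
    (h : X ≤ a • X₁ + d • X₂) :
    tr (NormedSpace.exp X) ≤ a * tr (NormedSpace.exp X₁) + d * tr (NormedSpace.exp X₂) := by
  rw [exp_eq_cfc hX, exp_eq_cfc h₁, exp_eq_cfc h₂]
  refine tr_cfc_le_of_qf_le convexOn_exp hX h₁ h₂ (Set.subset_univ _) (Set.subset_univ _)
    ha.le hd.le fun v _ => ?_
  have h3 := qf_mono h v
  rw [qf_add, qf_smul, qf_smul] at h3
  exact (Real.exp_le_exp.2 h3).trans
    (convexOn_exp.2 (Set.mem_univ _) (Set.mem_univ _) ha.le hd.le had)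

/-- Petz: α ≤ 2 puts the exponent 1 - α in [-1, 0]. Sandwiched: (1 - α) / α lies there for every α >
1, and x ^ α is increasing and convex. Log-Euclidean: the logarithm is operator concave and has the
negative coefficient 1 - α, so the exponent is operator convex. -/
lemma formulaQ_comb_le {t : Family} {α : ℝ} (hα : α ∈ convexityRange t) (h1 : 1 < α)
    (hρ : IsStrictlyPositive ρ) (hσ₁ : IsStrictlyPositive σ₁) (hσ₂ : IsStrictlyPositive σ₂)
    {a d : ℝ} (ha : 0 < a) (hd : 0 < d) (had : a + d = 1) :
    formulaQ t α ρ (a • σ₁ + d • σ₂) ≤ a * formulaQ t α ρ σ₁ + d * formulaQ t α ρ σ₂ := by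
  have hσ := isStrictlyPositive_comb hσ₁ hσ₂ ha hd
  cases t
  · have h2 : α ≤ 2 := hα.2
    have h3 := rpow_neg_comb_le (p := α - 1) ⟨by linarith, by linarith⟩ hσ₁ hσ₂ ha hd had
    rw [neg_sub] at h3
    have h4 := tr_mul_mono (isStrictlyPositive_rpow hρ α).nonneg h3
    simpa [formulaQ, mul_add, tr_add, tr_smul] using h4
  · have h2 : (α - 1) / α ∈ Set.Icc (0 : ℝ) 1 := by
      constructor
      · apply div_nonneg <;> linarith
      · rw [div_le_one (by linarith)]; linarith
    have h3 := rpow_neg_comb_le h2 hσ₁ hσ₂ ha hd had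
    have h4 := isStrictlyPositive_rpow hρ (1 / 2)
    have h5 := conj_mono h4.isSelfAdjoint h3
    have h6 : -((α - 1) / α) = (1 - α) / α := by ring
    rw [h6, mul_add, add_mul, mul_smul_comm, mul_smul_comm, smul_mul_assoc, smul_mul_assoc] at h5
    exact tr_rpow_comb_le h1.le (isStrictlyPositive_conj (isStrictlyPositive_rpow hσ _) h4).nonneg
      (isStrictlyPositive_conj (isStrictlyPositive_rpow hσ₁ _) h4).nonneg
      (isStrictlyPositive_conj (isStrictlyPositive_rpow hσ₂ _) h4).nonneg ha hd had h5
  · refine tr_exp_comb_le (isSelfAdjoint_flat _ _ _) (isSelfAdjoint_flat _ _ _)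
      (isSelfAdjoint_flat _ _ _) ha hd had ?_
    have h3 := CFC.concaveOn_log.2 hσ₁ hσ₂ ha.le hd.le had
    have h4 := smul_le_smul_of_nonneg_left h3 (sub_nonneg.2 h1.le)
    have h5 : a • (α • CFC.log ρ + (1 - α) • CFC.log σ₁) +
        d • (α • CFC.log ρ + (1 - α) • CFC.log σ₂) =
        α • CFC.log ρ - (α - 1) • (a • CFC.log σ₁ + d • CFC.log σ₂) := by
      have : a • α • CFC.log ρ + d • α • CFC.log ρ = α • CFC.log ρ := by
        rw [← add_smul, had, one_smul]
      calc _ = (a • α • CFC.log ρ + d • α • CFC.log ρ) -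
            (α - 1) • (a • CFC.log σ₁ + d • CFC.log σ₂) := by module
        _ = _ := by rw [this]
    have h6 : α • CFC.log ρ + (1 - α) • CFC.log (a • σ₁ + d • σ₂) =
        α • CFC.log ρ - (α - 1) • CFC.log (a • σ₁ + d • σ₂) := by module
    rw [h5, h6]
    exact sub_le_sub_left h4 _

/-- For the sandwiched family α ≥ 1/2 is exactly what makes (1 - α) / α at most 1. For the
log-Euclidean family, operator concavity of the exponent is not enough, since exp is convex; Lieb's
theorem takes over with weight 1 - α. -/
lemma formulaQ_comb_ge {t : Family} {α : ℝ} (hα : α ∈ convexityRange t) (h0 : 0 < α) (h1 : α < 1)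
    (hρ : IsStrictlyPositive ρ) (hσ₁ : IsStrictlyPositive σ₁) (hσ₂ : IsStrictlyPositive σ₂)
    {a d : ℝ} (ha : 0 < a) (hd : 0 < d) (had : a + d = 1) :
    a * formulaQ t α ρ σ₁ + d * formulaQ t α ρ σ₂ ≤ formulaQ t α ρ (a • σ₁ + d • σ₂) := by
  have hσ := isStrictlyPositive_comb hσ₁ hσ₂ ha hd
  cases t
  · have h3 := rpow_comb_ge (p := 1 - α) ⟨by linarith, by linarith⟩ hσ₁.nonneg hσ₂.nonneg ha hd had
    have h4 := tr_mul_mono (isStrictlyPositive_rpow hρ α).nonneg h3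
    simpa [formulaQ, mul_add, tr_add, tr_smul] using h4
  · have h2 : (1 - α) / α ∈ Set.Icc (0 : ℝ) 1 := by
      have : 1 / 2 ≤ α := hα
      constructor
      · apply div_nonneg <;> linarith
      · rw [div_le_one (by linarith)]; linarith
    have h3 := rpow_comb_ge h2 hσ₁.nonneg hσ₂.nonneg ha hd had
    have h4 := isStrictlyPositive_rpow hρ (1 / 2)
    have h5 := conj_mono h4.isSelfAdjoint h3
    rw [mul_add, add_mul, mul_smul_comm, mul_smul_comm, smul_mul_assoc, smul_mul_assoc] at h5
    exact tr_rpow_comb_ge ⟨h0.le, h1.le⟩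
      (isStrictlyPositive_conj (isStrictlyPositive_rpow hσ _) h4).nonneg
      (isStrictlyPositive_conj (isStrictlyPositive_rpow hσ₁ _) h4).nonneg
      (isStrictlyPositive_conj (isStrictlyPositive_rpow hσ₂ _) h4).nonneg ha hd had h5
  · exact lieb_concave (isSelfAdjoint_smul_real _ (isSelfAdjoint_log _)) hσ₁ hσ₂
      ⟨by linarith, by linarith⟩ ha hd had

/-- Superadditivity, with weights, of the degree-one homogeneous function `Q ^ (1 / (1 - α))`. -/
lemma formulaQ_rpow_superadditive [Nontrivial H] {t : Family} {α : ℝ} (hα : α ∈ convexityRange t)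
    (h0 : 0 < α) (h1 : α ≠ 1) (hρ : IsStrictlyPositive ρ) (hσ₁ : IsStrictlyPositive σ₁)
    (hσ₂ : IsStrictlyPositive σ₂) {a d : ℝ} (ha : 0 < a) (hd : 0 < d) :
    a * formulaQ t α ρ σ₁ ^ (1 / (1 - α)) + d * formulaQ t α ρ σ₂ ^ (1 / (1 - α)) ≤
      formulaQ t α ρ (a • σ₁ + d • σ₂) ^ (1 / (1 - α)) := by
  have hq₁ := formulaQ_pos t α hρ hσ₁
  have hq₂ := formulaQ_pos t α hρ hσ₂
  have hq := formulaQ_pos t α hρ (isStrictlyPositive_comb hσ₁ hσ₂ ha hd)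
  have hr : 1 - α ≠ 0 := sub_ne_zero.2 h1.symm
  set q₁ := formulaQ t α ρ σ₁
  set q₂ := formulaQ t α ρ σ₂
  set g₁ := q₁ ^ (1 / (1 - α)) with hg₁
  set g₂ := q₂ ^ (1 / (1 - α)) with hg₂
  have hg₁p : 0 < g₁ := Real.rpow_pos_of_pos hq₁ _
  have hg₂p : 0 < g₂ := Real.rpow_pos_of_pos hq₂ _
  have hgr : ∀ q : ℝ, 0 < q → (q ^ (1 / (1 - α)))⁻¹ ^ (1 - α) * q = 1 := by
    intro q hq
    rw [Real.inv_rpow (Real.rpow_pos_of_pos hq _).le, ← Real.rpow_mul hq.le,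
      one_div_mul_cancel hr, Real.rpow_one, inv_mul_cancel₀ hq.ne']
  -- Dividing `σ₁` by `g₁` and `σ₂` by `g₂` makes both values of Q equal to 1. With weights `a * g₁
  -- / G` and `d * g₂ / G`, the rescaled operators mix to G⁻¹ times the original mixture, so one
  -- application of convexity or concavity compares G with the value of Q ^ (1 / (1 - α)) there.
  set G := a * g₁ + d * g₂ with hG
  have hGp : 0 < G := by positivity
  have hw : a * g₁ / G + d * g₂ / G = 1 := by field_simp; exact hG.symm
  have hN₁ : formulaQ t α ρ (g₁⁻¹ • σ₁) = 1 := by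
    rw [formulaQ_smul t h0 hρ hσ₁ (inv_pos.2 hg₁p)]; exact hgr q₁ hq₁
  have hN₂ : formulaQ t α ρ (g₂⁻¹ • σ₂) = 1 := by
    rw [formulaQ_smul t h0 hρ hσ₂ (inv_pos.2 hg₂p)]; exact hgr q₂ hq₂
  have hσ : (a * g₁ / G) • g₁⁻¹ • σ₁ + (d * g₂ / G) • g₂⁻¹ • σ₂ = G⁻¹ • (a • σ₁ + d • σ₂) := by
    rw [smul_smul, smul_smul, smul_add, smul_smul, smul_smul]
    congr 2 <;> field_simp
  have hp₁ := hσ₁.smul (inv_pos.2 hg₁p)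
  have hp₂ := hσ₂.smul (inv_pos.2 hg₂p)
  have hc := formulaQ_smul t h0 hρ (isStrictlyPositive_comb hσ₁ hσ₂ ha hd) (inv_pos.2 hGp)
  rw [Real.inv_rpow hGp.le] at hc
  have hGe : (G ^ (1 - α)) ^ (1 / (1 - α)) = G := by
    rw [← Real.rpow_mul hGp.le, mul_one_div_cancel hr, Real.rpow_one]
  have hGr : 0 < G ^ (1 - α) := Real.rpow_pos_of_pos hGp _
  rcases lt_or_gt_of_ne h1 with h | h
  · have := formulaQ_comb_ge hα h0 h hρ hp₁ hp₂ (a := a * g₁ / G) (d := d * g₂ / G)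
      (by positivity) (by positivity) hw
    rw [hN₁, hN₂, mul_one, mul_one, hw, hσ, hc, ← div_eq_inv_mul, one_le_div hGr] at this
    have h3 := Real.rpow_le_rpow hGr.le this (one_div_nonneg.2 (sub_nonneg.2 h.le))
    rwa [hGe] at h3
  · have := formulaQ_comb_le hα h hρ hp₁ hp₂ (a := a * g₁ / G) (d := d * g₂ / G)
      (by positivity) (by positivity) hw
    rw [hN₁, hN₂, mul_one, mul_one, hw, hσ, hc, ← div_eq_inv_mul, div_le_one hGr] at this
    have h3 := Real.rpow_le_rpow_of_nonpos hq this (one_div_nonpos.2 (sub_nonpos.2 h.le))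
    rwa [hGe] at h3

/-- `σ ↦ (1 - α)⁻¹ log Q_α` is concave on positive definite operators. -/
lemma log_formulaQ_comb_ge [Nontrivial H] {t : Family} {α : ℝ} (hα : α ∈ convexityRange t)
    (h0 : 0 < α) (h1 : α ≠ 1) (hρ : IsStrictlyPositive ρ) (hσ₁ : IsStrictlyPositive σ₁)
    (hσ₂ : IsStrictlyPositive σ₂) {a d : ℝ} (ha : 0 < a) (hd : 0 < d) (had : a + d = 1) :
    a * (1 / (1 - α) * Real.log (formulaQ t α ρ σ₁)) +
        d * (1 / (1 - α) * Real.log (formulaQ t α ρ σ₂)) ≤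
      1 / (1 - α) * Real.log (formulaQ t α ρ (a • σ₁ + d • σ₂)) := by
  have hq₁ := formulaQ_pos t α hρ hσ₁
  have hq₂ := formulaQ_pos t α hρ hσ₂
  have hq := formulaQ_pos t α hρ (isStrictlyPositive_comb hσ₁ hσ₂ ha hd)
  rw [← Real.log_rpow hq₁, ← Real.log_rpow hq₂, ← Real.log_rpow hq]
  have h2 : 0 < formulaQ t α ρ σ₁ ^ (1 / (1 - α)) := Real.rpow_pos_of_pos hq₁ _
  have h3 : 0 < formulaQ t α ρ σ₂ ^ (1 / (1 - α)) := Real.rpow_pos_of_pos hq₂ _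
  refine (strictConcaveOn_log_Ioi.concaveOn.2 h2 h3 ha.le hd.le had).trans ?_
  exact Real.log_le_log (by simp only [smul_eq_mul]; positivity)
    (formulaQ_rpow_superadditive hα h0 h1 hρ hσ₁ hσ₂ ha hd)

/-- Comparison of `Q_α(ρ‖σ)` with its value at a multiple of the identity dominating `σ`. -/
lemma log_formulaQ_le [Nontrivial H] {t : Family} {α : ℝ} (hα : α ∈ convexityRange t)
    (h0 : 0 < α) (h1 : α ≠ 1) (hρ : IsStrictlyPositive ρ) (hσ : IsStrictlyPositive σ) {M : ℝ}
    (hM : IsStrictlyPositive (M • (1 : H →L[ℂ] H) - σ)) (hM0 : 0 < M) :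
    1 / (1 - α) * Real.log (formulaQ t α ρ σ) ≤
      Real.log M + 1 / (1 - α) * Real.log (tr (ρ ^ α)) := by
  have hq := formulaQ_pos t α hρ hσ
  have hq2 := formulaQ_pos t α hρ hM
  have hr : 1 - α ≠ 0 := sub_ne_zero.2 h1.symm
  -- The two summands are σ and its complement in `M • 1`; dropping the positive term of the
  -- complement yields monotonicity against `M • 1`, where Q is explicit.
  have h2 := formulaQ_rpow_superadditive hα h0 h1 hρ hσ hM one_pos one_pos
  rw [one_smul, one_smul, add_sub_cancel, one_mul, one_mul,
    formulaQ_smul t h0 hρ isStrictlyPositive_one hM0, formulaQ_one t α hρ] at h2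
  have h3 := formulaQ_pos t α hρ (isStrictlyPositive_one (A := H →L[ℂ] H))
  rw [formulaQ_one t α hρ] at h3
  have h4 : formulaQ t α ρ σ ^ (1 / (1 - α)) ≤ (M ^ (1 - α) * tr (ρ ^ α)) ^ (1 / (1 - α)) := by
    have := Real.rpow_nonneg hq2.le (1 / (1 - α))
    linarith
  have h5 := Real.log_le_log (Real.rpow_pos_of_pos hq _) h4
  have hMr := Real.rpow_pos_of_pos hM0 (1 - α)
  rw [Real.log_rpow hq, Real.log_rpow (mul_pos hMr h3), Real.log_mul hMr.ne' h3.ne',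
    Real.log_rpow hM0, mul_add, ← mul_assoc, one_div_mul_cancel hr, one_mul] at h5
  exact h5

end PosDef

/-! ### The limit ε ↘ 0 for the Petz and sandwiched families -/

section Limits

variable {H : Type*} [NormedAddCommGroup H] [InnerProductSpace ℂ H] [CompleteSpace H]
  [FiniteDimensional ℂ H] {A B ρ σ : H →L[ℂ] H}

/-- The power `A ^ p` on the support of `A`, and zero on its kernel. -/
def gpow (p : ℝ) (A : H →L[ℂ] H) : H →L[ℂ] H := cfc (fun x : ℝ => if x = 0 then 0 else x ^ p) A

/-- The projection onto the kernel. -/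
def kerProj (A : H →L[ℂ] H) : H →L[ℂ] H := cfc (fun x : ℝ => if x = 0 then 1 else 0) A

/-- The support of `ρ` is contained in the support of `σ`. -/
def SuppLE (ρ σ : H →L[ℂ] H) : Prop := tr (ρ * kerProj σ) = 0

lemma isSelfAdjoint_kerProj (A : H →L[ℂ] H) : IsSelfAdjoint (kerProj A) := isSelfAdjoint_cfc _ _

lemma isSelfAdjoint_gpow (p : ℝ) (A : H →L[ℂ] H) : IsSelfAdjoint (gpow p A) :=
  isSelfAdjoint_cfc _ _

lemma kerProj_nonneg (A : H →L[ℂ] H) : 0 ≤ kerProj A :=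
  cfc_nonneg' fun x _ => by split_ifs <;> norm_num

lemma kerProj_mul_self (A : H →L[ℂ] H) : kerProj A * kerProj A = kerProj A := by
  rw [kerProj, cfc_mul']
  exact cfc_congr fun x _ => by simp

lemma gpow_nonneg (hA : 0 ≤ A) (p : ℝ) : 0 ≤ gpow p A :=
  cfc_nonneg' fun x hx => by
    split_ifs
    · rfl
    · exact Real.rpow_nonneg (spectrum_nonneg hA hx) _

lemma gpow_eq_rpow (hA : 0 ≤ A) {p : ℝ} (hp : p ≠ 0) : gpow p A = A ^ p := by
  rw [rpow_eq_cfc hA]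
  refine cfc_congr fun x _ => ?_
  by_cases hx : x = 0
  · simp [hx, Real.zero_rpow hp]
  · simp [hx]

lemma self_mul_kerProj (hA : IsSelfAdjoint A) : A * kerProj A = 0 := by
  have h : cfc (fun x : ℝ => x) A * kerProj A = cfc (fun _ : ℝ => 0) A := by
    rw [kerProj, cfc_mul']
    exact cfc_congr fun x _ => by simp +contextual
  rwa [cfc_id' ℝ A, cfc_const_zero ℝ A] at h

lemma SuppLE.inner_eq_zero (h : SuppLE ρ σ) (hρ : 0 ≤ ρ)
    {b c : OrthonormalBasis (Fin (Module.finrank ℂ H)) ℂ H}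
    {x y : Fin (Module.finrank ℂ H) → ℝ} (hb : IsSpectralBasis ρ b x)
    (hc : IsSpectralBasis σ c y) {i j} (hx : x i ≠ 0) (hy : y j = 0) :
    ‖inner ℂ (c j) (b i)‖ ^ 2 = 0 := by
  have h1 := hb.tr_cfc_mul_cfc hc (fun x => x) (fun x => if x = 0 then 1 else 0)
  rw [cfc_id' ℝ ρ hb.isSelfAdjoint] at h1
  have hnn : ∀ i j, 0 ≤ x i * (if y j = 0 then 1 else 0) * ‖inner ℂ (c j) (b i)‖ ^ 2 := by
    intro i j
    have := spectrum_nonneg hρ (hb.mem i)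
    have : 0 ≤ x i := this
    split_ifs <;> positivity
  have h2 : tr (ρ * kerProj σ) = 0 := h
  rw [kerProj, h1, Finset.sum_eq_zero_iff_of_nonneg fun i _ => Finset.sum_nonneg fun j _ => hnn i j]
    at h2
  have h3 := h2 i (Finset.mem_univ _)
  rw [Finset.sum_eq_zero_iff_of_nonneg fun j _ => hnn i j] at h3
  have h4 := h3 j (Finset.mem_univ _)
  simpa [hy, hx] using h4

lemma tr_mul_kerProj_nonneg (hρ : 0 ≤ ρ) : 0 ≤ tr (ρ * kerProj σ) := by
  have := tr_mul_mono hρ (kerProj_nonneg σ)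
  simpa [tr] using this

lemma exists_inner_ne_zero (h : ¬ SuppLE ρ σ)
    {b c : OrthonormalBasis (Fin (Module.finrank ℂ H)) ℂ H}
    {x y : Fin (Module.finrank ℂ H) → ℝ} (hb : IsSpectralBasis ρ b x)
    (hc : IsSpectralBasis σ c y) :
    ∃ i j, x i ≠ 0 ∧ y j = 0 ∧ ‖inner ℂ (c j) (b i)‖ ^ 2 ≠ 0 := by
  by_contra! hcon
  refine h ?_
  have h1 := hb.tr_cfc_mul_cfc hc (fun x => x) (fun x => if x = 0 then 1 else 0)
  rw [cfc_id' ℝ ρ hb.isSelfAdjoint] at h1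
  rw [SuppLE, kerProj, h1]
  refine Finset.sum_eq_zero fun i _ => Finset.sum_eq_zero fun j _ => ?_
  by_cases hx : x i = 0
  · simp [hx]
  by_cases hy : y j = 0
  · rw [hcon i j hx hy]; simp
  · simp [hy]

lemma SuppLE.mul_kerProj (h : SuppLE ρ σ) (hρ : 0 ≤ ρ) (hσ : IsSelfAdjoint σ) :
    ρ * kerProj σ = 0 := by
  obtain ⟨b, x, hb⟩ := IsSpectralBasis.exists (IsSelfAdjoint.of_nonneg hρ)
  obtain ⟨c, y, hc⟩ := IsSpectralBasis.exists hσ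
  refine ContinuousLinearMap.coe_injective (c.toBasis.ext fun j => ?_)
  by_cases hy : y j = 0
  · have h1 : ρ (c j) = 0 := by
      rw [← b.sum_repr' (c j), map_sum]
      refine Finset.sum_eq_zero fun i _ => ?_
      rw [map_smul, hb.apply]
      by_cases hx : x i = 0
      · simp [hx]
      · have h2 := h.inner_eq_zero hρ hb hc hx hy
        rw [norm_inner_symm] at h2
        simp only [pow_eq_zero_iff, ne_eq, OfNat.ofNat_ne_zero, not_false_eq_true,
          norm_eq_zero] at h2
        simp [h2]
    simp [kerProj, hc.apply_cfc, hy, h1]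
  · simp [kerProj, hc.apply_cfc, hy]

/-- The range of `B` lies in the kernel of `A`, where `cfc f A` acts as the scalar f(0). -/
lemma cfc_mul_of_mul_eq_zero (hA : IsSelfAdjoint A) (h : A * B = 0) (f : ℝ → ℝ) :
    cfc f A * B = f 0 • B := by
  ext v
  have h1 : A (B v) = ((0 : ℝ) : ℂ) • B v := by
    rw [← mul_apply_eq_comp, h]; simp
  rw [mul_apply_eq_comp, cfc_apply_eigenvector f hA h1]
  simp

lemma mul_cfc_of_mul_eq_zero (hA : IsSelfAdjoint A) (h : B * A = 0) (f : ℝ → ℝ) :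
    B * cfc f A = f 0 • B := by
  have h1 : A * star B = 0 := by
    have := congrArg star h
    rwa [star_mul, hA.star_eq, star_zero] at this
  have h2 := congrArg star (cfc_mul_of_mul_eq_zero hA h1 f)
  rwa [star_mul, star_star, (isSelfAdjoint_cfc f A).star_eq, star_smul, star_star,
    star_trivial] at h2

lemma add_smul_one_rpow (hA : 0 ≤ A) {ε : ℝ} (hε : 0 < ε) (p : ℝ) :
    (A + ε • (1 : H →L[ℂ] H)) ^ p = cfc (fun x : ℝ => (x + ε) ^ p) A := by
  rw [rpow_eq_cfc (isStrictlyPositive_add_smul_one hA hε).nonneg,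
    cfc_add_smul_one _ (IsSelfAdjoint.of_nonneg hA)]

lemma tendsto_add_rpow {x : ℝ} (hx : x ≠ 0) (u : ℝ) :
    Tendsto (fun ε : ℝ => (x + ε) ^ u) (𝓝[>] 0) (𝓝 (x ^ u)) := by
  have h1 : Tendsto (fun ε : ℝ => x + ε) (𝓝[>] 0) (𝓝 x) := by
    have : Tendsto (fun ε : ℝ => x + ε) (𝓝 0) (𝓝 (x + 0)) := by
      exact (continuous_const.add continuous_id).tendsto 0
    rw [add_zero] at this
    exact this.mono_left nhdsWithin_le_nhds
  exact h1.rpow_const (Or.inl hx)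

lemma tendsto_zero_rpow {u : ℝ} (hu : 0 < u) :
    Tendsto (fun ε : ℝ => ε ^ u) (𝓝[>] 0) (𝓝 0) := by
  have := (Real.continuous_rpow_const hu.le).tendsto 0
  rw [Real.zero_rpow hu.ne'] at this
  exact this.mono_left nhdsWithin_le_nhds

lemma tendsto_add_rpow_of_pos {x : ℝ} {u : ℝ} (hu : 0 < u) :
    Tendsto (fun ε : ℝ => (x + ε) ^ u) (𝓝[>] 0) (𝓝 (if x = 0 then 0 else x ^ u)) := by
  by_cases hx : x = 0
  · simpa [hx] using tendsto_zero_rpow hu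
  · simpa [hx] using tendsto_add_rpow hx u

/-- Only y = 0 can be singular. There a positive `v` is harmless, and if x = 0 as well the product
is the single power ε ^ (u + v). -/
lemma tendsto_rpow_mul_rpow {x y u v : ℝ} (hu : 0 < u)
    (h : y = 0 → 0 < v ∨ (x = 0 ∧ 0 < u + v)) :
    Tendsto (fun ε : ℝ => (x + ε) ^ u * (y + ε) ^ v) (𝓝[>] 0)
      (𝓝 ((if x = 0 then 0 else x ^ u) * (if y = 0 then 0 else y ^ v))) := by
  by_cases hy : y = 0
  · rcases h hy with hv | ⟨hx, huv⟩
    · exact (tendsto_add_rpow_of_pos hu).mul (tendsto_add_rpow_of_pos hv)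
    · simp only [hy, hx, if_true, zero_add, mul_zero]
      refine (tendsto_zero_rpow huv).congr' ?_
      filter_upwards [self_mem_nhdsWithin] with ε hε
      exact Real.rpow_add hε u v
  · have := (tendsto_add_rpow_of_pos (x := x) hu).mul (tendsto_add_rpow hy v)
    simpa [hy] using this

/-- The limit is taken termwise in the double sum over eigenpairs. A divergent term would need x ≠ 0
and y = 0, and support inclusion gives such pairs weight zero. -/
lemma tendsto_tr_rpow_mul_rpow (hρ : 0 ≤ ρ) (hσ : 0 ≤ σ) {u v : ℝ} (hu : 0 < u)
    (h : 0 < v ∨ (SuppLE ρ σ ∧ 0 < u + v)) :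
    Tendsto (fun ε : ℝ => tr ((ρ + ε • (1 : H →L[ℂ] H)) ^ u * (σ + ε • (1 : H →L[ℂ] H)) ^ v))
      (𝓝[>] 0) (𝓝 (tr (gpow u ρ * gpow v σ))) := by
  obtain ⟨b, x, hb⟩ := IsSpectralBasis.exists (IsSelfAdjoint.of_nonneg hρ)
  obtain ⟨c, y, hc⟩ := IsSpectralBasis.exists (IsSelfAdjoint.of_nonneg hσ)
  have h1 : (fun ε : ℝ => ∑ i, ∑ j, (x i + ε) ^ u * (y j + ε) ^ v * ‖inner ℂ (c j) (b i)‖ ^ 2)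
      =ᶠ[𝓝[>] 0]
      fun ε => tr ((ρ + ε • (1 : H →L[ℂ] H)) ^ u * (σ + ε • (1 : H →L[ℂ] H)) ^ v) := by
    filter_upwards [self_mem_nhdsWithin] with ε hε
    rw [add_smul_one_rpow hρ hε, add_smul_one_rpow hσ hε, hb.tr_cfc_mul_cfc hc]
  refine Tendsto.congr' h1 ?_
  rw [gpow, gpow, hb.tr_cfc_mul_cfc hc]
  refine tendsto_finsetSum _ fun i _ => tendsto_finsetSum _ fun j _ => ?_
  by_cases hcase : x i ≠ 0 ∧ y j = 0 ∧ ¬ 0 < v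
  · have hS : SuppLE ρ σ := (h.resolve_left hcase.2.2).1
    rw [hS.inner_eq_zero hρ hb hc hcase.1 hcase.2.1]
    simp
  · refine (tendsto_rpow_mul_rpow hu fun hy => ?_).mul_const _
    by_cases hv : 0 < v
    · exact Or.inl hv
    · refine Or.inr ⟨?_, (h.resolve_left hv).2⟩
      by_contra hx
      exact hcase ⟨hx, hy, hv⟩

/-- Failure of support inclusion supplies an eigenpair with x ≠ 0, y = 0 and positive weight; its
term grows like ε ^ v and all the others are nonnegative. -/
lemma tendsto_tr_rpow_mul_rpow_atTop (hρ : 0 ≤ ρ) (hσ : 0 ≤ σ) {u v : ℝ} (hv : v < 0)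
    (h : ¬ SuppLE ρ σ) :
    Tendsto (fun ε : ℝ => tr ((ρ + ε • (1 : H →L[ℂ] H)) ^ u * (σ + ε • (1 : H →L[ℂ] H)) ^ v))
      (𝓝[>] 0) atTop := by
  obtain ⟨b, x, hb⟩ := IsSpectralBasis.exists (IsSelfAdjoint.of_nonneg hρ)
  obtain ⟨c, y, hc⟩ := IsSpectralBasis.exists (IsSelfAdjoint.of_nonneg hσ)
  obtain ⟨i, j, hx, hy, hw⟩ := exists_inner_ne_zero h hb hc
  have hx0 : ∀ i, 0 ≤ x i := fun i => spectrum_nonneg hρ (hb.mem i)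
  have hy0 : ∀ i, 0 ≤ y i := fun i => spectrum_nonneg hσ (hc.mem i)
  have h1 : ∀ᶠ ε : ℝ in 𝓝[>] 0, (x i + ε) ^ u * ‖inner ℂ (c j) (b i)‖ ^ 2 * ε ^ v ≤
      tr ((ρ + ε • (1 : H →L[ℂ] H)) ^ u * (σ + ε • (1 : H →L[ℂ] H)) ^ v) := by
    filter_upwards [self_mem_nhdsWithin] with ε hε
    have hε : 0 < ε := hε
    rw [add_smul_one_rpow hρ hε, add_smul_one_rpow hσ hε, hb.tr_cfc_mul_cfc hc]
    have hnn : ∀ i j, 0 ≤ (x i + ε) ^ u * (y j + ε) ^ v * ‖inner ℂ (c j) (b i)‖ ^ 2 := by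
      intro i j
      have := hx0 i
      have := hy0 j
      positivity
    calc _ = (x i + ε) ^ u * (y j + ε) ^ v * ‖inner ℂ (c j) (b i)‖ ^ 2 := by rw [hy]; ring_nf
      _ ≤ ∑ j, (x i + ε) ^ u * (y j + ε) ^ v * ‖inner ℂ (c j) (b i)‖ ^ 2 :=
        Finset.single_le_sum (f := fun j => (x i + ε) ^ u * (y j + ε) ^ v *
          ‖inner ℂ (c j) (b i)‖ ^ 2) (fun j _ => hnn i j) (Finset.mem_univ j)
      _ ≤ _ := Finset.single_le_sum (f := fun i => ∑ j, (x i + ε) ^ u * (y j + ε) ^ v *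
          ‖inner ℂ (c j) (b i)‖ ^ 2) (fun i _ => Finset.sum_nonneg fun j _ => hnn i j)
          (Finset.mem_univ i)
  refine tendsto_atTop_mono' _ h1 ?_
  refine Tendsto.pos_mul_atTop (C := x i ^ u * ‖inner ℂ (c j) (b i)‖ ^ 2) ?_
    ((tendsto_add_rpow hx u).mul_const _) (tendsto_rpow_neg_nhdsGT_zero hv)
  have : 0 < x i := (hx0 i).lt_of_ne hx.symm
  positivity

lemma continuousOn_cfc_selfAdjoint {f : ℝ → ℝ} (hf : Continuous f) :
    ContinuousOn (fun A : H →L[ℂ] H => cfc f A) {A | IsSelfAdjoint A} :=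
  ContinuousOn.cfc_of_mem_nhdsSet (s := Set.univ) f (by simp) continuousOn_id
    (fun _ hx => hx) hf.continuousOn

lemma tendsto_cfc_op {ι : Type*} {l : Filter ι} {f : ℝ → ℝ} (hf : Continuous f)
    {X : ι → H →L[ℂ] H} {Y : H →L[ℂ] H} (h : Tendsto X l (𝓝 Y)) (hY : IsSelfAdjoint Y)
    (hX : ∀ᶠ i in l, IsSelfAdjoint (X i)) : Tendsto (fun i => cfc f (X i)) l (𝓝 (cfc f Y)) :=
  ((continuousOn_cfc_selfAdjoint hf) Y hY).tendsto.comp (tendsto_nhdsWithin_iff.2 ⟨h, hX⟩)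

/-- The operator `ρ^{1/2} σ^p ρ^{1/2}` built from generalized powers. -/
def sandwich (p : ℝ) (ρ σ : H →L[ℂ] H) : H →L[ℂ] H := gpow (1 / 2) ρ * gpow p σ * gpow (1 / 2) ρ

lemma sandwich_nonneg (hσ : 0 ≤ σ) (p : ℝ) : 0 ≤ sandwich p ρ σ := by
  have := conj_mono (isSelfAdjoint_gpow (1 / 2) ρ) (gpow_nonneg hσ p)
  simpa [sandwich] using this

lemma tendsto_sandwich (hρ : 0 ≤ ρ) (hσ : 0 ≤ σ) {p : ℝ}
    (h : 0 < p ∨ (SuppLE ρ σ ∧ 0 < 1 + p)) :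
    Tendsto (fun ε : ℝ => (ρ + ε • (1 : H →L[ℂ] H)) ^ (1 / 2 : ℝ) *
      (σ + ε • (1 : H →L[ℂ] H)) ^ p * (ρ + ε • (1 : H →L[ℂ] H)) ^ (1 / 2 : ℝ))
      (𝓝[>] 0) (𝓝 (sandwich p ρ σ)) := by
  have hρε : Tendsto (fun ε : ℝ => cfc (fun x : ℝ => (x + ε) ^ (1 / 2 : ℝ)) ρ) (𝓝[>] 0)
      (𝓝 (gpow (1 / 2) ρ)) := tendsto_cfc fun x _ => tendsto_add_rpow_of_pos (by norm_num)
  have heq : (fun ε : ℝ => cfc (fun x : ℝ => (x + ε) ^ (1 / 2 : ℝ)) ρ * cfc (fun x : ℝ => (x + ε) ^ p) σ *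
      cfc (fun x : ℝ => (x + ε) ^ (1 / 2 : ℝ)) ρ) =ᶠ[𝓝[>] 0] fun ε =>
      (ρ + ε • (1 : H →L[ℂ] H)) ^ (1 / 2 : ℝ) * (σ + ε • (1 : H →L[ℂ] H)) ^ p *
        (ρ + ε • (1 : H →L[ℂ] H)) ^ (1 / 2 : ℝ) := by
    filter_upwards [self_mem_nhdsWithin] with ε hε
    rw [add_smul_one_rpow hρ hε, add_smul_one_rpow hσ hε]
  refine Tendsto.congr' heq ?_
  by_cases hp : 0 < p
  · exact (hρε.mul (tendsto_cfc fun x _ => tendsto_add_rpow_of_pos hp)).mul hρε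
  · obtain ⟨hS, hp1⟩ := h.resolve_left hp
    have hsa := IsSelfAdjoint.of_nonneg hρ
    have hZ := hS.mul_kerProj hρ (IsSelfAdjoint.of_nonneg hσ)
    have hZ' : kerProj σ * ρ = 0 := by
      have := congrArg star hZ
      rwa [star_mul, hsa.star_eq, (isSelfAdjoint_kerProj σ).star_eq, star_zero] at this
    -- For nonpositive `p` the singular part of (σ + ε) ^ p is ε ^ p on ker σ. Support inclusion
    -- gives ker σ ⊆ ker ρ, so each outer square root contributes ε ^ (1/2) there and the whole
    -- singular part is ε ^ (1 + p), which vanishes in the limit.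
    have hsplit : ∀ ε : ℝ, cfc (fun x : ℝ => (x + ε) ^ p) σ =
        cfc (fun x : ℝ => if x = 0 then 0 else (x + ε) ^ p) σ + ε ^ p • kerProj σ := by
      intro ε
      rw [kerProj, cfc_smul', cfc_add']
      refine cfc_congr fun x _ => ?_
      by_cases hx : x = 0 <;> simp [hx]
    have h1 : Tendsto (fun ε : ℝ => cfc (fun x : ℝ => if x = 0 then 0 else (x + ε) ^ p) σ)
        (𝓝[>] 0) (𝓝 (gpow p σ)) := by
      refine tendsto_cfc fun x _ => ?_
      by_cases hx : x = 0
      · simp [hx]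
      · simpa [hx] using tendsto_add_rpow hx p
    have h2 : Tendsto (fun ε : ℝ => ε ^ (1 + p) • kerProj σ) (𝓝[>] 0) (𝓝 0) := by
      have := (tendsto_zero_rpow hp1).smul_const (kerProj σ)
      rwa [zero_smul] at this
    have h3 := ((hρε.mul h1).mul hρε).add h2
    rw [add_zero] at h3
    refine h3.congr' ?_
    filter_upwards [self_mem_nhdsWithin] with ε hε
    have hε : 0 < ε := hε
    rw [hsplit ε, mul_add, add_mul, mul_smul_comm, smul_mul_assoc,
      cfc_mul_of_mul_eq_zero hsa hZ, smul_mul_assoc, mul_cfc_of_mul_eq_zero hsa hZ', smul_smul,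
      smul_smul, zero_add, ← Real.rpow_add hε, ← Real.rpow_add hε]
    congr 3
    ring

lemma tr_sandwich_rpow (hσ : 0 ≤ σ) (p q : ℝ) :
    tr (sandwich p ρ σ ^ q) = tr (cfc (fun x : ℝ => x ^ q) (sandwich p ρ σ)) := by
  rw [rpow_eq_cfc (sandwich_nonneg hσ p)]

lemma tendsto_formulaQ_sandwiched (hρ : 0 ≤ ρ) (hσ : 0 ≤ σ) {α : ℝ} (hα : 0 < α)
    (h : α < 1 ∨ SuppLE ρ σ) :
    Tendsto (fun ε : ℝ => formulaQ .sandwiched α (ρ + ε • (1 : H →L[ℂ] H))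
      (σ + ε • (1 : H →L[ℂ] H))) (𝓝[>] 0) (𝓝 (tr (sandwich ((1 - α) / α) ρ σ ^ α))) := by
  have h1 : 0 < (1 - α) / α ∨ (SuppLE ρ σ ∧ 0 < 1 + (1 - α) / α) := by
    rcases h with h | h
    · exact Or.inl (div_pos (by linarith) hα)
    · refine Or.inr ⟨h, ?_⟩
      have : 1 + (1 - α) / α = 1 / α := by field_simp; ring
      rw [this]; positivity
  have h2 := tendsto_sandwich hρ hσ h1
  have hpos : ∀ᶠ ε : ℝ in 𝓝[>] 0, 0 ≤ (ρ + ε • (1 : H →L[ℂ] H)) ^ (1 / 2 : ℝ) *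
      (σ + ε • (1 : H →L[ℂ] H)) ^ ((1 - α) / α) * (ρ + ε • (1 : H →L[ℂ] H)) ^ (1 / 2 : ℝ) := by
    filter_upwards [self_mem_nhdsWithin] with ε hε
    exact (isStrictlyPositive_conj
      (isStrictlyPositive_rpow (isStrictlyPositive_add_smul_one hσ hε) _)
      (isStrictlyPositive_rpow (isStrictlyPositive_add_smul_one hρ hε) _)).nonneg
  have h3 := tendsto_cfc_op (Real.continuous_rpow_const hα.le) h2
    (.of_nonneg (sandwich_nonneg hσ _)) (hpos.mono fun ε h => .of_nonneg h)
  rw [tr_sandwich_rpow hσ]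
  refine ((continuous_tr.tendsto _).comp h3).congr' ?_
  filter_upwards [hpos] with ε hε
  simp only [formulaQ, Function.comp_apply]
  rw [rpow_eq_cfc hε]

/-- Since x - 1 ≤ x ^ α for x > 0, Tr X ^ α is at least Tr X - Tr 1. By cyclicity Tr X is a
Petz-like trace, already known to diverge. -/
lemma tendsto_formulaQ_sandwiched_atTop (hρ : 0 ≤ ρ) (hσ : 0 ≤ σ) {α : ℝ} (hα : 1 < α)
    (h : ¬ SuppLE ρ σ) :
    Tendsto (fun ε : ℝ => formulaQ .sandwiched α (ρ + ε • (1 : H →L[ℂ] H))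
      (σ + ε • (1 : H →L[ℂ] H))) (𝓝[>] 0) atTop := by
  have h1 := tendsto_tr_rpow_mul_rpow_atTop (u := 1) hρ hσ
    (div_neg_of_neg_of_pos (sub_neg.2 hα) (zero_lt_one.trans hα)) h
  refine tendsto_atTop_mono' _ ?_
    (tendsto_atTop_add_const_right _ (-tr (1 : H →L[ℂ] H)) h1)
  filter_upwards [self_mem_nhdsWithin] with ε hε
  have hρε := isStrictlyPositive_add_smul_one hρ hε
  have hX := isStrictlyPositive_conj (isStrictlyPositive_rpow
    (isStrictlyPositive_add_smul_one hσ hε) ((1 - α) / α)) (isStrictlyPositive_rpow hρε (1 / 2))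
  have h2 : tr ((ρ + ε • (1 : H →L[ℂ] H)) ^ (1 : ℝ) *
      (σ + ε • (1 : H →L[ℂ] H)) ^ ((1 - α) / α)) = tr ((ρ + ε • (1 : H →L[ℂ] H)) ^ (1 / 2 : ℝ) *
      (σ + ε • (1 : H →L[ℂ] H)) ^ ((1 - α) / α) * (ρ + ε • (1 : H →L[ℂ] H)) ^ (1 / 2 : ℝ)) := by
    rw [tr_mul_comm (_ * _) (_ ^ (1 / 2 : ℝ)), ← mul_assoc, ← CFC.rpow_add hρε.isUnit]
    norm_num
  simp only [formulaQ]
  rw [h2]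
  set X := (ρ + ε • (1 : H →L[ℂ] H)) ^ (1 / 2 : ℝ) *
      (σ + ε • (1 : H →L[ℂ] H)) ^ ((1 - α) / α) * (ρ + ε • (1 : H →L[ℂ] H)) ^ (1 / 2 : ℝ)
  obtain ⟨b, x, hb⟩ := IsSpectralBasis.exists hX.isSelfAdjoint
  have h3 : tr (1 : H →L[ℂ] H) = ∑ _i : Fin (Module.finrank ℂ H), (1 : ℝ) := by
    have := hb.tr_cfc (fun _ => 1)
    rwa [cfc_const_one ℝ X hX.isSelfAdjoint] at this
  rw [tr_rpow_eq_sum hX.nonneg hb, hb.tr_self, h3, ← sub_eq_add_neg, ← Finset.sum_sub_distrib]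
  refine Finset.sum_le_sum fun i _ => ?_
  have hx := hb.pos hX i
  rcases le_total (x i) 1 with h | h
  · have := Real.rpow_nonneg hx.le α
    linarith
  · have := Real.rpow_le_rpow_of_exponent_le h hα.le
    rw [Real.rpow_one] at this
    linarith

lemma tendsto_formulaQ_petz (hρ : 0 ≤ ρ) (hσ : 0 ≤ σ) {α : ℝ} (hα : 0 < α)
    (h : α < 1 ∨ SuppLE ρ σ) :
    Tendsto (fun ε : ℝ => formulaQ .petz α (ρ + ε • (1 : H →L[ℂ] H))
      (σ + ε • (1 : H →L[ℂ] H))) (𝓝[>] 0) (𝓝 (tr (gpow α ρ * gpow (1 - α) σ))) :=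
  tendsto_tr_rpow_mul_rpow hρ hσ hα
    (h.imp (fun h => by linarith) fun h => ⟨h, by linarith⟩)

lemma tendsto_formulaQ_petz_atTop (hρ : 0 ≤ ρ) (hσ : 0 ≤ σ) {α : ℝ} (hα : 1 < α)
    (h : ¬ SuppLE ρ σ) :
    Tendsto (fun ε : ℝ => formulaQ .petz α (ρ + ε • (1 : H →L[ℂ] H))
      (σ + ε • (1 : H →L[ℂ] H))) (𝓝[>] 0) atTop :=
  tendsto_tr_rpow_mul_rpow_atTop hρ hσ (by linarith) h

end Limits

/-! ### The limit ε ↘ 0 for the log-Euclidean family -/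

section FlatLimit

variable {H : Type*} [NormedAddCommGroup H] [InnerProductSpace ℂ H] [CompleteSpace H]
  [FiniteDimensional ℂ H] {A B ρ σ K M : H →L[ℂ] H}

lemma qf_kerProj (A : H →L[ℂ] H) (v : H) : qf (kerProj A) v = ‖kerProj A v‖ ^ 2 := by
  have h1 := qf_conj (B := 1) (isSelfAdjoint_kerProj A) v
  rwa [mul_one, kerProj_mul_self, qf_one] at h1

lemma kerProj_le_one (A : H →L[ℂ] H) : kerProj A ≤ 1 := by
  by_cases hA : IsSelfAdjoint A
  · have h1 : 0 ≤ 1 - kerProj A := by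
      rw [kerProj, one_sub_cfc _ hA]
      exact cfc_nonneg' fun x _ => by split_ifs <;> norm_num
    exact sub_nonneg.1 h1
  · rw [kerProj, cfc_apply_of_not_predicate A hA]
    exact zero_le_one

lemma qf_one_sub_kerProj (A : H →L[ℂ] H) (v : H) :
    qf (1 - kerProj A) v = ‖(1 - kerProj A) v‖ ^ 2 := by
  have hs : IsSelfAdjoint (1 - kerProj A) := (IsSelfAdjoint.one _).sub (isSelfAdjoint_kerProj A)
  have h2 : (1 - kerProj A) * (1 - kerProj A) = 1 - kerProj A := by
    rw [mul_sub, sub_mul, sub_mul, kerProj_mul_self]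
    simp
  have h1 := qf_conj (B := 1) hs v
  rwa [mul_one, h2, qf_one] at h1

/-- Split `v` along the kernel of `A` and its complement. Young's inequality absorbs the cross term,
at cost δ on the kernel and a large constant on the complement, where the penalty will dominate. -/
lemma abs_qf_sub_qf_kerProj_le (A : H →L[ℂ] H) (hM : IsSelfAdjoint M) {δ : ℝ} (hδ : 0 < δ)
    (v : H) : |qf M v - qf (kerProj A * M * kerProj A) v| ≤
      δ * qf (kerProj A) v + (‖M‖ ^ 2 / δ + ‖M‖) * qf (1 - kerProj A) v := by
  rw [qf_conj (isSelfAdjoint_kerProj A), qf_kerProj, qf_one_sub_kerProj A]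
  set u := kerProj A v
  set w := (1 - kerProj A) v with hw
  have hv : v = u + w := by simp [u, w]
  have hsymm : (inner ℂ w (M u)).re = (inner ℂ u (M w)).re := by
    have h1 := ContinuousLinearMap.adjoint_inner_left M u w
    rw [ContinuousLinearMap.isSelfAdjoint_iff'.1 hM] at h1
    rw [← h1]
    exact inner_re_symm (𝕜 := ℂ) _ _
  have h1 : qf M v - qf M u = 2 * (inner ℂ u (M w)).re + qf M w := by
    rw [hv]
    simp only [qf, map_add, inner_add_left, inner_add_right, Complex.add_re, hsymm]
    ring
  have h2 : |(inner ℂ u (M w)).re| ≤ ‖u‖ * (‖M‖ * ‖w‖) :=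
    ((Complex.abs_re_le_norm _).trans (norm_inner_le_norm _ _)).trans
      (by gcongr; exact M.le_opNorm w)
  have h3 := qf_abs_le M w
  have h4 : 2 * (‖u‖ * (‖M‖ * ‖w‖)) ≤ δ * ‖u‖ ^ 2 + ‖M‖ ^ 2 / δ * ‖w‖ ^ 2 := by
    have h5 : 0 ≤ (δ * ‖u‖ - ‖M‖ * ‖w‖) ^ 2 / δ := by positivity
    have h6 : (δ * ‖u‖ - ‖M‖ * ‖w‖) ^ 2 / δ =
        δ * ‖u‖ ^ 2 - 2 * (‖u‖ * (‖M‖ * ‖w‖)) + ‖M‖ ^ 2 / δ * ‖w‖ ^ 2 := by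
      field_simp
      ring
    linarith
  rw [h1]
  calc |2 * (inner ℂ u (M w)).re + qf M w| ≤ |2 * (inner ℂ u (M w)).re| + |qf M w| :=
        abs_add_le _ _
    _ = 2 * |(inner ℂ u (M w)).re| + |qf M w| := by rw [abs_mul, abs_two]
    _ ≤ _ := by linarith

/-- The compression of `M` commutes with the block-scalar term, so the exponential factors; off the
kernel of `A` the compression is zero and its exponential is the identity. -/
lemma exp_add_kerProj (hA : IsSelfAdjoint A) (hM : IsSelfAdjoint M) (a c : ℝ) :
    NormedSpace.exp (kerProj A * M * kerProj A + (a • kerProj A + c • (1 - kerProj A))) =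
      Real.exp a • (NormedSpace.exp (kerProj A * M * kerProj A) * kerProj A) +
        Real.exp c • (1 - kerProj A) := by
  set P := kerProj A with hP
  set N := P * M * P
  have hPP : P * P = P := kerProj_mul_self A
  have hN : IsSelfAdjoint N := isSelfAdjoint_conj (isSelfAdjoint_kerProj A) hM
  have hNP : N * P = N := by simp only [N]; rw [mul_assoc, hPP]
  have hPN : P * N = N := by simp only [N]; rw [← mul_assoc, ← mul_assoc, hPP]
  have hcomm : Commute N (a • P + c • (1 - P)) := by
    have h1 : Commute N P := by rw [Commute, SemiconjBy, hNP, hPN]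
    exact (h1.smul_right a).add_right (((Commute.one_right N).sub_right h1).smul_right c)
  have h2 : a • P + c • (1 - P) = cfc (fun x : ℝ => if x = 0 then a else c) A := by
    rw [hP, kerProj, one_sub_cfc _ hA, cfc_smul', cfc_smul', cfc_add']
    exact cfc_congr fun x _ => by by_cases hx : x = 0 <;> simp [hx]
  have h3 : NormedSpace.exp (a • P + c • (1 - P)) = Real.exp a • P + Real.exp c • (1 - P) := by
    rw [h2, exp_eq_cfc (isSelfAdjoint_cfc _ _), cfc_cfc _ _ hA, hP, kerProj, one_sub_cfc _ hA,
      cfc_smul', cfc_smul', cfc_add']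
    exact cfc_congr fun x _ => by by_cases hx : x = 0 <;> simp [hx]
  have h4 : NormedSpace.exp N * (1 - P) = 1 - P := by
    have : N * (1 - P) = 0 := by rw [mul_sub, mul_one, hNP, sub_self]
    rw [exp_eq_cfc hN, cfc_mul_of_mul_eq_zero hN this]
    simp
  let : NormedAlgebra ℚ (H →L[ℂ] H) := .restrictScalars ℚ ℂ _
  rw [NormedSpace.exp_add_of_commute hcomm, h3, mul_add, mul_smul_comm, mul_smul_comm, h4]

lemma tr_exp_add_kerProj (hA : IsSelfAdjoint A) (hM : IsSelfAdjoint M) (a c : ℝ) :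
    tr (NormedSpace.exp (kerProj A * M * kerProj A + (a • kerProj A + c • (1 - kerProj A)))) =
      Real.exp a * tr (kerProj A * NormedSpace.exp (kerProj A * M * kerProj A)) +
        Real.exp c * tr (1 - kerProj A) := by
  rw [exp_add_kerProj hA hM, tr_add, tr_smul, tr_smul, tr_mul_comm _ (kerProj A)]

lemma tr_exp_mono {X Y : H →L[ℂ] H} (hX : IsSelfAdjoint X) (hY : IsSelfAdjoint Y) (h : X ≤ Y) :
    tr (NormedSpace.exp X) ≤ tr (NormedSpace.exp Y) := by
  rw [exp_eq_cfc hX, exp_eq_cfc hY]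
  exact tr_cfc_mono convexOn_exp (Real.exp_monotone.monotoneOn _) hX hY (Set.subset_univ _)
    (Set.subset_univ _) h

lemma qf_le_norm_mul_of_mul_kerProj_eq_zero (hK : IsSelfAdjoint K)
    (h : K * kerProj A = 0) (v : H) : qf K v ≤ ‖K‖ * qf (1 - kerProj A) v := by
  have hs : IsSelfAdjoint (1 - kerProj A) := (IsSelfAdjoint.one _).sub (isSelfAdjoint_kerProj A)
  have h1 : kerProj A * K = 0 := by
    have := congrArg star h
    rwa [star_mul, hK.star_eq, (isSelfAdjoint_kerProj A).star_eq, star_zero] at this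
  have h2 : (1 - kerProj A) * K * (1 - kerProj A) = K := by
    rw [sub_mul, one_mul, h1, sub_zero, mul_sub, mul_one, h, sub_zero]
  have h3 := qf_conj (B := K) hs v
  rw [h2] at h3
  rw [h3, qf_one_sub_kerProj A]
  exact (le_abs_self _).trans (qf_abs_le _ _)

/-- A penalty term of strength `-log ε`, vanishing exactly on the kernel of `A`, compresses the
exponential to this kernel as `ε ↘ 0`. -/
lemma tendsto_tr_exp_penalty {N : ℝ → H →L[ℂ] H} (hA : IsSelfAdjoint A) (hM : IsSelfAdjoint M)
    (hN : ∀ ε, IsSelfAdjoint (N ε)) (hlim : Tendsto N (𝓝[>] 0) (𝓝 M)) (hK : IsSelfAdjoint K)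
    (hKA : K * kerProj A = 0) {k : ℝ} (hk : 0 < k) (hKk : k • (1 - kerProj A) ≤ K) :
    Tendsto (fun ε => tr (NormedSpace.exp (N ε + Real.log ε • K))) (𝓝[>] 0)
      (𝓝 (tr (kerProj A * NormedSpace.exp (kerProj A * M * kerProj A)))) := by
  set P := kerProj A with hP
  set F := tr (P * NormedSpace.exp (P * M * P)) with hF
  have hP1 : IsSelfAdjoint P := isSelfAdjoint_kerProj A
  have hd : 0 ≤ tr (1 - P) := tr_nonneg (sub_nonneg.2 (kerProj_le_one A))
  have hsa : ∀ ε : ℝ, IsSelfAdjoint (N ε + Real.log ε • K) := fun ε =>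
    (hN ε).add (isSelfAdjoint_smul_real _ hK)
  have hsa2 : ∀ a c : ℝ, IsSelfAdjoint (P * M * P + (a • P + c • (1 - P))) := fun a c =>
    (isSelfAdjoint_conj hP1 hM).add ((isSelfAdjoint_smul_real _ hP1).add
      (isSelfAdjoint_smul_real _ ((IsSelfAdjoint.one _).sub hP1)))
  have hlog : ∀ᶠ ε : ℝ in 𝓝[>] 0, Real.log ε ≤ 0 := by
    filter_upwards [Ioo_mem_nhdsGT (zero_lt_one (α := ℝ))] with ε hε
    exact Real.log_nonpos hε.1.le hε.2.le
  -- The exponent lies between two block-diagonal operators with exact traces. On the kernel of `A`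
  -- they differ from the compression of `M` by ±2δ. On the complement the upper one has a
  -- coefficient tending to -∞, and the contribution of the lower one is positive and is discarded.
  -- Let ε go to 0 first, then δ.
  have hbound : ∀ δ > 0, ∀ᶠ ε : ℝ in 𝓝[>] 0,
      Real.exp (-(2 * δ)) * F ≤ tr (NormedSpace.exp (N ε + Real.log ε • K)) ∧
      tr (NormedSpace.exp (N ε + Real.log ε • K)) ≤ Real.exp (2 * δ) * F +
        Real.exp ((‖M‖ ^ 2 / δ + ‖M‖ + δ) + Real.log ε * k) * tr (1 - P) := by
    intro δ hδ
    set C := ‖M‖ ^ 2 / δ + ‖M‖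
    have hnear : ∀ᶠ ε : ℝ in 𝓝[>] 0, ‖N ε - M‖ ≤ δ := by
      filter_upwards [Metric.tendsto_nhds.1 hlim δ hδ] with ε hε
      rw [dist_eq_norm] at hε
      exact hε.le
    filter_upwards [hnear, hlog] with ε h1 h2
    have hq : ∀ v, |qf (N ε) v - qf (P * M * P) v| ≤
        2 * δ * qf P v + (C + δ) * qf (1 - P) v := by
      intro v
      have h3 := abs_qf_sub_qf_kerProj_le A hM hδ v
      have h4 : |qf (N ε) v - qf M v| ≤ δ * ‖v‖ ^ 2 := by
        rw [← qf_sub]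
        exact (qf_abs_le _ v).trans (by gcongr)
      have h5 : ‖v‖ ^ 2 = qf P v + qf (1 - P) v := by rw [qf_sub, qf_one]; ring
      rw [h5] at h4
      calc _ = |(qf (N ε) v - qf M v) + (qf M v - qf (P * M * P) v)| := by ring_nf
        _ ≤ _ := abs_add_le _ _
        _ ≤ _ := by linarith
    constructor
    · have h6 : P * M * P + ((-(2 * δ)) • P + (-(C + δ) + Real.log ε * ‖K‖) • (1 - P)) ≤
          N ε + Real.log ε • K := by
        refine le_of_qf_le (hsa2 _ _) (hsa ε) fun v => ?_
        have h7 := (abs_le.1 (hq v)).1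
        have h8 := mul_le_mul_of_nonpos_left
          (qf_le_norm_mul_of_mul_kerProj_eq_zero hK hKA v) h2
        simp only [qf_add, qf_smul]
        linarith
      have h9 := tr_exp_mono (hsa2 _ _) (hsa ε) h6
      rw [tr_exp_add_kerProj hA hM] at h9
      refine le_trans ?_ h9
      have : 0 ≤ Real.exp (-(C + δ) + Real.log ε * ‖K‖) * tr (1 - P) := by positivity
      linarith
    · have h6 : N ε + Real.log ε • K ≤
          P * M * P + ((2 * δ) • P + ((C + δ) + Real.log ε * k) • (1 - P)) := by
        refine le_of_qf_le (hsa ε) (hsa2 _ _) fun v => ?_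
        have h7 := (abs_le.1 (hq v)).2
        have h8 := mul_le_mul_of_nonpos_left (qf_mono hKk v) h2
        simp only [qf_add, qf_smul] at h8 ⊢
        linarith
      have h9 := tr_exp_mono (hsa ε) (hsa2 _ _) h6
      rwa [tr_exp_add_kerProj hA hM] at h9
  have hδ0 : ∀ c : ℝ, Tendsto (fun δ : ℝ => Real.exp (c * δ) * F) (𝓝[>] 0) (𝓝 F) := by
    intro c
    have : Continuous fun δ : ℝ => Real.exp (c * δ) * F := by fun_prop
    have h := this.tendsto 0
    simp only [mul_zero, Real.exp_zero, one_mul] at h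
    exact h.mono_left nhdsWithin_le_nhds
  rw [tendsto_order]
  constructor
  · intro a ha
    obtain ⟨δ, h1, h2⟩ := (((tendsto_order.1 (hδ0 (-2))).1 a ha).and self_mem_nhdsWithin).exists
    filter_upwards [hbound δ h2] with ε hε
    refine h1.trans_le ?_
    rw [neg_mul]
    exact hε.1
  · intro a ha
    obtain ⟨δ, h1, h2⟩ := (((tendsto_order.1 (hδ0 2)).2 a ha).and self_mem_nhdsWithin).exists
    have h3 : Tendsto (fun ε : ℝ => Real.exp (2 * δ) * F +
        Real.exp ((‖M‖ ^ 2 / δ + ‖M‖ + δ) + Real.log ε * k) * tr (1 - P)) (𝓝[>] 0)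
        (𝓝 (Real.exp (2 * δ) * F + 0 * tr (1 - P))) := by
      refine Tendsto.const_add _ (Tendsto.mul_const _ (Real.tendsto_exp_atBot.comp ?_))
      exact tendsto_atBot_add_const_left _ _ (Real.tendsto_log_nhdsGT_zero.atBot_mul_const hk)
    rw [zero_mul, add_zero] at h3
    filter_upwards [hbound δ h2, (tendsto_order.1 h3).2 a h1] with ε h4 h5
    exact h4.2.trans_lt h5

/-- The positive operator whose kernel is the intersection of the supports of `ρ` and `σ`. -/
def kerSum (ρ σ : H →L[ℂ] H) : H →L[ℂ] H := kerProj ρ + kerProj σ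

lemma kerSum_nonneg (ρ σ : H →L[ℂ] H) : 0 ≤ kerSum ρ σ :=
  add_nonneg (kerProj_nonneg ρ) (kerProj_nonneg σ)

lemma isSelfAdjoint_kerSum (ρ σ : H →L[ℂ] H) : IsSelfAdjoint (kerSum ρ σ) :=
  .of_nonneg (kerSum_nonneg ρ σ)

lemma kerProj_mul_kerProj_kerSum (ρ σ : H →L[ℂ] H) :
    kerProj ρ * kerProj (kerSum ρ σ) = 0 ∧ kerProj σ * kerProj (kerSum ρ σ) = 0 := by
  have h : ∀ v, kerProj ρ (kerProj (kerSum ρ σ) v) = 0 ∧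
      kerProj σ (kerProj (kerSum ρ σ) v) = 0 := by
    intro v
    set w := kerProj (kerSum ρ σ) v with hw
    have h1 : kerSum ρ σ w = 0 := by
      rw [hw, ← mul_apply_eq_comp, self_mul_kerProj (isSelfAdjoint_kerSum ρ σ)]; simp
    have h2 : qf (kerSum ρ σ) w = 0 := by rw [qf, h1]; simp
    rw [kerSum, qf_add, qf_kerProj, qf_kerProj] at h2
    have h3 : ‖kerProj ρ w‖ ^ 2 = 0 := by nlinarith [sq_nonneg ‖kerProj ρ w‖, sq_nonneg ‖kerProj σ w‖]
    have h4 : ‖kerProj σ w‖ ^ 2 = 0 := by nlinarith [sq_nonneg ‖kerProj ρ w‖, sq_nonneg ‖kerProj σ w‖]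
    exact ⟨by simpa using h3, by simpa using h4⟩
  exact ⟨ContinuousLinearMap.ext fun v => by simpa using (h v).1,
    ContinuousLinearMap.ext fun v => by simpa using (h v).2⟩

/-- Take for `k` the smallest nonzero point of the finite spectrum; if there is none, any positive
value does. -/
lemma exists_pos_smul_one_sub_kerProj_le (hA : 0 ≤ A) :
    ∃ k : ℝ, 0 < k ∧ k • (1 - kerProj A) ≤ A := by
  have hs := IsSelfAdjoint.of_nonneg hA
  have hfin : (spectrum ℝ A \ {0}).Finite := (finite_spectrum_real A).subset Set.sdiff_subset
  have hk : ∃ k : ℝ, 0 < k ∧ ∀ x ∈ spectrum ℝ A \ {0}, k ≤ x := by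
    rcases (spectrum ℝ A \ {0}).eq_empty_or_nonempty with h | h
    · exact ⟨1, one_pos, by simp [h]⟩
    · obtain ⟨k, hk, hmin⟩ := hfin.exists_minimalFor (fun x => x) _ h
      refine ⟨k, (spectrum_nonneg hA hk.1 : (0 : ℝ) ≤ k).lt_of_ne fun h0 => hk.2 h0.symm, ?_⟩
      intro x hx
      rcases le_total k x with h | h
      · exact h
      · exact hmin hx h
  obtain ⟨k, hk0, hk⟩ := hk
  refine ⟨k, hk0, ?_⟩
  rw [kerProj, one_sub_cfc _ hs, cfc_smul']
  nth_rw 2 [← cfc_id' ℝ A]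
  refine cfc_mono (fun x hx => ?_) (continuousOn_spectrum _ _) (continuousOn_spectrum _ _)
  by_cases h0 : x = 0
  · simp [h0]
  · simpa [h0] using hk x ⟨hx, h0⟩

lemma SuppLE.kerProj_le (h : SuppLE ρ σ) (hρ : 0 ≤ ρ) (hσ : 0 ≤ σ) : kerProj σ ≤ kerProj ρ := by
  have hsa := IsSelfAdjoint.of_nonneg hρ
  have hZ := h.mul_kerProj hρ (IsSelfAdjoint.of_nonneg hσ)
  have hZ' : kerProj σ * ρ = 0 := by
    have := congrArg star hZ
    rwa [star_mul, hsa.star_eq, (isSelfAdjoint_kerProj σ).star_eq, star_zero] at this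
  have h1 : kerProj ρ * kerProj σ = kerProj σ := by
    have := cfc_mul_of_mul_eq_zero hsa hZ (fun x => if x = 0 then 1 else 0)
    simp only [if_true, one_smul] at this
    exact this
  have h2 : kerProj σ * kerProj ρ = kerProj σ := by
    have := mul_cfc_of_mul_eq_zero hsa hZ' (fun x => if x = 0 then 1 else 0)
    simp only [if_true, one_smul] at this
    exact this
  have h3 := conj_mono (isSelfAdjoint_kerProj ρ) (kerProj_le_one σ)
  rwa [h1, h2, mul_one, kerProj_mul_self] at h3

/-- The weighted sum of kernel projections multiplying `log ε` in the exponent. -/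
lemma flat_penalty (hρ : 0 ≤ ρ) (hσ : 0 ≤ σ) {α : ℝ} (hα : 0 < α) (h : α < 1 ∨ SuppLE ρ σ) :
    ∃ k : ℝ, 0 < k ∧
      k • (1 - kerProj (kerSum ρ σ)) ≤ α • kerProj ρ + (1 - α) • kerProj σ := by
  obtain ⟨k, hk, hle⟩ := exists_pos_smul_one_sub_kerProj_le (kerSum_nonneg ρ σ)
  have hP : IsSelfAdjoint (1 - kerProj (kerSum ρ σ)) :=
    (IsSelfAdjoint.one _).sub (isSelfAdjoint_kerProj _)
  have hK : IsSelfAdjoint (α • kerProj ρ + (1 - α) • kerProj σ) :=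
    (isSelfAdjoint_smul_real _ (isSelfAdjoint_kerProj ρ)).add
      (isSelfAdjoint_smul_real _ (isSelfAdjoint_kerProj σ))
  rcases lt_or_ge α 1 with h1 | h1
  · have hm : 0 < min α (1 - α) := lt_min hα (by linarith)
    refine ⟨min α (1 - α) * k, mul_pos hm hk, ?_⟩
    refine le_of_qf_le (isSelfAdjoint_smul_real _ hP) hK fun v => ?_
    have h2 := qf_mono hle v
    have h3 := qf_nonneg (kerProj_nonneg ρ) v
    have h4 := qf_nonneg (kerProj_nonneg σ) v
    have h5 := mul_le_mul_of_nonneg_right (min_le_left α (1 - α)) h3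
    have h6 := mul_le_mul_of_nonneg_right (min_le_right α (1 - α)) h4
    have h7 := mul_le_mul_of_nonneg_left h2 hm.le
    rw [show qf (kerSum ρ σ) v = qf (kerProj ρ) v + qf (kerProj σ) v from qf_add _ _ _,
      qf_smul] at h7
    rw [qf_smul, qf_add, qf_smul, qf_smul]
    linarith
  · have hS : SuppLE ρ σ := h.resolve_left (not_lt.2 h1)
    -- Here 1 - α ≤ 0, but ker σ ⊆ ker ρ. With p and q the forms of the projections for ρ and σ, q ≤
    -- p gives α p + (1 - α) q ≥ p ≥ (p + q) / 2, whence the factor 1/2.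
    refine ⟨k / 2, by positivity, ?_⟩
    refine le_of_qf_le (isSelfAdjoint_smul_real _ hP) hK fun v => ?_
    have h2 := qf_mono hle v
    have h3 := qf_mono (hS.kerProj_le hρ hσ) v
    have h4 := mul_le_mul_of_nonneg_left h3 (sub_nonneg.2 h1)
    rw [show qf (kerSum ρ σ) v = qf (kerProj ρ) v + qf (kerProj σ) v from qf_add _ _ _,
      qf_smul] at h2
    rw [qf_smul, qf_add, qf_smul, qf_smul]
    linarith

/-- The regular part of `log (A + ε)`. -/
def regLog (ε : ℝ) (A : H →L[ℂ] H) : H →L[ℂ] H :=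
  cfc (fun x : ℝ => if x = 0 then 0 else Real.log (x + ε)) A

lemma isSelfAdjoint_regLog (ε : ℝ) (A : H →L[ℂ] H) : IsSelfAdjoint (regLog ε A) :=
  isSelfAdjoint_cfc _ _

lemma log_add_smul_one (hA : IsSelfAdjoint A) (ε : ℝ) :
    CFC.log (A + ε • (1 : H →L[ℂ] H)) = regLog ε A + Real.log ε • kerProj A := by
  rw [log_eq_cfc, cfc_add_smul_one _ hA, regLog, kerProj, cfc_smul', cfc_add']
  exact cfc_congr fun x _ => by by_cases hx : x = 0 <;> simp [hx]

/-- The convention `Real.log 0 = 0` makes `CFC.log A` vanish on the kernel, as the regular part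
does. -/
lemma tendsto_regLog (A : H →L[ℂ] H) :
    Tendsto (fun ε => regLog ε A) (𝓝[>] 0) (𝓝 (CFC.log A)) := by
  refine tendsto_cfc fun x _ => ?_
  by_cases hx : x = 0
  · simp [hx]
  · simp only [hx, if_false]
    have h1 : Tendsto (fun ε : ℝ => x + ε) (𝓝[>] 0) (𝓝 x) := by
      have : Tendsto (fun ε : ℝ => x + ε) (𝓝 0) (𝓝 (x + 0)) :=
        (continuous_const.add continuous_id).tendsto 0
      rw [add_zero] at this
      exact this.mono_left nhdsWithin_le_nhds
    exact h1.log hx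

/-- The limiting log-Euclidean quantity on the intersection of the supports. -/
def flatQ (α : ℝ) (ρ σ : H →L[ℂ] H) : ℝ :=
  tr (kerProj (kerSum ρ σ) * NormedSpace.exp (kerProj (kerSum ρ σ) *
    (α • CFC.log ρ + (1 - α) • CFC.log σ) * kerProj (kerSum ρ σ)))

lemma formulaQ_flat_reg (hρ : IsSelfAdjoint ρ) (hσ : IsSelfAdjoint σ) (α ε : ℝ) :
    formulaQ .flat α (ρ + ε • (1 : H →L[ℂ] H)) (σ + ε • (1 : H →L[ℂ] H)) =
      tr (NormedSpace.exp ((α • regLog ε ρ + (1 - α) • regLog ε σ) +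
        Real.log ε • (α • kerProj ρ + (1 - α) • kerProj σ))) := by
  simp only [formulaQ]
  rw [log_add_smul_one hρ, log_add_smul_one hσ]
  congr 2
  module

lemma isSelfAdjoint_regLog_comb (α ε : ℝ) :
    IsSelfAdjoint (α • regLog ε ρ + (1 - α) • regLog ε σ) :=
  (isSelfAdjoint_smul_real _ (isSelfAdjoint_regLog _ _)).add
    (isSelfAdjoint_smul_real _ (isSelfAdjoint_regLog _ _))

lemma tendsto_formulaQ_flat (hρ : 0 ≤ ρ) (hσ : 0 ≤ σ) {α : ℝ} (hα : 0 < α)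
    (h : α < 1 ∨ SuppLE ρ σ) :
    Tendsto (fun ε : ℝ => formulaQ .flat α (ρ + ε • (1 : H →L[ℂ] H))
      (σ + ε • (1 : H →L[ℂ] H))) (𝓝[>] 0) (𝓝 (flatQ α ρ σ)) := by
  obtain ⟨k, hk, hle⟩ := flat_penalty hρ hσ hα h
  simp only [formulaQ_flat_reg (IsSelfAdjoint.of_nonneg hρ) (IsSelfAdjoint.of_nonneg hσ)]
  refine tendsto_tr_exp_penalty (isSelfAdjoint_kerSum ρ σ) (isSelfAdjoint_flat _ _ _)
    (fun ε => isSelfAdjoint_regLog_comb α ε)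
    (((tendsto_regLog ρ).const_smul α).add ((tendsto_regLog σ).const_smul (1 - α)))
    ((isSelfAdjoint_smul_real _ (isSelfAdjoint_kerProj ρ)).add
      (isSelfAdjoint_smul_real _ (isSelfAdjoint_kerProj σ))) ?_ hk hle
  obtain ⟨h1, h2⟩ := kerProj_mul_kerProj_kerSum ρ σ
  rw [add_mul, smul_mul_assoc, smul_mul_assoc, h1, h2]
  simp

lemma exp_qf_le_tr_exp {X : H →L[ℂ] H} (hX : IsSelfAdjoint X) {v : H} (hv : ‖v‖ = 1) :
    Real.exp (qf X v) ≤ tr (NormedSpace.exp X) := by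
  have h1 := le_qf_cfc convexOn_exp hX (Set.subset_univ _) hv
  refine h1.trans ?_
  rw [← exp_eq_cfc hX]
  exact qf_le_tr (isStrictlyPositive_exp hX).nonneg hv

/-- Test the exponent on an eigenvector of ρ in its support that is not orthogonal to ker σ. The
ρ-penalty vanishes there, the σ-penalty is (1 - α) log ε times a positive number and tends to ∞, and
the trace of the exponential dominates the exponential of the form. -/
lemma tendsto_formulaQ_flat_atTop (hρ : 0 ≤ ρ) (hσ : 0 ≤ σ) {α : ℝ} (hα : 1 < α)
    (h : ¬ SuppLE ρ σ) :
    Tendsto (fun ε : ℝ => formulaQ .flat α (ρ + ε • (1 : H →L[ℂ] H))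
      (σ + ε • (1 : H →L[ℂ] H))) (𝓝[>] 0) atTop := by
  have hρs := IsSelfAdjoint.of_nonneg hρ
  have hσs := IsSelfAdjoint.of_nonneg hσ
  obtain ⟨b, x, hb⟩ := IsSpectralBasis.exists hρs
  obtain ⟨c, y, hc⟩ := IsSpectralBasis.exists hσs
  obtain ⟨i, j, hx, hy, hw⟩ := exists_inner_ne_zero h hb hc
  have hv : ‖b i‖ = 1 := b.orthonormal.1 i
  have h1 : qf (kerProj ρ) (b i) = 0 := by
    rw [kerProj, hb.qf_cfc_self]; simp [hx]
  have h2 : 0 < qf (kerProj σ) (b i) := by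
    rw [kerProj, hc.qf_cfc]
    refine Finset.sum_pos' (fun j _ => ?_) ⟨j, Finset.mem_univ _, ?_⟩
    · split_ifs <;> positivity
    · simp only [hy, if_true, one_mul]
      exact lt_of_le_of_ne (by positivity) hw.symm
  simp only [formulaQ_flat_reg hρs hσs]
  have hsa : ∀ ε : ℝ, IsSelfAdjoint ((α • regLog ε ρ + (1 - α) • regLog ε σ) +
        Real.log ε • (α • kerProj ρ + (1 - α) • kerProj σ)) := fun ε =>
    (isSelfAdjoint_regLog_comb α ε).add (isSelfAdjoint_smul_real _
      ((isSelfAdjoint_smul_real _ (isSelfAdjoint_kerProj ρ)).add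
        (isSelfAdjoint_smul_real _ (isSelfAdjoint_kerProj σ))))
  refine tendsto_atTop_mono (fun ε => exp_qf_le_tr_exp (hsa ε) hv) ?_
  refine Real.tendsto_exp_atTop.comp ?_
  have h3 : Tendsto (fun ε => qf (α • regLog ε ρ + (1 - α) • regLog ε σ) (b i)) (𝓝[>] 0)
      (𝓝 (qf (α • CFC.log ρ + (1 - α) • CFC.log σ) (b i))) :=
    ((continuous_qf (b i)).tendsto _).comp
      (((tendsto_regLog ρ).const_smul α).add ((tendsto_regLog σ).const_smul (1 - α)))
  have h4 : Tendsto (fun ε : ℝ => Real.log ε * ((1 - α) * qf (kerProj σ) (b i))) (𝓝[>] 0)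
      atTop :=
    Real.tendsto_log_nhdsGT_zero.atBot_mul_const_of_neg
      (mul_neg_of_neg_of_pos (by linarith) h2)
  refine (h3.add_atTop h4).congr fun ε => ?_
  rw [qf_add _ (Real.log ε • _), qf_smul, qf_add (α • kerProj ρ), qf_smul, qf_smul, h1]
  ring

end FlatLimit

/-! ### Dependence on α for the Petz and sandwiched families -/

section OrderLimits

variable {H : Type*} [NormedAddCommGroup H] [InnerProductSpace ℂ H] [CompleteSpace H]
  [FiniteDimensional ℂ H] {A B ρ σ : H →L[ℂ] H}

lemma differentiable_gpow_scalar {x : ℝ} (hx : 0 ≤ x) :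
    Differentiable ℝ fun p : ℝ => if x = 0 then (0 : ℝ) else x ^ p := by
  by_cases h : x = 0
  · simp [h]
  · simp only [h, if_false, Real.rpow_def_of_pos (hx.lt_of_ne (Ne.symm h))]
    fun_prop

lemma tr_gpow_mul_gpow_eq_sum {b c : OrthonormalBasis (Fin (Module.finrank ℂ H)) ℂ H}
    {x y : Fin (Module.finrank ℂ H) → ℝ} (hb : IsSpectralBasis ρ b x)
    (hc : IsSpectralBasis σ c y) (p q : ℝ) :
    tr (gpow p ρ * gpow q σ) = ∑ i, ∑ j, (if x i = 0 then 0 else x i ^ p) *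
      (if y j = 0 then 0 else y j ^ q) * ‖inner ℂ (c j) (b i)‖ ^ 2 :=
  hb.tr_cfc_mul_cfc hc _ _

lemma differentiable_tr_gpow_mul_gpow (hρ : 0 ≤ ρ) (hσ : 0 ≤ σ) :
    Differentiable ℝ fun z : ℝ × ℝ => tr (gpow z.1 ρ * gpow z.2 σ) := by
  obtain ⟨b, x, hb⟩ := IsSpectralBasis.exists (IsSelfAdjoint.of_nonneg hρ)
  obtain ⟨c, y, hc⟩ := IsSpectralBasis.exists (IsSelfAdjoint.of_nonneg hσ)
  simp only [tr_gpow_mul_gpow_eq_sum hb hc]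
  refine Differentiable.fun_sum fun i _ => Differentiable.fun_sum fun j _ => ?_
  have h1 := differentiable_gpow_scalar (spectrum_nonneg hρ (hb.mem i))
  have h2 := differentiable_gpow_scalar (spectrum_nonneg hσ (hc.mem j))
  exact ((h1.comp differentiable_fst).mul (h2.comp differentiable_snd)).mul_const _

lemma gpow_one (hA : 0 ≤ A) : gpow 1 A = A := by
  rw [gpow_eq_rpow hA one_ne_zero, CFC.rpow_one A hA]

lemma gpow_zero (hA : IsSelfAdjoint A) : gpow 0 A = 1 - kerProj A := by
  rw [kerProj, one_sub_cfc _ hA, gpow]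
  exact cfc_congr fun x _ => by by_cases hx : x = 0 <;> simp [hx]

lemma gpow_half_mul_self (hA : 0 ≤ A) : gpow (1 / 2) A * gpow (1 / 2) A = A := by
  nth_rw 3 [← gpow_one hA]
  rw [gpow, cfc_mul', gpow]
  refine cfc_congr fun x hx => ?_
  by_cases h : x = 0
  · simp [h]
  · have : 0 < x := (spectrum_nonneg hA hx : (0 : ℝ) ≤ x).lt_of_ne (Ne.symm h)
    simp only [h, if_false]
    rw [← Real.rpow_add this]
    norm_num

lemma tr_sandwich (hρ : 0 ≤ ρ) (p : ℝ) : tr (sandwich p ρ σ) = tr (gpow 1 ρ * gpow p σ) := by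
  rw [sandwich, tr_mul_comm, ← mul_assoc, gpow_half_mul_self hρ, gpow_one hρ]

lemma continuous_gpow (hA : 0 ≤ A) : Continuous fun p => gpow p A :=
  continuous_iff_continuousAt.2 fun _ => tendsto_cfc fun _ hx =>
    (differentiable_gpow_scalar (spectrum_nonneg hA hx)).continuous.tendsto _

lemma continuous_sandwich (hσ : 0 ≤ σ) : Continuous fun p => sandwich p ρ σ :=
  (continuous_const.mul (continuous_gpow hσ)).mul continuous_const

lemma exp_sub_one_sub_le (u : ℝ) : Real.exp u - 1 - u ≤ u ^ 2 * max 1 (Real.exp u) := by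
  have h1 := Real.add_one_le_exp (-u)
  have h2 := Real.add_one_le_exp u
  have h3 : Real.exp u * Real.exp (-u) = 1 := by rw [← Real.exp_add]; simp
  have h4 := Real.exp_pos u
  rcases le_total 0 u with h | h
  · have h5 : Real.exp u - 1 ≤ u * Real.exp u := by nlinarith
    have h6 : u * (Real.exp u - 1) ≤ u ^ 2 * Real.exp u := by nlinarith
    have h7 : u ^ 2 * Real.exp u ≤ u ^ 2 * max 1 (Real.exp u) := by
      gcongr; exact le_max_right _ _
    linarith
  · have h5 : u * (Real.exp u - 1) ≤ u ^ 2 := by nlinarith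
    have h6 : Real.exp u - 1 - u ≤ u * (Real.exp u - 1) := by nlinarith
    have h7 : u ^ 2 * 1 ≤ u ^ 2 * max 1 (Real.exp u) := by
      gcongr; exact le_max_left _ _
    linarith

/-- Uniform second-order estimate for `h ↦ x ^ (1 + h)` at `h = 0` on bounded sets of `x ≥ 0`. -/
lemma exists_rpow_one_add_sub_le (R : ℝ) : ∃ C : ℝ, ∀ x ∈ Set.Icc 0 R, ∀ h : ℝ, |h| ≤ 1 / 2 →
    |x ^ (1 + h) - x - h * (x * Real.log x)| ≤ C * h ^ 2 := by
  -- For x ≤ 1 the bound 16 is the square of |x ^ (1/4) log x| < 4, the power x ^ (-1/2) coming from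
  -- |h| ≤ 1/2. For x ≥ 1, log x ≤ x gives a bound x ^ 4 ≤ |R| ^ 5.
  refine ⟨16 + |R| ^ 5, fun x hx h hh => ?_⟩
  rcases eq_or_lt_of_le hx.1 with h0 | h0
  · rw [← h0, Real.zero_rpow (by have := (abs_le.1 hh).1; linarith)]
    simp
    positivity
  have hx1 : x ^ (1 + h) = x * Real.exp (h * Real.log x) := by
    rw [Real.rpow_add h0, Real.rpow_one, Real.rpow_def_of_pos h0, mul_comm h]
  set L := Real.log x with hL
  have h1 : x ^ (1 + h) - x - h * (x * L) = x * (Real.exp (h * L) - 1 - h * L) := by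
    rw [hx1]; ring
  have h2 : 0 ≤ Real.exp (h * L) - 1 - h * L := by
    have := Real.add_one_le_exp (h * L); linarith
  rw [h1, abs_of_nonneg (mul_nonneg h0.le h2)]
  have h3 : x * L ^ 2 * max 1 (Real.exp (h * L)) ≤ 16 + |R| ^ 5 := by
    rcases le_total x 1 with hx2 | hx2
    · have hL0 : L ≤ 0 := Real.log_nonpos h0.le hx2
      have h4 : max 1 (Real.exp (h * L)) ≤ x ^ (-(1 / 2) : ℝ) := by
        rw [Real.rpow_def_of_pos h0]
        have h5 : h * L ≤ L * -(1 / 2) := by nlinarith [(abs_le.1 hh).1]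
        refine max_le ?_ (Real.exp_le_exp.2 h5)
        exact Real.one_le_exp (by linarith)
      have h6 : |L * x ^ (1 / 4 : ℝ)| < 4 :=
        (Real.abs_log_mul_self_rpow_lt x (1 / 4) h0 hx2 (by norm_num)).trans_eq (by norm_num)
      have h7 : (L * x ^ (1 / 4 : ℝ)) ^ 2 ≤ 16 := by
        rw [← sq_abs]
        have := abs_nonneg (L * x ^ (1 / 4 : ℝ))
        nlinarith
      have h8 : x * L ^ 2 * x ^ (-(1 / 2) : ℝ) = (L * x ^ (1 / 4 : ℝ)) ^ 2 := by
        have h9 : x * x ^ (-(1 / 2) : ℝ) = x ^ (1 / 4 : ℝ) * x ^ (1 / 4 : ℝ) := by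
          rw [← Real.rpow_add h0]
          nth_rw 1 [← Real.rpow_one x]
          rw [← Real.rpow_add h0]
          norm_num
        linear_combination L ^ 2 * h9
      calc _ ≤ x * L ^ 2 * x ^ (-(1 / 2) : ℝ) := by gcongr
        _ ≤ 16 := h8.trans_le h7
        _ ≤ _ := le_add_of_nonneg_right (by positivity)
    · have hL0 : 0 ≤ L := Real.log_nonneg hx2
      have hLx : L ≤ x := (Real.log_le_sub_one_of_pos h0).trans (by linarith)
      have hxR : x ≤ |R| := hx.2.trans (le_abs_self R)
      have h4 : max 1 (Real.exp (h * L)) ≤ x := by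
        refine max_le hx2 ?_
        have h5 : h * L ≤ L := by nlinarith [(abs_le.1 hh).2]
        calc _ ≤ Real.exp L := Real.exp_le_exp.2 h5
          _ = x := Real.exp_log h0
      calc _ ≤ x * x ^ 2 * x := by gcongr
        _ = x ^ 4 := by ring
        _ ≤ x ^ 5 := pow_le_pow_right₀ hx2 (by norm_num)
        _ ≤ |R| ^ 5 := by gcongr
        _ ≤ _ := by linarith
  calc _ ≤ x * ((h * L) ^ 2 * max 1 (Real.exp (h * L))) := by
        gcongr; exact exp_sub_one_sub_le _
    _ = (x * L ^ 2 * max 1 (Real.exp (h * L))) * h ^ 2 := by ring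
    _ ≤ _ := by gcongr

lemma le_norm_of_mem_spectrum {x : ℝ} (hx : x ∈ spectrum ℝ A) : x ≤ ‖A‖ := by
  have hn : Nontrivial (H →L[ℂ] H) := by
    by_contra hnt
    rw [not_nontrivial_iff_subsingleton] at hnt
    simp [spectrum.of_subsingleton] at hx
  exact (le_abs_self x).trans (spectrum.norm_le_norm_of_mem hx)

/-- The trace of a power with varying exponent and operator is differentiable at exponent `1`. -/
lemma differentiableAt_tr_cfc_rpow {X : ℝ → H →L[ℂ] H} (hX : ∀ a, 0 ≤ X a)
    (hc : ContinuousAt X 1) (hd : DifferentiableAt ℝ (fun a => tr (X a)) 1) :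
    DifferentiableAt ℝ (fun a => tr (cfc (fun x : ℝ => x ^ a) (X a))) 1 := by
  have hsa : ∀ a, IsSelfAdjoint (X a) := fun a => .of_nonneg (hX a)
  obtain ⟨C, hC⟩ := exists_rpow_one_add_sub_le (‖X 1‖ + 1)
  let T : ℝ → ℝ := fun a => tr (cfc (fun x : ℝ => x * Real.log x) (X a))
  have hT : Tendsto T (𝓝 1) (𝓝 (T 1)) :=
    (continuous_tr.tendsto _).comp (tendsto_cfc_op Real.continuous_mul_log hc (hsa 1)
      (Eventually.of_forall hsa))
  have hnorm : ∀ᶠ a in 𝓝 (1 : ℝ), ‖X a‖ ≤ ‖X 1‖ + 1 := by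
    have := (continuous_norm.tendsto _).comp hc.tendsto
    filter_upwards [(tendsto_order.1 this).2 (‖X 1‖ + 1) (by linarith)] with a ha
    exact ha.le
  have hball : ∀ᶠ a in 𝓝 (1 : ℝ), |a - 1| ≤ 1 / 2 := by
    filter_upwards [Metric.closedBall_mem_nhds (1 : ℝ) (by norm_num : (0 : ℝ) < 1 / 2)] with a ha
    rwa [Metric.mem_closedBall, Real.dist_eq] at ha
  let d : ℝ := Fintype.card (Fin (Module.finrank ℂ H))
  have hbound : ∀ᶠ a in 𝓝 (1 : ℝ), |(tr (cfc (fun x : ℝ => x ^ a) (X a)) - tr (X a)) -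
      (a - 1) * T a| ≤ d * (C * (a - 1) ^ 2) := by
    filter_upwards [hnorm, hball] with a h1 h2
    obtain ⟨b, x, hb⟩ := IsSpectralBasis.exists (hsa a)
    simp only [T]
    rw [hb.tr_cfc, hb.tr_self, hb.tr_cfc, Finset.mul_sum, ← Finset.sum_sub_distrib,
      ← Finset.sum_sub_distrib]
    refine (Finset.abs_sum_le_sum_abs _ _).trans ?_
    refine (Finset.sum_le_card_nsmul Finset.univ _ (C * (a - 1) ^ 2) fun i _ => ?_).trans_eq ?_
    · have := hC (x i) ⟨spectrum_nonneg (hX a) (hb.mem i),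
        (le_norm_of_mem_spectrum (hb.mem i)).trans h1⟩ (a - 1) h2
      rwa [add_sub_cancel] at this
    · simp [d]
  -- The difference Tr X(a) ^ a - Tr X(a) equals (a - 1) T(a) + O((a - 1)²) uniformly for bounded
  -- X(a). Continuity of T at 1 therefore gives derivative T(1), and only the trace of `X`, not `X`
  -- itself, has to be differentiable.
  have hR : HasDerivAt (fun a => tr (cfc (fun x : ℝ => x ^ a) (X a)) - tr (X a)) (T 1) 1 := by
    have h1 : tr (cfc (fun x : ℝ => x ^ (1 : ℝ)) (X 1)) - tr (X 1) = 0 := by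
      simp only [Real.rpow_one]
      rw [cfc_id' ℝ (X 1) (hsa 1), sub_self]
    rw [hasDerivAt_iff_isLittleO, h1]
    have h2 : (fun a : ℝ => (tr (cfc (fun x : ℝ => x ^ a) (X a)) - tr (X a)) -
        (a - 1) * T a) =o[𝓝 1] fun a => a - 1 := by
      have h3 : (fun a : ℝ => (tr (cfc (fun x : ℝ => x ^ a) (X a)) - tr (X a)) -
        (a - 1) * T a) =O[𝓝 1] fun a => (a - 1) ^ 2 := by
        refine Asymptotics.IsBigO.of_bound (d * C) ?_
        filter_upwards [hbound] with a ha
        rw [Real.norm_eq_abs, Real.norm_eq_abs, abs_of_nonneg (sq_nonneg (a - 1)), mul_assoc]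
        exact ha
      refine h3.trans_isLittleO ?_
      have h4 : Tendsto (fun a : ℝ => a - 1) (𝓝 1) (𝓝 0) := by
        have : Tendsto (fun a : ℝ => a - 1) (𝓝 1) (𝓝 (1 - 1)) :=
          (continuous_id.sub continuous_const).tendsto 1
        rwa [sub_self] at this
      have h5 := (Asymptotics.isLittleO_one_iff ℝ).2 h4
      simpa [pow_two] using h5.mul_isBigO (Asymptotics.isBigO_refl (fun a : ℝ => a - 1) (𝓝 1))
    have h6 : (fun a : ℝ => (a - 1) * (T a - T 1)) =o[𝓝 1] fun a => a - 1 := by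
      have h4 : Tendsto (fun a : ℝ => T a - T 1) (𝓝 1) (𝓝 0) := by
        have := hT.sub_const (T 1)
        rwa [sub_self] at this
      have h5 := (Asymptotics.isLittleO_one_iff ℝ).2 h4
      simpa using (Asymptotics.isBigO_refl (fun a : ℝ => a - 1) (𝓝 1)).mul_isLittleO h5
    refine (h2.add h6).congr_left fun a => ?_
    simp only [smul_eq_mul]
    ring
  have := hR.differentiableAt.add hd
  refine this.congr_of_eventuallyEq (Eventually.of_forall fun a => ?_)
  simp

/-- The limit as `ε ↘ 0` of `Q_α(ρ + ε‖σ + ε)`, where it is finite. -/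
def limQ (t : Family) (α : ℝ) (ρ σ : H →L[ℂ] H) : ℝ :=
  match t with
  | .petz => tr (gpow α ρ * gpow (1 - α) σ)
  | .sandwiched => tr (sandwich ((1 - α) / α) ρ σ ^ α)
  | .flat => flatQ α ρ σ

lemma tendsto_formulaQ (t : Family) (hρ : 0 ≤ ρ) (hσ : 0 ≤ σ) {α : ℝ} (hα : 0 < α)
    (h : α < 1 ∨ SuppLE ρ σ) :
    Tendsto (fun ε : ℝ => formulaQ t α (ρ + ε • (1 : H →L[ℂ] H))
      (σ + ε • (1 : H →L[ℂ] H))) (𝓝[>] 0) (𝓝 (limQ t α ρ σ)) := by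
  cases t
  · exact tendsto_formulaQ_petz hρ hσ hα h
  · exact tendsto_formulaQ_sandwiched hρ hσ hα h
  · exact tendsto_formulaQ_flat hρ hσ hα h

lemma tendsto_formulaQ_atTop (t : Family) (hρ : 0 ≤ ρ) (hσ : 0 ≤ σ) {α : ℝ} (hα : 1 < α)
    (h : ¬ SuppLE ρ σ) :
    Tendsto (fun ε : ℝ => formulaQ t α (ρ + ε • (1 : H →L[ℂ] H))
      (σ + ε • (1 : H →L[ℂ] H))) (𝓝[>] 0) atTop := by
  cases t
  · exact tendsto_formulaQ_petz_atTop hρ hσ hα h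
  · exact tendsto_formulaQ_sandwiched_atTop hρ hσ hα h
  · exact tendsto_formulaQ_flat_atTop hρ hσ hα h

lemma formulaQ_order_one (t : Family) (hρ : IsStrictlyPositive ρ) (hσ : IsStrictlyPositive σ) :
    formulaQ t 1 ρ σ = tr ρ := by
  cases t
  · simp only [formulaQ]
    rw [CFC.rpow_one ρ hρ.nonneg, sub_self, CFC.rpow_zero σ hσ.nonneg, mul_one]
  · simp only [formulaQ]
    have h1 : ρ ^ (1 / 2 : ℝ) * ρ ^ (1 / 2 : ℝ) = ρ := by
      rw [← CFC.rpow_add hρ.isUnit]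
      norm_num
      exact CFC.rpow_one ρ hρ.nonneg
    rw [sub_self, zero_div, CFC.rpow_zero σ hσ.nonneg, mul_one, h1, CFC.rpow_one ρ hρ.nonneg]
  · simp only [formulaQ]
    rw [sub_self, zero_smul, add_zero, one_smul, CFC.exp_log ρ hρ]

lemma tendsto_formulaQ_order_one (t : Family) (hρ : 0 ≤ ρ) (hσ : 0 ≤ σ) :
    Tendsto (fun ε : ℝ => formulaQ t 1 (ρ + ε • (1 : H →L[ℂ] H))
      (σ + ε • (1 : H →L[ℂ] H))) (𝓝[>] 0) (𝓝 (tr ρ)) := by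
  have h1 : Tendsto (fun ε : ℝ => tr (ρ + ε • (1 : H →L[ℂ] H))) (𝓝[>] 0) (𝓝 (tr ρ)) := by
    have : Continuous fun ε : ℝ => tr (ρ + ε • (1 : H →L[ℂ] H)) :=
      continuous_tr.comp (by fun_prop)
    have h := this.tendsto 0
    rw [zero_smul, add_zero] at h
    exact h.mono_left nhdsWithin_le_nhds
  refine h1.congr' ?_
  filter_upwards [self_mem_nhdsWithin] with ε hε
  exact (formulaQ_order_one t (isStrictlyPositive_add_smul_one hρ hε)
    (isStrictlyPositive_add_smul_one hσ hε)).symm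

/-- At order one the closed formula reduces to the trace of its first argument, so the same limit in
ε is computed in two ways. -/
lemma limQ_one_of_suppLE (t : Family) (hρ : 0 ≤ ρ) (hσ : 0 ≤ σ) (h : SuppLE ρ σ) :
    limQ t 1 ρ σ = tr ρ :=
  tendsto_nhds_unique (tendsto_formulaQ t hρ hσ one_pos (Or.inr h))
    (tendsto_formulaQ_order_one t hρ hσ)

lemma limQ_petz_one (hρ : 0 ≤ ρ) (hσ : 0 ≤ σ) :
    limQ .petz 1 ρ σ = tr ρ - tr (ρ * kerProj σ) := by
  simp only [limQ]
  rw [sub_self, gpow_one hρ, gpow_zero (.of_nonneg hσ), mul_sub, mul_one, tr_sub]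

lemma limQ_sandwiched_one (hρ : 0 ≤ ρ) (hσ : 0 ≤ σ) :
    limQ .sandwiched 1 ρ σ = tr ρ - tr (ρ * kerProj σ) := by
  simp only [limQ]
  rw [sub_self, zero_div, CFC.rpow_one _ (sandwich_nonneg hσ _), tr_sandwich hρ, gpow_one hρ,
    gpow_zero (.of_nonneg hσ), mul_sub, mul_one, tr_sub]

lemma differentiableAt_limQ_petz (hρ : 0 ≤ ρ) (hσ : 0 ≤ σ) :
    DifferentiableAt ℝ (fun a => limQ .petz a ρ σ) 1 := by
  have h1 : Differentiable ℝ fun a : ℝ => (a, 1 - a) := by fun_prop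
  exact ((differentiable_tr_gpow_mul_gpow hρ hσ).comp h1) 1

lemma differentiableAt_limQ_sandwiched (hρ : 0 ≤ ρ) (hσ : 0 ≤ σ) :
    DifferentiableAt ℝ (fun a => limQ .sandwiched a ρ σ) 1 := by
  simp only [limQ, tr_sandwich_rpow hσ]
  have h0 : DifferentiableAt ℝ (fun a : ℝ => (1 - a) / a) 1 := by
    refine DifferentiableAt.div (by fun_prop) (by fun_prop) one_ne_zero
  refine differentiableAt_tr_cfc_rpow (fun a => sandwich_nonneg hσ _) ?_ ?_
  · exact ContinuousAt.comp (f := fun a : ℝ => (1 - a) / a)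
      (continuous_sandwich hσ).continuousAt h0.continuousAt
  · simp only [tr_sandwich hρ]
    exact DifferentiableAt.comp (f := fun a : ℝ => ((1 : ℝ), (1 - a) / a)) 1
      ((differentiable_tr_gpow_mul_gpow hρ hσ) _) ((differentiableAt_const _).prodMk h0)

lemma tendsto_limQ_petz_zero (hρ : 0 ≤ ρ) (hσ : 0 ≤ σ) :
    ∃ q, Tendsto (fun a => limQ .petz a ρ σ) (𝓝[>] 0) (𝓝 q) := by
  have h1 : Continuous fun a : ℝ => (a, 1 - a) := by fun_prop
  have h2 := ((differentiable_tr_gpow_mul_gpow hρ hσ).continuous.comp h1).tendsto 0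
  exact ⟨_, h2.mono_left nhdsWithin_le_nhds⟩

/-- This makes ρ^{1/2} σ^{-1} ρ^{1/2} nonzero, so that the logarithm of its norm is the finite limit
of the sandwiched divergence up to a vanishing term. -/
lemma SuppLE.tr_gpow_neg_one_pos (h : SuppLE ρ σ) (hρ : 0 ≤ ρ) (h0 : ρ ≠ 0) (hσ : 0 ≤ σ) :
    0 < tr (gpow 1 ρ * gpow (-1) σ) := by
  obtain ⟨b, x, hb⟩ := IsSpectralBasis.exists (IsSelfAdjoint.of_nonneg hρ)
  obtain ⟨c, y, hc⟩ := IsSpectralBasis.exists (IsSelfAdjoint.of_nonneg hσ)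
  have hx0 : ∀ i, 0 ≤ x i := fun i => spectrum_nonneg hρ (hb.mem i)
  have hy0 : ∀ i, 0 ≤ y i := fun i => spectrum_nonneg hσ (hc.mem i)
  rw [tr_gpow_mul_gpow_eq_sum hb hc]
  have hnn : ∀ i j, 0 ≤ (if x i = 0 then 0 else x i ^ (1 : ℝ)) *
      (if y j = 0 then 0 else y j ^ (-1 : ℝ)) * ‖inner ℂ (c j) (b i)‖ ^ 2 := by
    intro i j
    have := Real.rpow_nonneg (hx0 i) 1
    have := Real.rpow_nonneg (hy0 j) (-1)
    split_ifs <;> positivity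
  have hi : ∃ i, x i ≠ 0 := by
    by_contra! hcon
    have := tr_pos hρ h0
    rw [hb.tr_self] at this
    simp [hcon] at this
  obtain ⟨i, hi⟩ := hi
  refine Finset.sum_pos' (fun i _ => Finset.sum_nonneg fun j _ => hnn i j) ⟨i, Finset.mem_univ _, ?_⟩
  have hj : ∃ j, ‖inner ℂ (c j) (b i)‖ ^ 2 ≠ 0 := by
    by_contra! hcon
    have := sum_sq_norm_inner_eq_one c (b.orthonormal.1 i)
    simp [hcon] at this
  obtain ⟨j, hj⟩ := hj
  have hyj : y j ≠ 0 := fun hy => hj (h.inner_eq_zero hρ hb hc hi hy)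
  refine Finset.sum_pos' (fun j _ => hnn i j) ⟨j, Finset.mem_univ _, ?_⟩
  simp only [hi, hyj, if_false]
  have h1 : 0 < x i := (hx0 i).lt_of_ne hi.symm
  have h2 : 0 < y j := (hy0 j).lt_of_ne hyj.symm
  have h3 : 0 < ‖inner ℂ (c j) (b i)‖ ^ 2 := lt_of_le_of_ne (by positivity) hj.symm
  positivity

lemma exists_qf_eq_norm [Nontrivial H] (hA : 0 ≤ A) : ∃ v : H, ‖v‖ = 1 ∧ qf A v = ‖A‖ := by
  obtain ⟨b, x, hb⟩ := IsSpectralBasis.exists (IsSelfAdjoint.of_nonneg hA)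
  obtain ⟨i, hi⟩ := hb.surj _ (CStarAlgebra.norm_mem_spectrum_of_nonneg hA)
  exact ⟨b i, b.orthonormal.1 i, by rw [hb.qf_self, hi]⟩

lemma tendsto_div_sub_one : Tendsto (fun a : ℝ => a / (a - 1)) atTop (𝓝 1) := by
  have h1 : Tendsto (fun a : ℝ => 1 + 1 / (a - 1)) atTop (𝓝 (1 + 0)) := by
    refine Tendsto.const_add _ ?_
    simp only [one_div]
    exact tendsto_inv_atTop_zero.comp (tendsto_atTop_add_const_right _ (-1) tendsto_id)
  rw [add_zero] at h1
  refine h1.congr' ?_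
  filter_upwards [eventually_gt_atTop 1] with a ha
  have : a - 1 ≠ 0 := by linarith
  field_simp
  ring

lemma tendsto_const_div_sub_one (c : ℝ) : Tendsto (fun a : ℝ => c / (a - 1)) atTop (𝓝 0) :=
  tendsto_const_nhds.div_atTop (tendsto_atTop_add_const_right _ (-1) tendsto_id)

/-- The operators X(a) converge to Y = ρ^{1/2} σ^{-1} ρ^{1/2}, and Tr X(a) ^ a lies between (form of
X(a) at v) ^ a and dim H · ‖X(a)‖ ^ a, where v attains the norm of Y. Both bounds have exponential
rate log ‖Y‖. -/
lemma tendsto_log_limQ_sandwiched [Nontrivial H] (hρ : 0 ≤ ρ) (h0 : ρ ≠ 0) (hσ : 0 ≤ σ)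
    (h : SuppLE ρ σ) : (∀ᶠ a in atTop, 0 < limQ .sandwiched a ρ σ) ∧
      ∃ d : ℝ, Tendsto (fun a => Real.log (limQ .sandwiched a ρ σ) / (a - 1)) atTop (𝓝 d) := by
  set X : ℝ → H →L[ℂ] H := fun a => sandwich ((1 - a) / a) ρ σ with hX
  set Y := sandwich (-1) ρ σ with hY
  have hXnn : ∀ a, 0 ≤ X a := fun a => sandwich_nonneg hσ _
  have hYnn : 0 ≤ Y := sandwich_nonneg hσ _
  have hlim : Tendsto X atTop (𝓝 Y) := by
    have h1 : Tendsto (fun a : ℝ => (1 - a) / a) atTop (𝓝 (-1)) := by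
      have h2 : Tendsto (fun a : ℝ => a⁻¹ - 1) atTop (𝓝 (0 - 1)) :=
        tendsto_inv_atTop_zero.sub_const 1
      rw [zero_sub] at h2
      refine h2.congr' ?_
      filter_upwards [eventually_gt_atTop 0] with a ha
      field_simp
    exact ((continuous_sandwich hσ).tendsto _).comp h1
  have hYne : Y ≠ 0 := by
    intro hY0
    have := h.tr_gpow_neg_one_pos hρ h0 hσ
    rw [← tr_sandwich hρ, ← hY, hY0] at this
    simp [tr] at this
  have hm : 0 < ‖Y‖ := norm_pos_iff.2 hYne
  obtain ⟨v, hv, hvY⟩ := exists_qf_eq_norm hYnn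
  have hq : Tendsto (fun a => qf (X a) v) atTop (𝓝 ‖Y‖) := by
    rw [← hvY]
    exact ((continuous_qf v).tendsto _).comp hlim
  have hn : Tendsto (fun a => ‖X a‖) atTop (𝓝 ‖Y‖) := (continuous_norm.tendsto _).comp hlim
  have hqpos : ∀ᶠ a in atTop, 0 < qf (X a) v := (tendsto_order.1 hq).1 0 hm
  have hlow : ∀ᶠ a in atTop, qf (X a) v ^ a ≤ limQ .sandwiched a ρ σ := by
    filter_upwards [eventually_ge_atTop 1] with a ha
    simp only [limQ]
    rw [rpow_eq_cfc (hXnn a)]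
    refine (le_qf_cfc (convexOn_rpow ha) (.of_nonneg (hXnn a)) (spectrum_nonneg (hXnn a)) hv).trans
      (qf_le_tr ?_ hv)
    exact cfc_nonneg' fun x hx => Real.rpow_nonneg (spectrum_nonneg (hXnn a) hx) _
  let d : ℝ := Fintype.card (Fin (Module.finrank ℂ H))
  have hup : ∀ᶠ a in atTop, limQ .sandwiched a ρ σ ≤ d * ‖X a‖ ^ a := by
    filter_upwards [eventually_ge_atTop 0] with a ha
    obtain ⟨b, x, hb⟩ := IsSpectralBasis.exists (IsSelfAdjoint.of_nonneg (hXnn a))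
    simp only [limQ]
    rw [tr_rpow_eq_sum (hXnn a) hb]
    refine (Finset.sum_le_card_nsmul Finset.univ _ (‖X a‖ ^ a) fun i _ => ?_).trans_eq ?_
    · exact Real.rpow_le_rpow (spectrum_nonneg (hXnn a) (hb.mem i))
        (le_norm_of_mem_spectrum (hb.mem i)) ha
    · simp [d]
  have hpos : ∀ᶠ a in atTop, 0 < limQ .sandwiched a ρ σ := by
    filter_upwards [hqpos, hlow] with a h1 h2
    exact (Real.rpow_pos_of_pos h1 a).trans_le h2
  have hd : 0 < d := by
    have : 0 < Module.finrank ℂ H := Module.finrank_pos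
    simpa [d] using this
  refine ⟨hpos, Real.log ‖Y‖, ?_⟩
  have hl1 : Tendsto (fun a => a / (a - 1) * Real.log (qf (X a) v)) atTop
      (𝓝 (1 * Real.log ‖Y‖)) := tendsto_div_sub_one.mul (hq.log hm.ne')
  have hl2 : Tendsto (fun a => Real.log d / (a - 1) + a / (a - 1) * Real.log ‖X a‖) atTop
      (𝓝 (0 + 1 * Real.log ‖Y‖)) :=
    (tendsto_const_div_sub_one _).add (tendsto_div_sub_one.mul (hn.log hm.ne'))
  rw [one_mul] at hl1
  rw [zero_add, one_mul] at hl2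
  refine tendsto_of_tendsto_of_tendsto_of_le_of_le' hl1 hl2 ?_ ?_
  · filter_upwards [hqpos, hlow, eventually_gt_atTop 1] with a h1 h2 h3
    have h4 := Real.log_le_log (Real.rpow_pos_of_pos h1 a) h2
    rw [Real.log_rpow h1] at h4
    rw [div_mul_eq_mul_div]
    have : 0 < a - 1 := by linarith
    gcongr
  · filter_upwards [hpos, hup, eventually_gt_atTop 1, (tendsto_order.1 hn).1 0 hm]
      with a h1 h2 h3 h5
    have h4 := Real.log_le_log h1 h2
    rw [Real.log_mul hd.ne' (Real.rpow_pos_of_pos h5 a).ne', Real.log_rpow h5] at h4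
    rw [div_mul_eq_mul_div, ← add_div]
    have : 0 < a - 1 := by linarith
    gcongr

end OrderLimits

/-! ### Dependence on α for the log-Euclidean family, and the strict gap at α = 1 -/

section FlatOrder

variable {H : Type*} [NormedAddCommGroup H] [InnerProductSpace ℂ H] [CompleteSpace H]
  [FiniteDimensional ℂ H] {A B ρ σ K M : H →L[ℂ] H}

/-- Klein's inequality in both directions traps the first-order remainder at `a` between 0 and (c -
a)(g(c) - g(a)), which is o(c - a) because g is continuous. -/
lemma differentiable_tr_exp_affine {Z V : H →L[ℂ] H} (hZ : IsSelfAdjoint Z)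
    (hV : IsSelfAdjoint V) : Differentiable ℝ fun a : ℝ => tr (NormedSpace.exp (Z + a • V)) := by
  intro a
  have hsa : ∀ c : ℝ, IsSelfAdjoint (Z + c • V) := fun c => hZ.add (isSelfAdjoint_smul_real _ hV)
  let g : ℝ → ℝ := fun c => tr (NormedSpace.exp (Z + c • V) * V)
  have hg : Tendsto g (𝓝 a) (𝓝 (g a)) := by
    have h1 : Tendsto (fun c : ℝ => Z + c • V) (𝓝 a) (𝓝 (Z + a • V)) := by
      have : Continuous fun c : ℝ => Z + c • V := by fun_prop
      exact this.tendsto a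
    have h2 := tendsto_cfc_op Real.continuous_exp h1 (hsa a) (Eventually.of_forall hsa)
    simp only [g, exp_eq_cfc (hsa _)]
    exact (continuous_tr.tendsto _).comp (h2.mul_const V)
  have hklein : ∀ c d : ℝ, tr (NormedSpace.exp (Z + c • V)) + (d - c) * g c ≤
      tr (NormedSpace.exp (Z + d • V)) := by
    intro c d
    have h := klein_exp (hsa d) (hsa c)
    rwa [show Z + d • V - (Z + c • V) = (d - c) • V by module, mul_smul_comm, tr_smul] at h
  have hO : (fun c : ℝ => (c - a) * (g c - g a)) =o[𝓝 a] fun c => c - a := by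
    have h5 := (Asymptotics.isLittleO_one_iff ℝ).2 (by simpa using hg.sub_const (g a))
    simpa using (Asymptotics.isBigO_refl (fun c : ℝ => c - a) (𝓝 a)).mul_isLittleO h5
  refine HasDerivAt.differentiableAt (f' := g a) ?_
  rw [hasDerivAt_iff_isLittleO]
  refine Asymptotics.IsBigO.trans_isLittleO (Asymptotics.IsBigO.of_norm_le fun c => ?_) hO
  have h1 := hklein a c
  have h2 := hklein c a
  rw [Real.norm_eq_abs, smul_eq_mul, abs_of_nonneg (by linarith)]
  linarith

/-- Off the range of the projection the exponential is the identity. Subtracting that constant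
leaves the trace of a full exponential, to which differentiability along affine families applies. -/
lemma flatQ_eq (α : ℝ) (ρ σ : H →L[ℂ] H) :
    flatQ α ρ σ = tr (NormedSpace.exp (kerProj (kerSum ρ σ) *
      (α • CFC.log ρ + (1 - α) • CFC.log σ) * kerProj (kerSum ρ σ))) -
        tr (1 - kerProj (kerSum ρ σ)) := by
  have h := tr_exp_add_kerProj (isSelfAdjoint_kerSum ρ σ) (isSelfAdjoint_flat α ρ σ) 0 0
  rw [zero_smul, zero_smul, add_zero, add_zero, Real.exp_zero, one_mul, one_mul] at h
  rw [h, flatQ]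
  ring

lemma differentiable_limQ_flat (ρ σ : H →L[ℂ] H) :
    Differentiable ℝ fun a => limQ .flat a ρ σ := by
  set P := kerProj (kerSum ρ σ) with hP
  have h := differentiable_tr_exp_affine
    (isSelfAdjoint_conj (isSelfAdjoint_kerProj (kerSum ρ σ)) (isSelfAdjoint_log σ))
    (isSelfAdjoint_conj (isSelfAdjoint_kerProj (kerSum ρ σ))
      ((isSelfAdjoint_log ρ).sub (isSelfAdjoint_log σ)))
  have h2 : (fun a => limQ .flat a ρ σ) = fun a : ℝ => tr (NormedSpace.exp
      (P * CFC.log σ * P + a • (P * (CFC.log ρ - CFC.log σ) * P))) - tr (1 - P) := by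
    funext a
    simp only [limQ]
    rw [flatQ_eq]
    congr 3
    rw [← hP, ← smul_mul_assoc, ← mul_smul_comm, ← add_mul, ← mul_add]
    congr 2
    module
  rw [h2]
  exact h.sub_const _

lemma kerProj_kerSum_mul_kerProj (ρ σ : H →L[ℂ] H) :
    kerProj (kerSum ρ σ) * kerProj ρ = 0 ∧ kerProj (kerSum ρ σ) * kerProj σ = 0 := by
  obtain ⟨h1, h2⟩ := kerProj_mul_kerProj_kerSum ρ σ
  constructor
  · have := congrArg star h1
    rwa [star_mul, (isSelfAdjoint_kerProj _).star_eq, (isSelfAdjoint_kerProj _).star_eq,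
      star_zero] at this
  · have := congrArg star h2
    rwa [star_mul, (isSelfAdjoint_kerProj _).star_eq, (isSelfAdjoint_kerProj _).star_eq,
      star_zero] at this

/-- The intersection of the supports lies inside supp ρ, and `E` projects onto what is left. If `E`
were zero, supp ρ would equal the intersection and so lie in supp σ. -/
lemma tr_kerProj_lt (hρ : 0 ≤ ρ) (h : ¬ SuppLE ρ σ) :
    tr (kerProj ρ) < tr (1 - kerProj (kerSum ρ σ)) := by
  set P := kerProj (kerSum ρ σ) with hP
  obtain ⟨h1, h2⟩ := kerProj_mul_kerProj_kerSum ρ σ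
  obtain ⟨h3, h4⟩ := kerProj_kerSum_mul_kerProj ρ σ
  rw [← hP] at h1 h2 h3 h4
  have hPP : P * P = P := kerProj_mul_self _
  have hkk : kerProj ρ * kerProj ρ = kerProj ρ := kerProj_mul_self _
  set E := 1 - P - kerProj ρ with hE
  have hEs : IsSelfAdjoint E :=
    ((IsSelfAdjoint.one _).sub (isSelfAdjoint_kerProj _)).sub (isSelfAdjoint_kerProj _)
  have hEE : E * E = E := by
    simp only [hE, mul_sub, sub_mul, mul_one, one_mul, hPP, hkk, h1, h3]
    abel
  have hE0 : 0 ≤ E := by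
    have := star_mul_self_nonneg E
    rwa [hEs.star_eq, hEE] at this
  have hEne : E ≠ 0 := by
    intro h0
    refine h ?_
    have h5 : ρ * kerProj σ = 0 := by
      have h6 : ρ * kerProj ρ = 0 := self_mul_kerProj (.of_nonneg hρ)
      have h7 : kerProj σ = P * kerProj σ + kerProj ρ * kerProj σ := by
        have : (1 : H →L[ℂ] H) = P + kerProj ρ := by
          rw [hE, sub_sub, sub_eq_zero] at h0
          exact h0
        rw [← add_mul, ← this, one_mul]
      rw [h7, h4, zero_add, ← mul_assoc, h6, zero_mul]
    rw [SuppLE, h5]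
    simp [tr]
  have := tr_pos hE0 hEne
  rw [hE, tr_sub] at this
  linarith

lemma tr_exp_log_add_kerProj (hρ : 0 ≤ ρ) (c : ℝ) :
    tr (NormedSpace.exp (CFC.log ρ + c • kerProj ρ)) = tr ρ + Real.exp c * tr (kerProj ρ) := by
  have hs := IsSelfAdjoint.of_nonneg hρ
  have h1 : CFC.log ρ + c • kerProj ρ =
      cfc (fun x : ℝ => if x = 0 then c else Real.log x) ρ := by
    rw [log_eq_cfc, kerProj, cfc_smul', cfc_add']
    exact cfc_congr fun x _ => by by_cases hx : x = 0 <;> simp [hx]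
  have h2 : NormedSpace.exp (CFC.log ρ + c • kerProj ρ) = ρ + Real.exp c • kerProj ρ := by
    rw [h1, exp_eq_cfc (isSelfAdjoint_cfc _ _), cfc_cfc _ _ hs]
    conv_rhs => enter [1]; rw [← cfc_id' ℝ ρ]
    rw [kerProj, cfc_smul', cfc_add']
    refine cfc_congr fun x hx => ?_
    have := spectrum_nonneg hρ hx
    by_cases h0 : x = 0
    · simp [h0]
    · simp [h0, Real.exp_log (this.lt_of_ne (Ne.symm h0))]
  rw [h2, tr_add, tr_smul]

lemma limQ_flat_one_lt (hρ : 0 ≤ ρ) (h : ¬ SuppLE ρ σ) :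
    limQ .flat 1 ρ σ < tr ρ := by
  have hlt := tr_kerProj_lt hρ h
  obtain ⟨h1, -⟩ := kerProj_mul_kerProj_kerSum ρ σ
  obtain ⟨h3, -⟩ := kerProj_kerSum_mul_kerProj ρ σ
  set P := kerProj (kerSum ρ σ) with hP
  have hPP : P * P = P := kerProj_mul_self _
  have hPs : IsSelfAdjoint P := isSelfAdjoint_kerProj _
  set L := CFC.log ρ with hL
  have hLs : IsSelfAdjoint L := isSelfAdjoint_log ρ
  set N := P * L * P with hN
  have hNs : IsSelfAdjoint N := isSelfAdjoint_conj hPs hLs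
  have hPN : P * N = N := by rw [hN, ← mul_assoc, ← mul_assoc, hPP]
  have hNP : N * P = N := by rw [hN, mul_assoc, hPP]
  have hfl : limQ .flat 1 ρ σ = tr (P * NormedSpace.exp N) := by
    simp only [limQ, flatQ]
    rw [sub_self, zero_smul, add_zero, one_smul]
  -- Klein's inequality compares log ρ + c · (projection on ker ρ) with the compression of log ρ to
  -- the intersection of supports plus c on its complement. The block of the difference on the
  -- intersection vanishes, leaving only terms with factor e^c.
  have key : ∀ c : ℝ, limQ .flat 1 ρ σ + Real.exp c * (tr (1 - P) + tr ((1 - P) * L) +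
      c * (tr (kerProj ρ) - tr (1 - P))) ≤ tr ρ + Real.exp c * tr (kerProj ρ) := by
    intro c
    have hX : IsSelfAdjoint (L + c • kerProj ρ) :=
      hLs.add (isSelfAdjoint_smul_real _ (isSelfAdjoint_kerProj _))
    have hZ : IsSelfAdjoint (N + ((0 : ℝ) • P + c • (1 - P))) :=
      hNs.add ((isSelfAdjoint_smul_real _ hPs).add
        (isSelfAdjoint_smul_real _ ((IsSelfAdjoint.one _).sub hPs)))
    have hk := klein_exp hX hZ
    rw [tr_exp_log_add_kerProj hρ] at hk
    have hex := exp_add_kerProj (isSelfAdjoint_kerSum ρ σ) hLs 0 c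
    have htr := tr_exp_add_kerProj (isSelfAdjoint_kerSum ρ σ) hLs 0 c
    rw [← hP, ← hN, Real.exp_zero] at hex htr
    rw [one_smul] at hex
    rw [one_mul, ← hfl] at htr
    set Y := L + c • kerProj ρ - (N + ((0 : ℝ) • P + c • (1 - P))) with hY
    have hPY : P * Y * P = 0 := by
      have h5 : P * Y = P * L - N := by
        simp only [hY, mul_sub, mul_add, mul_smul_comm, h3, hPN, hPP, mul_one]
        simp
      rw [h5, sub_mul, hNP, ← hN, sub_self]
    have hcomm : NormedSpace.exp N * P = P * NormedSpace.exp N * P := by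
      have h6 : Commute N P := by rw [Commute, SemiconjBy, hNP, hPN]
      have h7 : NormedSpace.exp N * P = P * NormedSpace.exp N := by
        rw [exp_eq_cfc hNs]
        exact h6.cfc_real _
      rw [← h7, mul_assoc, hPP]
    have hz1 : tr (NormedSpace.exp N * P * Y) = 0 := by
      rw [hcomm, mul_assoc, mul_assoc, tr_mul_comm, mul_assoc, mul_assoc, ← mul_assoc P, hPY,
        mul_zero]
      simp [tr]
    have hz2 : tr ((1 - P) * Y) = tr ((1 - P) * L) + c * (tr (kerProj ρ) - tr (1 - P)) := by
      have h8 : (1 - P) * Y = (1 - P) * L + c • (kerProj ρ - (1 - P)) := by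
        simp only [hY, sub_mul, mul_sub, mul_add, mul_smul_comm, h3, hPN, hPP, mul_one, one_mul]
        module
      rw [h8, tr_add, tr_smul, tr_sub]
    rw [htr, hex, add_mul, tr_add, hz1, smul_mul_assoc, tr_smul, hz2] at hk
    linarith
  set e := tr (1 - P) - tr (kerProj ρ) with he
  have he0 : 0 < e := by linarith
  -- This value of c cancels the term containing log ρ, leaving the strictly positive gap `Real.exp
  -- c * e`.
  have h9 := key ((tr ((1 - P) * L)) / e)
  have h10 : tr ((1 - P) * L) / e * (tr (kerProj ρ) - tr (1 - P)) = - tr ((1 - P) * L) := by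
    rw [show tr (kerProj ρ) - tr (1 - P) = -e by rw [he]; ring]
    field_simp
  rw [h10] at h9
  have h11 := mul_pos (Real.exp_pos (tr ((1 - P) * L) / e)) he0
  rw [he, mul_sub] at h11
  linarith

lemma limQ_one_lt (t : Family) (hρ : 0 ≤ ρ) (hσ : 0 ≤ σ) (h : ¬ SuppLE ρ σ) :
    limQ t 1 ρ σ < tr ρ := by
  have hpos : 0 < tr (ρ * kerProj σ) := (tr_mul_kerProj_nonneg hρ).lt_of_ne (Ne.symm h)
  cases t
  · rw [limQ_petz_one hρ hσ]; linarith
  · rw [limQ_sandwiched_one hρ hσ]; linarith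
  · exact limQ_flat_one_lt hρ h

lemma differentiableAt_limQ (t : Family) (hρ : 0 ≤ ρ) (hσ : 0 ≤ σ) :
    DifferentiableAt ℝ (fun a => limQ t a ρ σ) 1 := by
  cases t
  · exact differentiableAt_limQ_petz hρ hσ
  · exact differentiableAt_limQ_sandwiched hρ hσ
  · exact differentiable_limQ_flat ρ σ 1

lemma tendsto_limQ_flat_zero (ρ σ : H →L[ℂ] H) :
    ∃ q, Tendsto (fun a => limQ .flat a ρ σ) (𝓝[>] 0) (𝓝 q) :=
  ⟨_, ((differentiable_limQ_flat ρ σ).continuous.tendsto 0).mono_left nhdsWithin_le_nhds⟩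

lemma qf_ofReal_smul (A : H →L[ℂ] H) (r : ℝ) (v : H) : qf A ((r : ℂ) • v) = r ^ 2 * qf A v := by
  simp only [qf, map_smul, inner_smul_left, inner_smul_right, Complex.conj_ofReal]
  rw [← mul_assoc, ← Complex.ofReal_mul, Complex.re_ofReal_mul]
  ring

/-- The unit sphere of the range of the projection is compact and nonempty; homogeneity of degree
two extends the bound to the whole range. -/
lemma exists_max_qf_kerProj (A : H →L[ℂ] H) {B : H →L[ℂ] H} (hne : kerProj B ≠ 0) :
    ∃ v, ‖v‖ = 1 ∧ kerProj B v = v ∧ ∀ w, kerProj B w = w → qf A w ≤ qf A v * ‖w‖ ^ 2 := by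
  have hfix : ∀ w, kerProj B (kerProj B w) = kerProj B w := fun w => by
    rw [← mul_apply_eq_comp, kerProj_mul_self]
  let S : Set H := Metric.sphere 0 1 ∩ {v | kerProj B v = v}
  have hS : IsCompact S := by
    have : ProperSpace H := FiniteDimensional.proper ℂ H
    exact (isCompact_sphere 0 1).inter_right
      (isClosed_eq (kerProj B).continuous continuous_id)
  have hscale : ∀ w, w ≠ 0 → kerProj B w = w → ((‖w‖⁻¹ : ℝ) : ℂ) • w ∈ S := by
    intro w hw hw'
    refine ⟨?_, ?_⟩
    · rw [mem_sphere_zero_iff_norm, norm_smul, Complex.norm_real, norm_inv, norm_norm]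
      exact inv_mul_cancel₀ (norm_ne_zero_iff.2 hw)
    · simp only [Set.mem_ofPred_eq, map_smul, hw']
  have hSne : S.Nonempty := by
    by_contra hcon
    refine hne (ContinuousLinearMap.ext fun w => ?_)
    by_contra hw
    exact hcon ⟨_, hscale _ hw (hfix w)⟩
  obtain ⟨v, hv, hmax⟩ := hS.exists_isMaxOn hSne
    (f := fun v => qf A v) (by
      refine Continuous.continuousOn ?_
      unfold qf
      fun_prop)
  refine ⟨v, mem_sphere_zero_iff_norm.1 hv.1, hv.2, fun w hw => ?_⟩
  by_cases h0 : w = 0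
  · simp [h0, qf]
  have h1 : qf A (((‖w‖⁻¹ : ℝ) : ℂ) • w) ≤ qf A v := hmax (hscale w h0 hw)
  rw [qf_ofReal_smul, inv_pow] at h1
  have h2 : 0 < ‖w‖ ^ 2 := by positivity
  rwa [inv_mul_le_iff₀ h2, mul_comm] at h1

/-- If the supports met only in zero, the sum of the kernel projections would be at least k > 0.
Both projections vanish on supp ρ because ker σ ⊆ ker ρ, so supp ρ would be zero. -/
lemma SuppLE.kerProj_kerSum_ne_zero (h : SuppLE ρ σ) (hρ : 0 ≤ ρ) (h0 : ρ ≠ 0) (hσ : 0 ≤ σ) :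
    kerProj (kerSum ρ σ) ≠ 0 := by
  intro hP
  obtain ⟨k, hk, hle⟩ := exists_pos_smul_one_sub_kerProj_le (kerSum_nonneg ρ σ)
  rw [hP, sub_zero] at hle
  refine h0 ?_
  have hk1 : kerProj ρ = 1 := by
    refine ContinuousLinearMap.ext fun v => ?_
    set w := (1 - kerProj ρ) v with hw
    have h1 : qf (kerProj ρ) w = 0 := by
      rw [qf_kerProj]
      have : kerProj ρ w = 0 := by
        rw [hw, ← mul_apply_eq_comp, mul_sub, mul_one, kerProj_mul_self, sub_self]
        simp
      rw [this]
      simp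
    have h2 := qf_mono (h.kerProj_le hρ hσ) w
    have h3 := qf_mono hle w
    rw [kerSum, qf_add, h1, qf_smul, qf_one] at h3
    have h4 : ‖w‖ ^ 2 = 0 := by nlinarith [sq_nonneg ‖w‖]
    have h5 : w = 0 := by simpa using h4
    rw [hw] at h5
    have h6 : v - kerProj ρ v = 0 := by simpa using h5
    rw [← sub_eq_zero.1 h6]
    simp
  have := self_mul_kerProj (IsSelfAdjoint.of_nonneg hρ)
  rwa [hk1, mul_one] at this

/-- On the intersection of the supports the exponent is log σ + a (log ρ - log σ). Its growth rate
in `a` is therefore the maximum `y` of the form of log ρ - log σ over unit vectors there; testing at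
a maximizer and bounding the whole compression give matching rates. -/
lemma tendsto_log_limQ_flat (hρ : 0 ≤ ρ) (h0 : ρ ≠ 0) (hσ : 0 ≤ σ) (h : SuppLE ρ σ) :
    (∀ᶠ a in atTop, 0 < limQ .flat a ρ σ) ∧
      ∃ d : ℝ, Tendsto (fun a => Real.log (limQ .flat a ρ σ) / (a - 1)) atTop (𝓝 d) := by
  have hne := h.kerProj_kerSum_ne_zero hρ h0 hσ
  set L := CFC.log ρ
  set B := CFC.log σ
  obtain ⟨v, hv, hPv, hmax⟩ := exists_max_qf_kerProj (L - B) hne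
  set P := kerProj (kerSum ρ σ) with hP
  have hPs : IsSelfAdjoint P := isSelfAdjoint_kerProj _
  have hPP : P * P = P := kerProj_mul_self _
  set y := qf (L - B) v
  have hqf : ∀ (a : ℝ) w, qf (P * (a • L + (1 - a) • B) * P) w =
      qf B (P w) + a * qf (L - B) (P w) := by
    intro a w
    rw [qf_conj hPs, ← qf_smul, ← qf_add]
    congr 1
    module
  have hZ : ∀ a : ℝ, IsSelfAdjoint (P * (a • L + (1 - a) • B) * P) := fun a =>
    isSelfAdjoint_conj hPs (isSelfAdjoint_flat a ρ σ)
  have hlow : ∀ a, Real.exp (qf B v + a * y) ≤ limQ .flat a ρ σ := by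
    intro a
    set Z := P * (a • L + (1 - a) • B) * P with hZdef
    have h1 := le_qf_cfc convexOn_exp (hZ a) (Set.subset_univ _) hv
    rw [hqf, hPv, ← exp_eq_cfc (hZ a)] at h1
    refine h1.trans ?_
    have h2 : qf (NormedSpace.exp Z) v = qf (P * NormedSpace.exp Z * P) v := by
      rw [qf_conj hPs, hPv]
    rw [h2]
    refine (qf_le_tr ?_ hv).trans_eq ?_
    · have := conj_mono hPs (isStrictlyPositive_exp (hZ a)).nonneg
      simpa using this
    · rw [tr_mul_comm, ← mul_assoc, hPP]
      rfl
  have hup : ∀ a, 0 ≤ a → limQ .flat a ρ σ ≤ Real.exp (‖B‖ + a * y) * tr P := by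
    intro a ha
    have h1 : P * (a • L + (1 - a) • B) * P ≤
        P * 0 * P + ((‖B‖ + a * y) • P + (0 : ℝ) • (1 - P)) := by
      rw [mul_zero, zero_mul, zero_add, zero_smul, add_zero]
      refine le_of_qf_le (hZ a) (isSelfAdjoint_smul_real _ hPs) fun w => ?_
      rw [hqf, qf_smul, qf_kerProj]
      have h2 := hmax (P w) (by rw [← mul_apply_eq_comp, hPP])
      have h3 := (abs_le.1 (qf_abs_le B (P w))).2
      have h4 := mul_le_mul_of_nonneg_left h2 ha
      linarith
    have hsa : IsSelfAdjoint (P * 0 * P + ((‖B‖ + a * y) • P + (0 : ℝ) • (1 - P))) := by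
      rw [mul_zero, zero_mul, zero_add, zero_smul, add_zero]
      exact isSelfAdjoint_smul_real _ hPs
    have h5 := tr_exp_mono (hZ a) hsa h1
    rw [tr_exp_add_kerProj (isSelfAdjoint_kerSum ρ σ) (IsSelfAdjoint.zero _), ← hP, mul_zero,
      zero_mul, NormedSpace.exp_zero, mul_one, Real.exp_zero, one_mul] at h5
    have h6 := flatQ_eq a ρ σ
    simp only [limQ]
    rw [h6]
    linarith
  have hpos : ∀ a, 0 < limQ .flat a ρ σ := fun a => (Real.exp_pos _).trans_le (hlow a)
  have htP : 0 < tr P := by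
    have h1 := hup 0 le_rfl
    have h2 := (hpos 0).trans_le h1
    exact pos_of_mul_pos_right h2 (Real.exp_pos _).le
  refine ⟨Eventually.of_forall hpos, y, ?_⟩
  have hl1 : Tendsto (fun a => qf B v / (a - 1) + a / (a - 1) * y) atTop (𝓝 (0 + 1 * y)) :=
    (tendsto_const_div_sub_one _).add (tendsto_div_sub_one.mul_const y)
  have hl2 : Tendsto (fun a => (‖B‖ + Real.log (tr P)) / (a - 1) + a / (a - 1) * y) atTop
      (𝓝 (0 + 1 * y)) :=
    (tendsto_const_div_sub_one _).add (tendsto_div_sub_one.mul_const y)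
  rw [zero_add, one_mul] at hl1 hl2
  refine tendsto_of_tendsto_of_tendsto_of_le_of_le' hl1 hl2 ?_ ?_
  · filter_upwards [eventually_gt_atTop 1] with a h1
    have h4 := Real.log_le_log (Real.exp_pos _) (hlow a)
    rw [Real.log_exp] at h4
    rw [div_mul_eq_mul_div, ← add_div]
    have : 0 < a - 1 := by linarith
    gcongr
  · filter_upwards [eventually_gt_atTop 1] with a h1
    have h4 := Real.log_le_log (hpos a) (hup a (by linarith))
    rw [Real.log_mul (Real.exp_pos _).ne' htP.ne', Real.log_exp] at h4
    rw [div_mul_eq_mul_div, ← add_div]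
    have : 0 < a - 1 := by linarith
    gcongr
    linarith

end FlatOrder

/-! ### Passing to the limit in extended-real inequalities -/

section Extended

/-- The requirement c ≠ 0 avoids the discontinuity of multiplication at 0 · ∞; subtracting a finite
limit is always continuous. -/
lemma tendsto_coe_mul_sub_coe {ι : Type*} {l : Filter ι} {f : ι → EReal} {x : EReal} {c k : ℝ}
    {u v : ι → ℝ} (hf : Tendsto f l (𝓝 x)) (hu : Tendsto u l (𝓝 c)) (hv : Tendsto v l (𝓝 k))
    (hc : c ≠ 0) :
    Tendsto (fun i => (u i : EReal) * f i - (v i : EReal)) l (𝓝 ((c : EReal) * x - (k : EReal))) := by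
  have hu' : Tendsto (fun i => (u i : EReal)) l (𝓝 (c : EReal)) :=
    (continuous_coe_real_ereal.tendsto _).comp hu
  have hv' : Tendsto (fun i => ((-v i : ℝ) : EReal)) l (𝓝 ((-k : ℝ) : EReal)) :=
    (continuous_coe_real_ereal.tendsto _).comp hv.neg
  have h1 : Tendsto (fun i => (u i : EReal) * f i) l (𝓝 ((c : EReal) * x)) :=
    EReal.Tendsto.mul hu' hf (Or.inl (by exact_mod_cast hc)) (Or.inl (by exact_mod_cast hc))
      (Or.inl (EReal.coe_ne_bot c)) (Or.inl (EReal.coe_ne_top c))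
  have h2 := (EReal.continuousAt_add (p := ((c : EReal) * x, ((-k : ℝ) : EReal)))
    (Or.inr (EReal.coe_ne_bot _)) (Or.inr (EReal.coe_ne_top _))).tendsto.comp
      (h1.prodMk_nhds hv')
  refine (h2.congr fun i => ?_).trans_eq ?_
  · simp [sub_eq_add_neg]
  · simp [sub_eq_add_neg]

/-- Addition in `EReal` is continuous away from the pairs ∞ + (-∞), and these cannot occur when
neither limit is -∞. -/
lemma le_of_tendsto_comb {ι : Type*} {l : Filter ι} [l.NeBot] {f f₁ f₂ : ι → EReal}
    {x x₁ x₂ : EReal} {a b : ℝ} (ha : 0 < a) (hb : 0 < b)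
    (h : ∀ᶠ i in l, f i ≤ (a : EReal) * f₁ i + (b : EReal) * f₂ i)
    (hf : Tendsto f l (𝓝 x)) (hf₁ : Tendsto f₁ l (𝓝 x₁)) (hf₂ : Tendsto f₂ l (𝓝 x₂))
    (hx₁ : x₁ ≠ ⊥) (hx₂ : x₂ ≠ ⊥) : x ≤ (a : EReal) * x₁ + (b : EReal) * x₂ := by
  have key : ∀ {c : ℝ} {y : EReal} {g : ι → EReal}, 0 < c → Tendsto g l (𝓝 y) → y ≠ ⊥ →
      Tendsto (fun i => (c : EReal) * g i) l (𝓝 ((c : EReal) * y)) ∧ (c : EReal) * y ≠ ⊥ := by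
    intro c y g hc hg hy
    constructor
    · have := tendsto_coe_mul_sub_coe (k := 0) hg (tendsto_const_nhds (x := c))
        tendsto_const_nhds hc.ne'
      simpa using this
    · induction y with
      | bot => exact absurd rfl hy
      | top => rw [EReal.coe_mul_top_of_pos hc]; exact top_ne_bot
      | coe r => exact_mod_cast EReal.coe_ne_bot (c * r)
  obtain ⟨h1, h1'⟩ := key ha hf₁ hx₁
  obtain ⟨h2, h2'⟩ := key hb hf₂ hx₂
  refine le_of_tendsto_of_tendsto hf ?_ h
  exact (EReal.continuousAt_add (p := ((a : EReal) * x₁, (b : EReal) * x₂))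
    (Or.inr h2') (Or.inl h1')).tendsto.comp (h1.prodMk_nhds h2)

end Extended

/-! ### Values and convexity for fixed α > 0, α ≠ 1 -/

section Values

variable {H : Type*} [NormedAddCommGroup H] [InnerProductSpace ℂ H] [CompleteSpace H]
  [FiniteDimensional ℂ H] {ρ σ : H →L[ℂ] H} {t : Family} {α : ℝ}

lemma posOp_comb {σ₁ σ₂ : H →L[ℂ] H} (h₁ : σ₁ ∈ posOp H) (h₂ : σ₂ ∈ posOp H) {a b : ℝ}
    (ha : 0 < a) (hb : 0 < b) : a • σ₁ + b • σ₂ ∈ posOp H := by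
  have h3 : 0 ≤ a • σ₁ := smul_nonneg ha.le h₁.1
  have h4 : 0 ≤ b • σ₂ := smul_nonneg hb.le h₂.1
  refine ⟨add_nonneg h3 h4, fun h0 => ?_⟩
  have h5 := tr_pos h₁.1 h₁.2
  have h6 := tr_pos h₂.1 h₂.2
  have h7 : tr (a • σ₁ + b • σ₂) = 0 := by rw [h0]; simp [tr]
  rw [tr_add, tr_smul, tr_smul] at h7
  have := mul_pos ha h5
  have := mul_pos hb h6
  linarith

lemma nontrivial_of_mem_posOp (hρ : ρ ∈ posOp H) : Nontrivial H := by
  by_contra h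
  rw [not_nontrivial_iff_subsingleton] at h
  exact hρ.2 (Subsingleton.elim _ _)

lemma tendsto_regQ_of_suppLE (t : Family) (hρ : 0 ≤ ρ) (hσ : 0 ≤ σ) (hα : 0 < α)
    (h : α < 1 ∨ SuppLE ρ σ) :
    Tendsto (regQ t α ρ σ) (𝓝[>] 0) (𝓝 (ENNReal.ofReal (limQ t α ρ σ))) :=
  ENNReal.tendsto_ofReal (tendsto_formulaQ t hρ hσ hα h)

lemma tendsto_regQ_one (t : Family) (hρ : 0 ≤ ρ) (hσ : 0 ≤ σ) :
    Tendsto (regQ t 1 ρ σ) (𝓝[>] 0) (𝓝 (ENNReal.ofReal (tr ρ))) :=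
  ENNReal.tendsto_ofReal (tendsto_formulaQ_order_one t hρ hσ)

lemma tendsto_regQ_of_not_suppLE (t : Family) (hρ : 0 ≤ ρ) (hσ : 0 ≤ σ) (hα : 1 < α)
    (h : ¬ SuppLE ρ σ) : Tendsto (regQ t α ρ σ) (𝓝[>] 0) (𝓝 ⊤) :=
  ENNReal.tendsto_ofReal_atTop.comp (tendsto_formulaQ_atTop t hρ hσ hα h)

lemma posQ_eq_ofReal (t : Family) (hρ : 0 ≤ ρ) (hσ : 0 ≤ σ) (hα : 0 < α)
    (h : α < 1 ∨ SuppLE ρ σ) : posQ t α ρ σ = ENNReal.ofReal (limQ t α ρ σ) :=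
  (tendsto_regQ_of_suppLE t hρ hσ hα h).limUnder_eq

lemma posQ_one (t : Family) (hρ : 0 ≤ ρ) (hσ : 0 ≤ σ) :
    posQ t 1 ρ σ = ENNReal.ofReal (tr ρ) :=
  (tendsto_regQ_one t hρ hσ).limUnder_eq

lemma posQ_eq_top (t : Family) (hρ : 0 ≤ ρ) (hσ : 0 ≤ σ) (hα : 1 < α) (h : ¬ SuppLE ρ σ) :
    posQ t α ρ σ = ⊤ :=
  (tendsto_regQ_of_not_suppLE t hρ hσ hα h).limUnder_eq

lemma tendsto_regQ (t : Family) (hρ : 0 ≤ ρ) (hσ : 0 ≤ σ) (hα : 0 < α) :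
    Tendsto (regQ t α ρ σ) (𝓝[>] 0) (𝓝 (posQ t α ρ σ)) := by
  refine tendsto_nhds_limUnder ?_
  rcases lt_trichotomy α 1 with h | rfl | h
  · exact ⟨_, tendsto_regQ_of_suppLE t hρ hσ hα (Or.inl h)⟩
  · exact ⟨_, tendsto_regQ_one t hρ hσ⟩
  · by_cases hS : SuppLE ρ σ
    · exact ⟨_, tendsto_regQ_of_suppLE t hρ hσ hα (Or.inr hS)⟩
    · exact ⟨_, tendsto_regQ_of_not_suppLE t hρ hσ h hS⟩

lemma posQ_ne_top (t : Family) (hρ : 0 ≤ ρ) (hσ : 0 ≤ σ) (hα : 0 < α) (h : α < 1) :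
    posQ t α ρ σ ≠ ⊤ := by
  rw [posQ_eq_ofReal t hρ hσ hα (Or.inl h)]
  exact ENNReal.ofReal_ne_top

/-- Comparison of `σ` with a multiple of the identity keeps `Q` away from zero. -/
lemma limQ_pos (hα : α ∈ convexityRange t) (h1 : 1 < α) (hρ : ρ ∈ posOp H) (hσ : 0 ≤ σ)
    (h : SuppLE ρ σ) : 0 < limQ t α ρ σ := by
  have := nontrivial_of_mem_posOp hρ
  obtain ⟨v, hv, hvρ⟩ := exists_qf_eq_norm hρ.1
  have hm : 0 < ‖ρ‖ := norm_pos_iff.2 hρ.2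
  -- The margin 2 keeps M - (σ + ε) strictly positive for all ε < 1, so one constant serves every
  -- small ε.
  set M := ‖σ‖ + 2
  have hM0 : 0 < M := by positivity
  have hlow : ∀ᶠ ε : ℝ in 𝓝[>] 0, Real.exp ((1 - α) * Real.log M) * ‖ρ‖ ^ α ≤
      formulaQ t α (ρ + ε • (1 : H →L[ℂ] H)) (σ + ε • (1 : H →L[ℂ] H)) := by
    filter_upwards [Ioo_mem_nhdsGT (zero_lt_one (α := ℝ))] with ε hε
    have hρε := isStrictlyPositive_add_smul_one hρ.1 hε.1
    have hσε := isStrictlyPositive_add_smul_one hσ hε.1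
    have hMσ : IsStrictlyPositive (M • (1 : H →L[ℂ] H) - (σ + ε • (1 : H →L[ℂ] H))) := by
      have h2 : M • (1 : H →L[ℂ] H) - (σ + ε • (1 : H →L[ℂ] H)) =
          (‖σ‖ • (1 : H →L[ℂ] H) - σ) + (2 - ε) • (1 : H →L[ℂ] H) := by
        simp only [M]; module
      rw [h2]
      exact isStrictlyPositive_add_smul_one
        (sub_nonneg.2 (le_norm_smul_one (.of_nonneg hσ))) (by linarith [hε.2])
    have hb := log_formulaQ_le hα (by linarith) h1.ne' hρε hσε hMσ hM0
    have hq := formulaQ_pos t α hρε hσε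
    set q := formulaQ t α (ρ + ε • (1 : H →L[ℂ] H)) (σ + ε • (1 : H →L[ℂ] H))
    -- Testing on a norm-attaining vector of ρ gives a positive lower bound independent of ε.
    have h3 : ‖ρ‖ ^ α ≤ tr ((ρ + ε • (1 : H →L[ℂ] H)) ^ α) := by
      have h4 : ‖ρ‖ ≤ qf (ρ + ε • (1 : H →L[ℂ] H)) v := by
        rw [qf_add, qf_smul, qf_one, hvρ, hv]
        linarith [hε.1]
      refine (Real.rpow_le_rpow hm.le h4 (by linarith)).trans ?_
      rw [rpow_eq_cfc hρε.nonneg]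
      refine (le_qf_cfc (convexOn_rpow h1.le) (.of_nonneg hρε.nonneg)
        (spectrum_nonneg hρε.nonneg) hv).trans (qf_le_tr ?_ hv)
      exact cfc_nonneg' fun x hx => Real.rpow_nonneg (spectrum_nonneg hρε.nonneg hx) _
    have hT : 0 < tr ((ρ + ε • (1 : H →L[ℂ] H)) ^ α) := (Real.rpow_pos_of_pos hm α).trans_le h3
    have hneg : 1 - α < 0 := by linarith
    have h5 := mul_le_mul_of_nonpos_left hb hneg.le
    rw [mul_add, ← mul_assoc, ← mul_assoc, mul_one_div_cancel hneg.ne, one_mul, one_mul] at h5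
    calc _ ≤ Real.exp ((1 - α) * Real.log M) * tr ((ρ + ε • (1 : H →L[ℂ] H)) ^ α) := by gcongr
      _ = Real.exp ((1 - α) * Real.log M + Real.log (tr ((ρ + ε • (1 : H →L[ℂ] H)) ^ α))) := by
          rw [Real.exp_add, Real.exp_log hT]
      _ ≤ Real.exp (Real.log q) := Real.exp_le_exp.2 h5
      _ = q := Real.exp_log hq
  have hlim := ge_of_tendsto (tendsto_formulaQ t hρ.1 hσ (by linarith) (Or.inr h)) hlow
  exact lt_of_lt_of_le (by positivity) hlim

lemma posQ_ne_zero (hα : α ∈ convexityRange t) (h1 : 1 < α) (hρ : ρ ∈ posOp H) (hσ : 0 ≤ σ) :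
    posQ t α ρ σ ≠ 0 := by
  by_cases hS : SuppLE ρ σ
  · rw [posQ_eq_ofReal t hρ.1 hσ (by linarith) (Or.inr hS)]
    exact (ENNReal.ofReal_pos.2 (limQ_pos hα h1 hρ hσ hS)).ne'
  · rw [posQ_eq_top t hρ.1 hσ h1 hS]
    exact ENNReal.top_ne_zero

lemma comb_add_smul_one (σ₁ σ₂ : H →L[ℂ] H) {a b : ℝ} (hab : a + b = 1) (ε : ℝ) :
    a • σ₁ + b • σ₂ + ε • (1 : H →L[ℂ] H) =
      a • (σ₁ + ε • (1 : H →L[ℂ] H)) + b • (σ₂ + ε • (1 : H →L[ℂ] H)) := by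
  rw [smul_add, smul_add, smul_smul, smul_smul, add_add_add_comm, ← add_smul, ← add_mul, hab,
    one_mul]

lemma convexOnPosOp_mul_posQ (hρ : ρ ∈ posOp H) (hα : α ∈ convexityRange t) (h0 : 0 < α)
    (h1 : α ≠ 1) : ConvexOnPosOp fun σ : H →L[ℂ] H => (s α : EReal) * (posQ t α ρ σ : EReal) := by
  have := nontrivial_of_mem_posOp hρ
  intro σ₁ h₁ σ₂ h₂ a b ha hb hab
  have hlim : ∀ σ : H →L[ℂ] H, σ ∈ posOp H → Tendsto (fun ε => (s α : EReal) * (regQ t α ρ σ ε : EReal))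
      (𝓝[>] 0) (𝓝 ((s α : EReal) * (posQ t α ρ σ : EReal))) := by
    intro σ hσ
    have h2 : s α ≠ 0 := by unfold s; split_ifs <;> norm_num
    have := tendsto_coe_mul_sub_coe (k := 0) ((continuous_coe_ennreal_ereal.tendsto _).comp
      (tendsto_regQ t hρ.1 hσ.1 h0)) (tendsto_const_nhds (x := s α)) tendsto_const_nhds h2
    simpa using this
  have hbot : ∀ σ : H →L[ℂ] H, σ ∈ posOp H → (s α : EReal) * (posQ t α ρ σ : EReal) ≠ ⊥ := by
    intro σ hσ
    unfold s
    split_ifs with h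
    · simp
    · rw [posQ_eq_ofReal t hρ.1 hσ.1 h0 (Or.inl (not_le.1 h)), EReal.coe_ennreal_ofReal,
        ← EReal.coe_mul]
      exact EReal.coe_ne_bot _
  refine le_of_tendsto_comb ha hb ?_ (hlim _ (posOp_comb h₁ h₂ ha hb)) (hlim _ h₁) (hlim _ h₂)
    (hbot _ h₁) (hbot _ h₂)
  filter_upwards [self_mem_nhdsWithin] with ε hε
  have hρε := isStrictlyPositive_add_smul_one hρ.1 hε
  have hσ₁ := isStrictlyPositive_add_smul_one h₁.1 hε
  have hσ₂ := isStrictlyPositive_add_smul_one h₂.1 hε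
  have hσ := isStrictlyPositive_comb hσ₁ hσ₂ ha hb
  simp only [regQ, EReal.coe_ennreal_ofReal]
  rw [comb_add_smul_one _ _ hab, max_eq_left (formulaQ_pos t α hρε hσ).le,
    max_eq_left (formulaQ_pos t α hρε hσ₁).le, max_eq_left (formulaQ_pos t α hρε hσ₂).le]
  norm_cast
  rcases lt_or_gt_of_ne h1 with h | h
  · have := formulaQ_comb_ge hα h0 h hρε hσ₁ hσ₂ ha hb hab
    simp only [s, not_le.2 h, if_false]
    linarith
  · have := formulaQ_comb_le hα h hρε hσ₁ hσ₂ ha hb hab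
    simp only [s, h.le, if_true]
    linarith

/-- For α < 1 the factor `c` is negative and Q is finite; for α > 1 it is positive and Q is nonzero.
Either way -∞ is excluded. -/
lemma mul_log_posQ_sub_ne_bot (hρ : ρ ∈ posOp H) (hα : α ∈ convexityRange t) (h0 : 0 < α)
    (h1 : α ≠ 1) {c : ℝ} (hc : 0 < c * (α - 1)) (k : ℝ) (hσ : σ ∈ posOp H) :
    (c : EReal) * ENNReal.log (posQ t α ρ σ) - (k : EReal) ≠ ⊥ := by
  have key : (c : EReal) * ENNReal.log (posQ t α ρ σ) ≠ ⊥ := by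
    rcases lt_or_gt_of_ne h1 with h | h
    · have hc' : c < 0 := by nlinarith
      have h2 : ENNReal.log (posQ t α ρ σ) ≠ ⊤ := by
        rw [Ne, ENNReal.log_eq_top_iff]
        exact posQ_ne_top t hρ.1 hσ.1 h0 h
      induction hx : ENNReal.log (posQ t α ρ σ) with
      | bot => rw [EReal.coe_mul_bot_of_neg hc']; exact top_ne_bot
      | top => exact absurd hx h2
      | coe r => exact_mod_cast EReal.coe_ne_bot (c * r)
    · have hc' : 0 < c := by nlinarith
      have h2 : ENNReal.log (posQ t α ρ σ) ≠ ⊥ := by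
        rw [Ne, ENNReal.log_eq_bot_iff]
        exact posQ_ne_zero hα h hρ hσ.1
      induction hx : ENNReal.log (posQ t α ρ σ) with
      | bot => exact absurd hx h2
      | top => rw [EReal.coe_mul_top_of_pos hc']; exact top_ne_bot
      | coe r => exact_mod_cast EReal.coe_ne_bot (c * r)
  rw [sub_eq_add_neg, ← EReal.coe_neg, Ne, EReal.add_eq_bot_iff]
  rintro (h | h)
  · exact key h
  · exact EReal.coe_ne_bot _ h

/-- The parameters cover ψ (`c = s α`, `k = 0`) and D (`c = 1 / (α - 1)`) at once. The sign
condition says that c log Q is a negative multiple of the concave function (1 - α)⁻¹ log Q. -/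
lemma convexOnPosOp_mul_log_posQ (hρ : ρ ∈ posOp H) (hα : α ∈ convexityRange t) (h0 : 0 < α)
    (h1 : α ≠ 1) {c : ℝ} (hc : 0 < c * (α - 1)) (k : ℝ) :
    ConvexOnPosOp fun σ : H →L[ℂ] H =>
      (c : EReal) * ENNReal.log (posQ t α ρ σ) - (k : EReal) := by
  have := nontrivial_of_mem_posOp hρ
  have hc0 : c ≠ 0 := by rintro rfl; simp at hc
  intro σ₁ h₁ σ₂ h₂ a b ha hb hab
  have hlim : ∀ σ : H →L[ℂ] H, σ ∈ posOp H →
      Tendsto (fun ε => (c : EReal) * ENNReal.log (regQ t α ρ σ ε) - (k : EReal))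
      (𝓝[>] 0) (𝓝 ((c : EReal) * ENNReal.log (posQ t α ρ σ) - (k : EReal))) := fun σ hσ =>
    tendsto_coe_mul_sub_coe ((ENNReal.continuous_log.tendsto _).comp
      (tendsto_regQ t hρ.1 hσ.1 h0)) tendsto_const_nhds tendsto_const_nhds hc0
  refine le_of_tendsto_comb ha hb ?_ (hlim _ (posOp_comb h₁ h₂ ha hb)) (hlim _ h₁) (hlim _ h₂)
    (mul_log_posQ_sub_ne_bot hρ hα h0 h1 hc k h₁) (mul_log_posQ_sub_ne_bot hρ hα h0 h1 hc k h₂)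
  filter_upwards [self_mem_nhdsWithin] with ε hε
  have hρε := isStrictlyPositive_add_smul_one hρ.1 hε
  have hσ₁ := isStrictlyPositive_add_smul_one h₁.1 hε
  have hσ₂ := isStrictlyPositive_add_smul_one h₂.1 hε
  have hσ := isStrictlyPositive_comb hσ₁ hσ₂ ha hb
  simp only [regQ]
  rw [comb_add_smul_one _ _ hab, ENNReal.log_ofReal_of_pos (formulaQ_pos t α hρε hσ),
    ENNReal.log_ofReal_of_pos (formulaQ_pos t α hρε hσ₁),
    ENNReal.log_ofReal_of_pos (formulaQ_pos t α hρε hσ₂)]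
  norm_cast
  have h2 := log_formulaQ_comb_ge hα h0 h1 hρε hσ₁ hσ₂ ha hb hab
  have h3 : ∀ y : ℝ, c * y = -(c * (α - 1) * (1 / (1 - α) * y)) := by
    intro y
    have : 1 - α ≠ 0 := sub_ne_zero.2 h1.symm
    field_simp
    ring
  have h4 := mul_le_mul_of_nonneg_left h2 hc.le
  rw [h3, h3 (Real.log (formulaQ t α (ρ + ε • (1 : H →L[ℂ] H)) (σ₁ + ε • (1 : H →L[ℂ] H)))),
    h3 (Real.log (formulaQ t α (ρ + ε • (1 : H →L[ℂ] H)) (σ₂ + ε • (1 : H →L[ℂ] H))))]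
  have h5 : k = a * k + b * k := by rw [← add_mul, hab, one_mul]
  linarith

end Values

/-! ### The limits of α at 0, 1 and ∞ -/

section Orders

variable {H : Type*} [NormedAddCommGroup H] [InnerProductSpace ℂ H] [CompleteSpace H]
  [FiniteDimensional ℂ H] {ρ σ : H →L[ℂ] H} {t : Family} {α : ℝ}

lemma exists_tendsto_posQ_zero (h0 : (0 : ℝ) ∈ convexityRange t) (hρ : 0 ≤ ρ) (hσ : 0 ≤ σ) :
    ∃ q : ℝ, Tendsto (fun a => posQ t a ρ σ) (𝓝[>] 0) (𝓝 (ENNReal.ofReal q)) := by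
  have h1 : ∃ q, Tendsto (fun a => limQ t a ρ σ) (𝓝[>] 0) (𝓝 q) := by
    cases t
    · exact tendsto_limQ_petz_zero hρ hσ
    · have : (1 / 2 : ℝ) ≤ 0 := h0
      norm_num at this
    · exact tendsto_limQ_flat_zero ρ σ
  obtain ⟨q, hq⟩ := h1
  refine ⟨q, (ENNReal.tendsto_ofReal hq).congr' ?_⟩
  filter_upwards [Ioo_mem_nhdsGT (zero_lt_one (α := ℝ))] with a ha
  exact (posQ_eq_ofReal t hρ hσ ha.1 (Or.inl ha.2)).symm

lemma Q_of_ne_zero (h : α ≠ 0) : Q t α ρ σ = posQ t α ρ σ := if_neg h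

lemma tendsto_Q_zero (h0 : (0 : ℝ) ∈ convexityRange t) (hρ : 0 ≤ ρ) (hσ : 0 ≤ σ) :
    Tendsto (fun a => posQ t a ρ σ) (𝓝[>] 0) (𝓝 (Q t 0 ρ σ)) ∧ Q t 0 ρ σ ≠ ⊤ := by
  obtain ⟨q, hq⟩ := exists_tendsto_posQ_zero h0 hρ hσ
  have h1 : Q t 0 ρ σ = ENNReal.ofReal q := by
    rw [Q, if_pos rfl]
    exact hq.limUnder_eq
  rw [h1]
  exact ⟨hq, ENNReal.ofReal_ne_top⟩

lemma qLimitExists (hα : α ∈ convexityRange t) (hα0 : 0 ≤ α) (hρ : 0 ≤ ρ) (hσ : 0 ≤ σ) :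
    QLimitExists t α ρ σ := by
  unfold QLimitExists
  split_ifs with h
  · rw [h] at hα
    exact ⟨_, (tendsto_Q_zero hα hρ hσ).1⟩
  · exact ⟨_, tendsto_regQ t hρ hσ (hα0.lt_of_ne (Ne.symm h))⟩

lemma genericD_eq (h : α ≠ 0) : genericD t α ρ σ =
    ((1 / (α - 1) : ℝ) : EReal) * ENNReal.log (posQ t α ρ σ) -
      ((1 / (α - 1) * Real.log (tr ρ) : ℝ) : EReal) := by
  rw [genericD, psi, Q_of_ne_zero h]

lemma genericD_eq_coe (h : α ≠ 0) {q : ℝ} (hq : 0 < q) (hQ : posQ t α ρ σ = ENNReal.ofReal q) :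
    genericD t α ρ σ = (((Real.log q - Real.log (tr ρ)) / (α - 1) : ℝ) : EReal) := by
  rw [genericD_eq h, hQ, ENNReal.log_ofReal_of_pos hq]
  norm_cast
  ring

lemma genericD_eq_top (t : Family) (hρ : 0 ≤ ρ) (hσ : 0 ≤ σ) (hα : 1 < α) (h : ¬ SuppLE ρ σ) :
    genericD t α ρ σ = ⊤ := by
  rw [genericD_eq (by linarith), posQ_eq_top t hρ hσ hα h, ENNReal.log_top,
    EReal.coe_mul_top_of_pos (one_div_pos.2 (by linarith)), EReal.top_sub_coe]

lemma tendsto_genericD_zero (h0 : (0 : ℝ) ∈ convexityRange t) (hρ : 0 ≤ ρ) (hσ : 0 ≤ σ) :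
    ∃ d, d ≠ ⊥ ∧ Tendsto (fun a => genericD t a ρ σ) (𝓝[>] 0) (𝓝 d) := by
  obtain ⟨h1, h2⟩ := tendsto_Q_zero h0 hρ hσ
  have h3 : Tendsto (fun a : ℝ => 1 / (a - 1)) (𝓝[>] 0) (𝓝 (-1)) := by
    have h4 : ContinuousAt (fun a : ℝ => 1 / (a - 1)) 0 :=
      ContinuousAt.div (by fun_prop) (by fun_prop) (by norm_num)
    have h5 := h4.tendsto
    norm_num at h5
    simpa using h5.mono_left nhdsWithin_le_nhds
  have h6 := tendsto_coe_mul_sub_coe ((ENNReal.continuous_log.tendsto _).comp h1) h3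
    (h3.mul_const (Real.log (tr ρ))) (by norm_num)
  refine ⟨_, ?_, h6.congr' ?_⟩
  · rw [Ne, ← ENNReal.log_eq_top_iff] at h2
    induction hx : ENNReal.log (Q t 0 ρ σ) with
    | bot =>
      rw [EReal.coe_mul_bot_of_neg (by norm_num), EReal.top_sub_coe]
      exact top_ne_bot
    | top => exact absurd hx h2
    | coe r => exact_mod_cast EReal.coe_ne_bot _
  · filter_upwards [self_mem_nhdsWithin] with a ha
    rw [genericD_eq (ne_of_gt ha)]
    rfl

/-- Since `limQ` at 1 equals Tr ρ, the divergence is the slope of log `limQ` between 1 and `a`, and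
it converges to the derivative. -/
lemma tendsto_genericD_one_of_suppLE (t : Family) (hρ : ρ ∈ posOp H) (hσ : 0 ≤ σ)
    (h : SuppLE ρ σ) :
    ∃ d : ℝ, Tendsto (fun a => genericD t a ρ σ) (𝓝[≠] 1) (𝓝 (d : EReal)) := by
  have hd := differentiableAt_limQ t hρ.1 hσ
  have h1 := limQ_one_of_suppLE t hρ.1 hσ h
  have htr := tr_pos hρ.1 hρ.2
  have hpos : ∀ᶠ a in 𝓝 (1 : ℝ), 0 < limQ t a ρ σ :=
    (tendsto_order.1 hd.continuousAt.tendsto).1 0 (by rw [h1]; exact htr)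
  have hs := hasDerivAt_iff_tendsto_slope.1 (hd.log (by rw [h1]; exact htr.ne')).hasDerivAt
  refine ⟨_, ((continuous_coe_real_ereal.tendsto _).comp hs).congr' ?_⟩
  filter_upwards [hpos.filter_mono nhdsWithin_le_nhds,
    (lt_mem_nhds (zero_lt_one (α := ℝ))).filter_mono nhdsWithin_le_nhds] with a h2 h3
  rw [genericD_eq_coe h3.ne' h2 (posQ_eq_ofReal t hρ.1 hσ h3 (Or.inr h)), Function.comp_apply,
    slope_def_field, h1]

lemma tendsto_genericD_one_of_not_suppLE (t : Family) (hρ : ρ ∈ posOp H) (hσ : 0 ≤ σ)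
    (h : ¬ SuppLE ρ σ) : Tendsto (fun a => genericD t a ρ σ) (𝓝[≠] 1) (𝓝 ⊤) := by
  rw [← Set.Iio_union_Ioi, nhdsWithin_union, tendsto_sup]
  constructor
  · have htr := tr_pos hρ.1 hρ.2
    -- On the left of 1 the numerator log Q - log Tr ρ must stay below a negative constant while a -
    -- 1 ↗ 0. The maximum with 0 keeps `r` positive so that its logarithm is meaningful.
    obtain ⟨r, hr1, hr2⟩ := exists_between (max_lt htr (limQ_one_lt t hρ.1 hσ h))
    have hr0 : 0 < r := (le_max_left _ _).trans_lt hr1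
    have hlt : ∀ᶠ a in 𝓝 (1 : ℝ), limQ t a ρ σ < r :=
      (tendsto_order.1 (differentiableAt_limQ t hρ.1 hσ).continuousAt.tendsto).2 r
        ((le_max_right _ _).trans_lt hr1)
    have hlog : Real.log r - Real.log (tr ρ) < 0 := sub_neg.2 (Real.log_lt_log hr0 hr2)
    have hlim : Tendsto (fun a : ℝ => (Real.log r - Real.log (tr ρ)) / (a - 1)) (𝓝[<] 1)
        atTop := by
      have h2 : Tendsto (fun a : ℝ => a - 1) (𝓝[<] 1) (𝓝[<] 0) := by
        refine tendsto_nhdsWithin_iff.2 ⟨?_, ?_⟩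
        · have : Tendsto (fun a : ℝ => a - 1) (𝓝 1) (𝓝 (1 - 1)) :=
            (continuous_id.sub continuous_const).tendsto 1
          rw [sub_self] at this
          exact this.mono_left nhdsWithin_le_nhds
        · filter_upwards [self_mem_nhdsWithin] with a ha
          exact sub_neg.2 (Set.mem_Iio.1 ha)
      simp only [div_eq_mul_inv]
      exact (tendsto_inv_nhdsLT_zero.comp h2).const_mul_atBot_of_neg hlog
    refine tendsto_of_tendsto_of_tendsto_of_le_of_le' (EReal.tendsto_coe_atTop.comp hlim)
      tendsto_const_nhds ?_ (Eventually.of_forall fun _ => le_top)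
    filter_upwards [hlt.filter_mono nhdsWithin_le_nhds, self_mem_nhdsWithin,
      (lt_mem_nhds (zero_lt_one (α := ℝ))).filter_mono nhdsWithin_le_nhds] with a h2 h3 h4
    have h5 : a - 1 < 0 := sub_neg.2 h3
    have hQ := posQ_eq_ofReal t hρ.1 hσ h4 (Or.inl h3)
    -- Q may vanish for α < 1, for instance with orthogonal supports; then D is already ∞.
    rcases le_or_gt (limQ t a ρ σ) 0 with h6 | h6
    · rw [genericD_eq h4.ne', hQ, ENNReal.log_ofReal, if_pos h6,
        EReal.coe_mul_bot_of_neg (one_div_neg.2 h5), EReal.top_sub_coe]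
      exact le_top
    · rw [genericD_eq_coe h4.ne' h6 hQ]
      have h7 := Real.log_le_log h6 h2.le
      exact EReal.coe_le_coe_iff.2 (div_le_div_of_nonpos_of_le h5.le (by linarith))
  · refine tendsto_const_nhds.congr' ?_
    filter_upwards [self_mem_nhdsWithin] with a ha
    exact (genericD_eq_top t hρ.1 hσ ha h).symm

lemma tendsto_genericD_one (t : Family) (hρ : ρ ∈ posOp H) (hσ : 0 ≤ σ) :
    ∃ d, d ≠ ⊥ ∧ Tendsto (fun a => genericD t a ρ σ) (𝓝[≠] 1) (𝓝 d) := by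
  by_cases h : SuppLE ρ σ
  · obtain ⟨d, hd⟩ := tendsto_genericD_one_of_suppLE t hρ hσ h
    exact ⟨d, EReal.coe_ne_bot d, hd⟩
  · exact ⟨⊤, top_ne_bot, tendsto_genericD_one_of_not_suppLE t hρ hσ h⟩

lemma D_eq_genericD (h0 : α ≠ 0) (h1 : α ≠ 1) : D t α ρ σ = genericD t α ρ σ := by
  rw [D, if_neg h0, if_neg h1]

lemma tendsto_D_atTop (ht : t ≠ .petz) (hρ : ρ ∈ posOp H) (hσ : 0 ≤ σ) :
    ∃ d, d ≠ ⊥ ∧ Tendsto (fun a => D t a ρ σ) atTop (𝓝 d) := by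
  have := nontrivial_of_mem_posOp hρ
  have hD : ∀ᶠ a : ℝ in atTop, genericD t a ρ σ = D t a ρ σ := by
    filter_upwards [eventually_gt_atTop 1] with a ha
    exact (D_eq_genericD (by linarith) ha.ne').symm
  by_cases h : SuppLE ρ σ
  · have h1 : (∀ᶠ a in atTop, 0 < limQ t a ρ σ) ∧
        ∃ d : ℝ, Tendsto (fun a => Real.log (limQ t a ρ σ) / (a - 1)) atTop (𝓝 d) := by
      cases t
      · exact absurd rfl ht
      · exact tendsto_log_limQ_sandwiched hρ.1 hρ.2 hσ h
      · exact tendsto_log_limQ_flat hρ.1 hρ.2 hσ h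
    obtain ⟨hpos, d, hd⟩ := h1
    refine ⟨((d - 0 : ℝ) : EReal), EReal.coe_ne_bot _, Tendsto.congr' hD ?_⟩
    refine ((continuous_coe_real_ereal.tendsto _).comp
      (hd.sub (tendsto_const_div_sub_one (Real.log (tr ρ))))).congr' ?_
    filter_upwards [hpos, eventually_gt_atTop 0] with a h2 h3
    rw [genericD_eq_coe h3.ne' h2 (posQ_eq_ofReal t hρ.1 hσ h3 (Or.inr h)), Function.comp_apply,
      sub_div]
  · refine ⟨⊤, top_ne_bot, Tendsto.congr' hD (tendsto_const_nhds.congr' ?_)⟩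
    filter_upwards [eventually_gt_atTop 1] with a ha
    exact (genericD_eq_top t hρ.1 hσ ha h).symm

lemma ConvexOnPosOp.of_tendsto {ι : Type*} {l : Filter ι} [l.NeBot]
    {f : ι → (H →L[ℂ] H) → EReal} {g : (H →L[ℂ] H) → EReal}
    (hf : ∀ᶠ i in l, ConvexOnPosOp (f i))
    (hlim : ∀ σ ∈ posOp H, Tendsto (fun i => f i σ) l (𝓝 (g σ)) ∧ g σ ≠ ⊥) :
    ConvexOnPosOp g := by
  intro σ₁ h₁ σ₂ h₂ a b ha hb hab
  refine le_of_tendsto_comb ha hb ?_ (hlim _ (posOp_comb h₁ h₂ ha hb)).1 (hlim _ h₁).1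
    (hlim _ h₂).1 (hlim _ h₁).2 (hlim _ h₂).2
  filter_upwards [hf] with i hi
  exact hi σ₁ h₁ σ₂ h₂ a b ha hb hab

lemma ConvexOnPosOp.congr {f g : (H →L[ℂ] H) → EReal} (hf : ConvexOnPosOp f)
    (h : ∀ σ ∈ posOp H, f σ = g σ) : ConvexOnPosOp g := by
  intro σ₁ h₁ σ₂ h₂ a b ha hb hab
  rw [← h _ h₁, ← h _ h₂, ← h _ (posOp_comb h₁ h₂ ha hb)]
  exact hf σ₁ h₁ σ₂ h₂ a b ha hb hab

lemma convexOnPosOp_const (r : ℝ) : ConvexOnPosOp fun _ : H →L[ℂ] H => (r : EReal) := by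
  intro σ₁ _ σ₂ _ a b _ _ hab
  have h : r = a * r + b * r := by rw [← add_mul, hab, one_mul]
  change (r : EReal) ≤ (a : EReal) * (r : EReal) + (b : EReal) * (r : EReal)
  exact_mod_cast h.le

lemma convexOnPosOp_genericD (hρ : ρ ∈ posOp H) (hα : α ∈ convexityRange t) (h0 : 0 < α)
    (h1 : α ≠ 1) : ConvexOnPosOp fun σ : H →L[ℂ] H => genericD t α ρ σ := by
  have h2 : α - 1 ≠ 0 := sub_ne_zero.2 h1
  simp only [genericD_eq h0.ne']
  exact convexOnPosOp_mul_log_posQ hρ hα h0 h1 (by rw [one_div_mul_cancel h2]; exact one_pos) _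

lemma eventually_mem_convexityRange_zero (h : (0 : ℝ) ∈ convexityRange t) :
    ∀ᶠ a : ℝ in 𝓝[>] 0, a ∈ convexityRange t ∧ 0 < a ∧ a < 1 := by
  filter_upwards [Ioo_mem_nhdsGT (zero_lt_one (α := ℝ))] with a ha
  refine ⟨?_, ha.1, ha.2⟩
  cases t
  · exact ⟨ha.1.le, by linarith [ha.2]⟩
  · have : (1 / 2 : ℝ) ≤ 0 := h
    norm_num at this
  · exact ha.1.le

lemma convexOnPosOp_Q (hρ : ρ ∈ posOp H) (hα : α ∈ convexityRange t) (hα0 : 0 ≤ α) :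
    ConvexOnPosOp fun σ : H →L[ℂ] H => (s α : EReal) * (Q t α ρ σ : EReal) := by
  rcases hα0.eq_or_lt with rfl | h0
  · refine ConvexOnPosOp.of_tendsto (l := 𝓝[>] (0 : ℝ))
      (f := fun a σ => (s a : EReal) * (posQ t a ρ σ : EReal)) ?_ fun σ hσ => ?_
    · filter_upwards [eventually_mem_convexityRange_zero hα] with a ha
      exact convexOnPosOp_mul_posQ hρ ha.1 ha.2.1 ha.2.2.ne
    · obtain ⟨h1, h2⟩ := tendsto_Q_zero hα hρ.1 hσ.1
      have hs : s 0 = -1 := if_neg (by norm_num)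
      constructor
      · have h3 := tendsto_coe_mul_sub_coe (k := 0) ((continuous_coe_ennreal_ereal.tendsto _).comp
          h1) (tendsto_const_nhds (x := s 0)) tendsto_const_nhds (by rw [hs]; norm_num)
        rw [EReal.coe_zero, sub_zero] at h3
        refine h3.congr' ?_
        filter_upwards [eventually_mem_convexityRange_zero hα] with a ha
        rw [hs, s, if_neg (not_le.2 ha.2.2)]
        simp
      · lift Q t 0 ρ σ to NNReal using h2 with q
        exact_mod_cast EReal.coe_ne_bot (s 0 * q)
  · simp only [Q_of_ne_zero h0.ne']
    by_cases h1 : α = 1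
    · subst h1
      -- At α = 1 the value Tr ρ does not depend on σ; the maximum is the form in which
      -- `ENNReal.ofReal` coerces to `EReal`.
      refine (convexOnPosOp_const (s 1 * max (tr ρ) 0)).congr fun σ hσ => ?_
      rw [posQ_one t hρ.1 hσ.1, EReal.coe_ennreal_ofReal, EReal.coe_mul]
    · exact convexOnPosOp_mul_posQ hρ hα h0 h1

lemma convexOnPosOp_psi (hρ : ρ ∈ posOp H) (hα : α ∈ convexityRange t) (hα0 : 0 ≤ α) :
    ConvexOnPosOp fun σ : H →L[ℂ] H => (s α : EReal) * psi t α ρ σ := by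
  rcases hα0.eq_or_lt with rfl | h0
  · refine ConvexOnPosOp.of_tendsto (l := 𝓝[>] (0 : ℝ))
      (f := fun a σ => ((s 0 : ℝ) : EReal) * ENNReal.log (posQ t a ρ σ) - ((0 : ℝ) : EReal))
      ?_ fun σ hσ => ?_
    · filter_upwards [eventually_mem_convexityRange_zero hα] with a ha
      refine convexOnPosOp_mul_log_posQ hρ ha.1 ha.2.1 ha.2.2.ne ?_ 0
      rw [s, if_neg (by norm_num)]
      linarith [ha.2.2]
    · obtain ⟨h1, h2⟩ := tendsto_Q_zero hα hρ.1 hσ.1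
      have hs : s 0 = -1 := if_neg (by norm_num)
      constructor
      · have h3 := tendsto_coe_mul_sub_coe (k := 0) ((ENNReal.continuous_log.tendsto _).comp
          h1) (tendsto_const_nhds (x := s 0)) tendsto_const_nhds (by rw [hs]; norm_num)
        simpa [psi] using h3
      · rw [Ne, ← ENNReal.log_eq_top_iff] at h2
        rw [psi]
        induction hx : ENNReal.log (Q t 0 ρ σ) with
        | bot =>
          rw [EReal.coe_mul_bot_of_neg (by rw [hs]; norm_num)]
          exact top_ne_bot
        | top => exact absurd hx h2
        | coe r => exact_mod_cast EReal.coe_ne_bot (s 0 * r)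
  · simp only [psi, Q_of_ne_zero h0.ne']
    by_cases h1 : α = 1
    · subst h1
      refine (convexOnPosOp_const (s 1 * Real.log (tr ρ))).congr fun σ hσ => ?_
      rw [posQ_one t hρ.1 hσ.1, ENNReal.log_ofReal_of_pos (tr_pos hρ.1 hρ.2), EReal.coe_mul]
    · have hs : 0 < s α * (α - 1) := by
        unfold s
        split_ifs with h
        · have := lt_of_le_of_ne h (Ne.symm h1)
          linarith
        · linarith
      simpa using convexOnPosOp_mul_log_posQ hρ hα h0 h1 hs 0

lemma convexOnPosOp_D (hρ : ρ ∈ posOp H) (hα : α ∈ convexityRange t) (hα0 : 0 ≤ α) :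
    ConvexOnPosOp fun σ : H →L[ℂ] H => D t α ρ σ := by
  rcases hα0.eq_or_lt with rfl | h0
  · refine ConvexOnPosOp.of_tendsto (l := 𝓝[>] (0 : ℝ)) (f := fun a σ => genericD t a ρ σ) ?_
      fun σ hσ => ?_
    · filter_upwards [eventually_mem_convexityRange_zero hα] with a ha
      exact convexOnPosOp_genericD hρ ha.1 ha.2.1 ha.2.2.ne
    · obtain ⟨d, hd, hlim⟩ := tendsto_genericD_zero hα hρ.1 hσ.1
      rw [D, if_pos rfl, hlim.limUnder_eq]
      exact ⟨hlim, hd⟩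
  by_cases h1 : α = 1
  · subst h1
    refine ConvexOnPosOp.of_tendsto (l := 𝓝[<] (1 : ℝ)) (f := fun a σ => genericD t a ρ σ) ?_
      fun σ hσ => ?_
    -- The limit at 1 is two-sided, so one side suffices; the interval (1/2, 1) lies in the range of
    -- α for all three families.
    · filter_upwards [Ioo_mem_nhdsLT (show (1 / 2 : ℝ) < 1 by norm_num)] with a ha
      refine convexOnPosOp_genericD hρ ?_ (by linarith [ha.1]) ha.2.ne
      cases t
      · exact ⟨by linarith [ha.1], by linarith [ha.2]⟩
      · exact ha.1.le
      · exact (show (0 : ℝ) ≤ a by linarith [ha.1])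
    · obtain ⟨d, hd, hlim⟩ := tendsto_genericD_one t hρ hσ.1
      rw [D, if_neg one_ne_zero, if_pos rfl, hlim.limUnder_eq]
      exact ⟨hlim.mono_left (nhdsWithin_mono _ fun a ha => ne_of_lt ha), hd⟩
  · simp only [D_eq_genericD h0.ne' h1]
    exact convexOnPosOp_genericD hρ hα h0 h1

lemma dLimitExists (hρ : ρ ∈ posOp H) (hα : α ∈ convexityRange t) (hσ : 0 ≤ σ) :
    DLimitExists t α ρ σ := by
  constructor
  · rintro rfl
    obtain ⟨d, -, hd⟩ := tendsto_genericD_zero hα hρ.1 hσ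
    exact ⟨d, hd⟩
  · rintro -
    obtain ⟨d, -, hd⟩ := tendsto_genericD_one t hρ hσ
    exact ⟨d, hd⟩

lemma convexOnPosOp_DInf (ht : t ≠ .petz) (hρ : ρ ∈ posOp H) :
    ConvexOnPosOp fun σ : H →L[ℂ] H => DInf t ρ σ := by
  refine ConvexOnPosOp.of_tendsto (l := atTop) (f := fun a σ => D t a ρ σ) ?_ fun σ hσ => ?_
  · filter_upwards [eventually_ge_atTop 1] with a ha
    refine convexOnPosOp_D hρ ?_ (by linarith)
    cases t
    · exact absurd rfl ht
    · exact (show (1 / 2 : ℝ) ≤ a by linarith)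
    · exact (show (0 : ℝ) ≤ a by linarith)
  · obtain ⟨d, hd, hlim⟩ := tendsto_D_atTop ht hρ hσ.1
    rw [DInf, hlim.limUnder_eq]
    exact ⟨hlim, hd⟩

lemma dInfLimitExists (ht : t ≠ .petz) (hρ : ρ ∈ posOp H) (hσ : 0 ≤ σ) :
    DInfLimitExists t ρ σ := by
  obtain ⟨d, -, hd⟩ := tendsto_D_atTop ht hρ hσ
  exact ⟨d, hd⟩

lemma nonneg_of_mem_convexityRange (hα : α ∈ convexityRange t) : 0 ≤ α := by
  cases t
  · exact hα.1
  · exact le_trans (by norm_num) (show (1 / 2 : ℝ) ≤ α from hα)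
  · exact hα

end Orders

end QRenyi

end

theorem mainTheorem8 {H : Type*} [NormedAddCommGroup H] [InnerProductSpace ℂ H]
    [FiniteDimensional ℂ H] [CompleteSpace H] (ρ : H →L[ℂ] H) (hρ : ρ ∈ QRenyi.posOp H) :
    (∀ t : QRenyi.Family, ∀ α ∈ QRenyi.convexityRange t,
      (∀ σ ∈ QRenyi.posOp H,
        QRenyi.QLimitExists t α ρ σ ∧ QRenyi.DLimitExists t α ρ σ) ∧
      QRenyi.ConvexOnPosOp (fun σ => (QRenyi.s α : EReal) * (QRenyi.Q t α ρ σ : EReal)) ∧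
      QRenyi.ConvexOnPosOp (fun σ => (QRenyi.s α : EReal) * QRenyi.psi t α ρ σ) ∧
      QRenyi.ConvexOnPosOp (fun σ => QRenyi.D t α ρ σ)) ∧
    ((∀ σ ∈ QRenyi.posOp H,
        QRenyi.DInfLimitExists .flat ρ σ ∧ QRenyi.DInfLimitExists .sandwiched ρ σ) ∧
      QRenyi.ConvexOnPosOp (fun σ => QRenyi.DInf .flat ρ σ) ∧
      QRenyi.ConvexOnPosOp (fun σ => QRenyi.DInf .sandwiched ρ σ)) := by
  refine ⟨fun t α hα => ?_, ?_, ?_, ?_⟩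
  · have hα0 := QRenyi.nonneg_of_mem_convexityRange hα
    exact ⟨fun σ hσ => ⟨QRenyi.qLimitExists hα hα0 hρ.1 hσ.1, QRenyi.dLimitExists hρ hα hσ.1⟩,
      QRenyi.convexOnPosOp_Q hρ hα hα0, QRenyi.convexOnPosOp_psi hρ hα hα0,
      QRenyi.convexOnPosOp_D hρ hα hα0⟩
  · exact fun σ hσ => ⟨QRenyi.dInfLimitExists (by simp) hρ hσ.1,
      QRenyi.dInfLimitExists (by simp) hρ hσ.1⟩
  · exact QRenyi.convexOnPosOp_DInf (by simp) hρ
  · exact QRenyi.convexOnPosOp_DInf (by simp) hρ
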